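/- Let $n\ge 1$, $\mu_1,\mu_2\ge 0$, $\nu_1,\nu_2\in\mathbb R$, $p,q>1$, $R>0$. For $k=1,2$ put $\delta_k=(\mu_k-1)^2-4\nu_k^2$ and $$\sigma_k=\begin{cases}\mu_k+1-\sqrt{\delta_k}&\text{if }\delta_k\in[0,1),\\ \mu_k&\text{if }\delta_k\ge 1,\end{cases}$$ and assume $\delta_1,\delta_2\ge 0$. Let $$\Lambda(d,p,q)=\frac{p+1}{pq-1}-\frac{d-1}{2},\quad \Lambda_1=\Lambda(n+\sigma_1,p,q),\quad \Lambda_2=\Lambda(n+\sigma_2,q,p),\quad \Omega=\max\{\Lambda_1,\Lambda_2\}.$$ Let $u_0,u_1,v_0,v_1:\mathbb R^n\to\mathbb R$ be nonnegative, not all identically zero, with supports contained in $\{|x|\le R\}$, and assume $u_0=0$ if $\delta_1<1$ and $v_0=0$ if $\delta_2<1$. For $\varepsilon>0$ consider the Cauchy problem $$\begin{cases}u_{tt}-\Delta u+\frac{\mu_1}{1+t}u_t+\frac{\nu_1^2}{(1+t)^2}u=|v_t|^p,& x\in\mathbb R^n,\ t>0,\\ v_{tt}-\Delta v+\frac{\mu_2}{1+t}v_t+\frac{\nu_2^2}{(1+t)^2}v=|u_t|^q,&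 x\in\mathbb R^n,\ t>0,\\ (u,u_t,v,v_t)(0,x)=\varepsilon\,(u_0,u_1,v_0,v_1)(x),& x\in\mathbb R^n,\end{cases}$$ and let its lifespan $T(\varepsilon)\in[0,\infty]$ be the supremum of all $T\in(0,\infty]$ for which it has a classical solution $u,v\in C^2([0,T)\times\mathbb R^n)$. Assume $\Omega\ge 0$. Then there are $\varepsilon_0>0$ and $C>0$ (depending on $n,p,q,\mu_1,\mu_2,\nu_1^2,\nu_2^2,R$ and the data, but not on $\varepsilon$) such that for every $\varepsilon\in(0,\varepsilon_0]$ local solutions blow up in finite time, that is, $T(\varepsilon)<\infty$. Furthermore, provided that $(u_0,u_1)\not\equiv(0,0)$ if $\Lambda_1=\Omega$ and $(v_0,v_1)\not\equiv(0,0)$ if $\Lambda_2=\Omega$ (in particular whenever both pairs are nontrivial), for every $\varepsilon\in(0,\varepsilon_0]$ $$T(\varepsilon)\le\begin{cases}C\,\varepsilon^{-1/\Omega}&\text{if }\Omega>0,\\ \exp\big(C\varepsilon^{-(pq-1)}\big)&\text{if }\Omega=0,\\ \exp\big(C\varepsilon^{-\min\{\frac{pq-1}{p+1},\frac{pq-1}{q+1}\}}\big)&\text{if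 }\Lambda_1=\Lambda_2=0.\end{cases}$$ -/

import Mathlib

open scoped ENNReal

noncomputable section

namespace ScaleInvariantSystem

/-- `δ = (μ - 1)² - 4ν²`. -/
def delta (μ ν : ℝ) : ℝ := (μ - 1) ^ 2 - 4 * ν ^ 2

/-- The shift `σ`: it is `μ + 1 - √δ` if `δ ∈ [0, 1)` and `μ` if `δ ≥ 1`
(only used for `δ ≥ 0`). -/
def shift (μ ν : ℝ) : ℝ :=
  if delta μ ν < 1 then μ + 1 - Real.sqrt (delta μ ν) else μ

/-- `Λ(d, p, q) = (p + 1) / (pq - 1) - (d - 1) / 2`, with a real "dimension" `d`. -/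
def Lam (d p q : ℝ) : ℝ := (p + 1) / (p * q - 1) - (d - 1) / 2

/-- `Ω(n, σ₁, σ₂, p, q) = max {Λ(n + σ₁, p, q), Λ(n + σ₂, q, p)}`. -/
def Om (n : ℕ) (σ₁ σ₂ p q : ℝ) : ℝ := max (Lam (n + σ₁) p q) (Lam (n + σ₂) q p)

/-- The space-time slab `[0, T) × ℝⁿ`, for `T ∈ [0, ∞]`. -/
def slab (n : ℕ) (T : ℝ≥0∞) : Set (ℝ × EuclideanSpace ℝ (Fin n)) :=
  {z | 0 ≤ z.1 ∧ ENNReal.ofReal z.1 < T}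

/-- The linear operator `w_tt - Δw + μ/(1+t) w_t + ν²/(1+t)² w`, evaluated at `(t, x)`. -/
def waveOp {n : ℕ} (μ ν : ℝ) (w : ℝ → EuclideanSpace ℝ (Fin n) → ℝ)
    (t : ℝ) (x : EuclideanSpace ℝ (Fin n)) : ℝ :=
  iteratedDeriv 2 (fun s => w s x) t - Laplacian.laplacian (w t) x
    + μ / (1 + t) * deriv (fun s => w s x) t + ν ^ 2 / (1 + t) ^ 2 * w t x

/-- `(u, v)` is a classical solution, of class `C²` on `[0, T) × ℝⁿ` with `T ∈ (0, ∞]`, of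
`u_tt - Δu + μ₁/(1+t) u_t + ν₁²/(1+t)² u = |v_t|^p`,
`v_tt - Δv + μ₂/(1+t) v_t + ν₂²/(1+t)² v = |u_t|^q`
with `(u, u_t, v, v_t) = ε (u₀, u₁, v₀, v₁)` at `t = 0`. -/
structure IsSolution {n : ℕ} (μ₁ ν₁ μ₂ ν₂ p q ε : ℝ)
    (u₀ u₁ v₀ v₁ : EuclideanSpace ℝ (Fin n) → ℝ) (T : ℝ≥0∞)
    (u v : ℝ → EuclideanSpace ℝ (Fin n) → ℝ) : Prop where
  pos : 0 < T
  contDiffOn_u : ContDiffOn ℝ 2 (fun z : ℝ × EuclideanSpace ℝ (Fin n) => u z.1 z.2) (slab n T)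
  contDiffOn_v : ContDiffOn ℝ 2 (fun z : ℝ × EuclideanSpace ℝ (Fin n) => v z.1 z.2) (slab n T)
  eq_u : ∀ t x, 0 < t → ENNReal.ofReal t < T →
    waveOp μ₁ ν₁ u t x = |deriv (fun s => v s x) t| ^ p
  eq_v : ∀ t x, 0 < t → ENNReal.ofReal t < T →
    waveOp μ₂ ν₂ v t x = |deriv (fun s => u s x) t| ^ q
  init_u : ∀ x, u 0 x = ε * u₀ x
  init_v : ∀ x, v 0 x = ε * v₀ x
  init_ut : ∀ x, HasDerivWithinAt (fun s => u s x) (ε * u₁ x) (Set.Ici 0) 0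
  init_vt : ∀ x, HasDerivWithinAt (fun s => v s x) (ε * v₁ x) (Set.Ici 0) 0

/-- The lifespan `T(ε) ∈ [0, ∞]`: the supremum of all `T` for which a classical solution on
`[0, T) × ℝⁿ` exists. -/
def lifespan {n : ℕ} (μ₁ ν₁ μ₂ ν₂ p q ε : ℝ)
    (u₀ u₁ v₀ v₁ : EuclideanSpace ℝ (Fin n) → ℝ) : ℝ≥0∞ :=
  sSup {T | ∃ u v, IsSolution μ₁ ν₁ μ₂ ν₂ p q ε u₀ u₁ v₀ v₁ T u v}

end ScaleInvariantSystem

end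

/-! The wave equations are tested against the eigenfunction `exp (l xᵢ)` of the Laplacian, with
eigenvalue `l²`, and the system is reduced to two ordinary differential inequalities.

An energy estimate in backward cones gives finite speed of propagation
(`IsSolution.eq_zero_of_lt_norm`): at time `t` the solution lives in the ball of radius `R + t`.
Hence y = ∫ u exp(l xᵢ) is well defined and solves the damped equation y'' + μ/(1+t) y' + (ν²/(1+t)²
- l²) y = N, where N is the integral of the nonlinearity against the weight (`Jet.functional_eq`,
`DampedODE`). For `l` large the term -l² y makes y and y' nonnegative. The operator is nearly a
product of two first order factors with leading parts ∂ - l and ∂ + l. Applying the second one and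
an integrating factor for the first gives a functional G (`renorm`) with G' ≥ `profile` · N; the
condition δ ≥ 0 enters here. So G never drops below its initial value, a multiple of ε, while for t
≥ 1 it is at most a constant times exp(-lt) (1+t)^(μ/2) y'.

The integral of `exp (l xᵢ)` over the ball of radius R + t is at most a constant times exp(lt)
(1+t)^((n-1)/2) (`setIntegral_expWeight_le`). Jensen's inequality therefore bounds N from below by a
power of the other functional. All exponentials cancel (`coupling_lower_bound`), and with s = 1 + t
there remain X' ≥ c s^(-A) Y^p and Y' ≥ c s^(-B) X^q (`exists_superPair`).

Such pairs blow up (`SuperPair`), and the sign of (1-A) + p(1-B) decides how fast. This number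
equals (pq-1) Λ(n+μ₁, p, q) (`couplingExponent_combination`). If it is positive, one dyadic interval
suffices; if it vanishes, X gains a fixed amount of X^(-(pq-1)) per dyadic interval, which costs
exponential time; if A = B = 1, the variable log s makes the system autonomous. Since μ ≤ σ, one has
Λ(n+σ, ·, ·) ≤ Λ(n+μ, ·, ·), so the bounds obtained with μ imply those stated with σ. -/

noncomputable section

namespace ScaleInvariantSystem

open Set Filter Topology MeasureTheory

/-! ### Classical derivatives of C² functions on a closed slab -/

/-- The partial derivatives of order at most two of a function `u` of class `C²` on
`[0, b] × ℝⁿ`; those of second order are only recorded for `0 < t < b`. -/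
structure Jet {n : ℕ} (b : ℝ) (u ut : ℝ → EuclideanSpace ℝ (Fin n) → ℝ)
    (ux : Fin n → ℝ → EuclideanSpace ℝ (Fin n) → ℝ) (utt : ℝ → EuclideanSpace ℝ (Fin n) → ℝ)
    (utx uxx : Fin n → ℝ → EuclideanSpace ℝ (Fin n) → ℝ) : Prop where
  cont : ContinuousOn (Function.uncurry u) (Icc 0 b ×ˢ univ)
  cont_t : ContinuousOn (Function.uncurry ut) (Icc 0 b ×ˢ univ)
  cont_x : ∀ i, ContinuousOn (Function.uncurry (ux i)) (Icc 0 b ×ˢ univ)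
  cont_tt : ContinuousOn (Function.uncurry utt) (Ioo 0 b ×ˢ univ)
  cont_tx : ∀ i, ContinuousOn (Function.uncurry (utx i)) (Ioo 0 b ×ˢ univ)
  cont_xx : ∀ i, ContinuousOn (Function.uncurry (uxx i)) (Ioo 0 b ×ˢ univ)
  deriv_zero : ∀ x, HasDerivWithinAt (fun s => u s x) (ut 0 x) (Icc 0 b) 0
  deriv_t : ∀ t ∈ Ioo 0 b, ∀ x, HasDerivAt (fun s => u s x) (ut t x) t
  deriv_tt : ∀ t ∈ Ioo 0 b, ∀ x, HasDerivAt (fun s => ut s x) (utt t x) t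
  deriv_xt : ∀ i, ∀ t ∈ Ioo 0 b, ∀ x, HasDerivAt (fun s => ux i s x) (utx i t x) t
  line_x : ∀ i, ∀ t ∈ Icc 0 b, ∀ x,
    HasLineDerivAt ℝ (u t) (ux i t x) x (EuclideanSpace.single i 1)
  line_tx : ∀ i, ∀ t ∈ Ioo 0 b, ∀ x,
    HasLineDerivAt ℝ (ut t) (utx i t x) x (EuclideanSpace.single i 1)
  line_xx : ∀ i, ∀ t ∈ Ioo 0 b, ∀ x,
    HasLineDerivAt ℝ (ux i t) (uxx i t x) x (EuclideanSpace.single i 1)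
  laplacian_eq : ∀ t ∈ Ioo 0 b, ∀ x, Laplacian.laplacian (u t) x = ∑ i, uxx i t x
  iteratedDeriv_eq : ∀ t ∈ Ioo 0 b, ∀ x, iteratedDeriv 2 (fun s => u s x) t = utt t x

theorem laplacian_eq_sum_of_hasLineDerivAt {n : ℕ} {f : EuclideanSpace ℝ (Fin n) → ℝ}
    {g h : Fin n → EuclideanSpace ℝ (Fin n) → ℝ} (hf : ContDiff ℝ 2 f)
    (hg : ∀ i x, HasLineDerivAt ℝ f (g i x) x (EuclideanSpace.single i 1))
    (hh : ∀ i x, HasLineDerivAt ℝ (g i) (h i x) x (EuclideanSpace.single i 1))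
    (x : EuclideanSpace ℝ (Fin n)) : Laplacian.laplacian f x = ∑ i, h i x := by
  rw [InnerProductSpace.laplacian_eq_iteratedFDeriv_orthonormalBasis f
    (EuclideanSpace.basisFun (Fin n) ℝ)]
  refine Finset.sum_congr rfl fun i _ => ?_
  rw [iteratedFDeriv_two_apply]
  simp only [EuclideanSpace.basisFun_apply, Matrix.cons_val_zero, Matrix.cons_val_one]
  have hd : Differentiable ℝ (fderiv ℝ f) :=
    (hf.fderiv_right (m := 1) (by norm_num)).differentiable (by norm_num)
  have h1 : (fun y => fderiv ℝ f y (EuclideanSpace.single i 1)) = g i := by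
    funext y
    rw [← ((hf.differentiable (by norm_num)) y).lineDeriv_eq_fderiv]
    exact (hg i y).lineDeriv
  have h2 : HasFDerivAt (fun y => fderiv ℝ f y (EuclideanSpace.single i 1))
      ((fderiv ℝ (fderiv ℝ f) x).flip (EuclideanSpace.single i 1)) x := by
    have := (hd x).hasFDerivAt.clm_apply (hasFDerivAt_const (EuclideanSpace.single i (1:ℝ)) x)
    simpa using this
  rw [h1] at h2
  have h3 := (h2.hasLineDerivAt (EuclideanSpace.single i 1)).lineDeriv
  rw [(hh i x).lineDeriv] at h3
  simpa using h3.symm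

/-- All derivatives are read off from g = `fderivWithin f S`, which is C¹ up to the boundary of the
slab because the slab has unique differentials. Second derivatives come from `fderiv g` in the
interior. Symmetry of the second derivative lets one function `utx` serve both as ∂ᵢuₜ and as ∂ₜuᵢ.
-/
theorem exists_jet {n : ℕ} {b : ℝ} (hb : 0 < b) {u : ℝ → EuclideanSpace ℝ (Fin n) → ℝ}
    (hu : ContDiffOn ℝ 2 (fun z : ℝ × EuclideanSpace ℝ (Fin n) => u z.1 z.2)
      (Icc 0 b ×ˢ univ)) :
    ∃ ut ux utt utx uxx, Jet b u ut ux utt utx uxx := by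
  set f : ℝ × EuclideanSpace ℝ (Fin n) → ℝ := fun z => u z.1 z.2 with hf
  set S : Set (ℝ × EuclideanSpace ℝ (Fin n)) := Icc 0 b ×ˢ univ with hS
  have hSu : UniqueDiffOn ℝ S := (uniqueDiffOn_Icc hb).prod uniqueDiffOn_univ
  set g := fderivWithin ℝ f S with hg
  have hgc : ContDiffOn ℝ 1 g S := hu.fderivWithin hSu (by norm_num)
  have hO : IsOpen (Ioo 0 b ×ˢ (univ : Set (EuclideanSpace ℝ (Fin n)))) := isOpen_Ioo.prod isOpen_univ
  have hOS : (Ioo 0 b ×ˢ (univ : Set (EuclideanSpace ℝ (Fin n)))) ⊆ S :=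
    prod_mono Ioo_subset_Icc_self subset_rfl
  have hnhds : ∀ t ∈ Ioo 0 b, ∀ x : EuclideanSpace ℝ (Fin n), S ∈ 𝓝 (t, x) := fun t ht x =>
    mem_of_superset (hO.mem_nhds ⟨ht, mem_univ _⟩) hOS
  have hfd : ∀ z ∈ S, HasFDerivWithinAt f (g z) S z := fun z hz =>
    ((hu.differentiableOn (by norm_num)) z hz).hasFDerivWithinAt
  have hgd : ∀ t ∈ Ioo 0 b, ∀ x : EuclideanSpace ℝ (Fin n),
      HasFDerivAt g (fderiv ℝ g (t, x)) (t, x) := fun t ht x =>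
    ((hgc.differentiableOn (by norm_num) (t, x) (hOS ⟨ht, mem_univ _⟩)).differentiableAt
      (hnhds t ht x)).hasFDerivAt
  have hgg : ContinuousOn (fderiv ℝ g) (Ioo 0 b ×ˢ univ) :=
    (hgc.mono hOS).continuousOn_fderiv_of_isOpen hO (by norm_num)
  have hsymm : ∀ t ∈ Ioo 0 b, ∀ x : EuclideanSpace ℝ (Fin n), ∀ v w,
      fderiv ℝ g (t, x) v w = fderiv ℝ g (t, x) w v := by
    intro t ht x v w
    have h1 : ContDiffAt ℝ 2 f (t, x) := hu.contDiffAt (hnhds t ht x)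
    have h2 : g =ᶠ[𝓝 (t, x)] fderiv ℝ f := by
      filter_upwards [hO.mem_nhds (mk_mem_prod ht (mem_univ x))] with z hz
      exact fderivWithin_of_mem_nhds (hnhds z.1 hz.1 z.2)
    rw [h2.fderiv_eq]
    exact (h1.isSymmSndFDerivAt (by simp)) v w
  have hline : ∀ (t : ℝ) (x v : EuclideanSpace ℝ (Fin n)),
      HasDerivAt (fun τ : ℝ => (t, x + τ • v)) ((0, v) : ℝ × EuclideanSpace ℝ (Fin n)) 0 := by
    intro t x v
    refine (hasDerivAt_const _ _).prodMk ?_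
    simpa using ((hasDerivAt_id (0 : ℝ)).smul_const v).const_add x
  have htime : ∀ (t : ℝ) (x : EuclideanSpace ℝ (Fin n)),
      HasDerivAt (fun τ : ℝ => (τ, x)) ((1, 0) : ℝ × EuclideanSpace ℝ (Fin n)) t := by
    intro t x
    exact (hasDerivAt_id t).prodMk (hasDerivAt_const _ _)
  have happly : ∀ t ∈ Ioo 0 b, ∀ x v, HasFDerivAt (fun z => g z v)
      ((fderiv ℝ g (t, x)).flip v) (t, x) := by
    intro t ht x v
    simpa using (hgd t ht x).clm_apply (hasFDerivAt_const v (t, x))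
  have hcg : ∀ v, ContinuousOn (fun z => g z v) S := fun v =>
    hgc.continuousOn.clm_apply continuousOn_const
  have hcgg : ∀ v w, ContinuousOn (fun z => fderiv ℝ g z v w) (Ioo 0 b ×ˢ univ) := fun v w =>
    (hgg.clm_apply continuousOn_const).clm_apply continuousOn_const
  have hdt : ∀ t ∈ Ioo 0 b, ∀ x, HasDerivAt (fun s => u s x) (g (t, x) (1, 0)) t := by
    intro t ht x
    exact ((hfd (t, x) (hOS ⟨ht, mem_univ _⟩)).hasFDerivAt (hnhds t ht x)).comp_hasDerivAt t
      (htime t x)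
  have hdtt : ∀ t ∈ Ioo 0 b, ∀ x, ∀ v, HasDerivAt (fun s => g (s, x) v)
      (fderiv ℝ g (t, x) (1, 0) v) t := by
    intro t ht x v
    exact (happly t ht x v).comp_hasDerivAt t (htime t x)
  have hlx : ∀ i, ∀ t ∈ Icc 0 b, ∀ x, HasLineDerivAt ℝ (u t)
      (g (t, x) (0, EuclideanSpace.single i 1)) x (EuclideanSpace.single i 1) := by
    intro i t ht x
    have h1 := hline t x (EuclideanSpace.single i 1)
    have h2 := (hfd (t, x) ⟨ht, mem_univ _⟩)
    have h3 : HasFDerivWithinAt f (g (t, x)) S (t, x + (0:ℝ) • EuclideanSpace.single i (1:ℝ)) := by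
      simpa using h2
    exact (h3.comp_hasDerivWithinAt (0:ℝ) (h1.hasDerivWithinAt (s := univ))
      (fun τ _ => mk_mem_prod ht (mem_univ _))).hasDerivAt univ_mem
  have hlv : ∀ i, ∀ t ∈ Ioo 0 b, ∀ x v, HasLineDerivAt ℝ (fun y => g (t, y) v)
      (fderiv ℝ g (t, x) (0, EuclideanSpace.single i 1) v) x (EuclideanSpace.single i 1) := by
    intro i t ht x v
    have h1 := hline t x (EuclideanSpace.single i 1)
    have h3 : HasFDerivAt (fun z => g z v) ((fderiv ℝ g (t, x)).flip v)
        (t, x + (0:ℝ) • EuclideanSpace.single i (1:ℝ)) := by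
      simpa using happly t ht x v
    exact h3.comp_hasDerivAt (0:ℝ) h1
  refine ⟨fun t x => g (t, x) (1, 0), fun i t x => g (t, x) (0, EuclideanSpace.single i 1),
    fun t x => fderiv ℝ g (t, x) (1, 0) (1, 0),
    fun i t x => fderiv ℝ g (t, x) (0, EuclideanSpace.single i 1) (1, 0),
    fun i t x => fderiv ℝ g (t, x) (0, EuclideanSpace.single i 1) (0, EuclideanSpace.single i 1),
    ?_⟩
  refine
    { cont := hu.continuousOn
      cont_t := hcg _
      cont_x := fun i => hcg _
      cont_tt := hcgg _ _
      cont_tx := fun i => hcgg _ _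
      cont_xx := fun i => hcgg _ _
      deriv_zero := ?_
      deriv_t := hdt
      deriv_tt := fun t ht x => hdtt t ht x _
      deriv_xt := ?_
      line_x := hlx
      line_tx := fun i t ht x => hlv i t ht x _
      line_xx := fun i t ht x => hlv i t ht x _
      laplacian_eq := ?_
      iteratedDeriv_eq := ?_ }
  · intro x
    exact (hfd (0, x) ⟨⟨le_rfl, hb.le⟩, mem_univ _⟩).comp_hasDerivWithinAt 0
      (htime 0 x).hasDerivWithinAt (fun τ hτ => mk_mem_prod hτ (mem_univ _))
  · intro i t ht x
    rw [hsymm t ht x]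
    exact hdtt t ht x _
  · intro t ht x
    refine laplacian_eq_sum_of_hasLineDerivAt (g := fun i y => g (t, y) (0, EuclideanSpace.single i 1))
      (h := fun i x => fderiv ℝ g (t, x) (0, EuclideanSpace.single i 1) (0, EuclideanSpace.single i 1))
      ?_ (fun i y => hlx i t (Ioo_subset_Icc_self ht) y) (fun i y => hlv i t ht y _) x
    rw [← contDiffOn_univ]
    exact hu.comp (contDiff_const.prodMk contDiff_id).contDiffOn
      (fun y _ => ⟨Ioo_subset_Icc_self ht, mem_univ _⟩)
  · intro t ht x
    rw [iteratedDeriv_succ, iteratedDeriv_one]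
    have h1 : deriv (fun s => u s x) =ᶠ[𝓝 t] fun s => g (s, x) (1, 0) := by
      filter_upwards [isOpen_Ioo.mem_nhds ht] with s hs
      exact (hdt s hs x).deriv
    rw [h1.deriv_eq]
    exact (hdtt t ht x _).deriv

/-! ### Integrals with compactly supported integrands -/

section Integrals

variable {n : ℕ}

theorem continuous_slice {f : ℝ → EuclideanSpace ℝ (Fin n) → ℝ} {s : Set ℝ}
    (hf : ContinuousOn (Function.uncurry f) (s ×ˢ univ)) {t : ℝ} (ht : t ∈ s) :
    Continuous (f t) := by
  rw [← continuousOn_univ]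
  exact hf.comp (f := fun x => (t, x)) (by fun_prop) (fun x _ => mk_mem_prod ht (mem_univ x))

theorem integrable_of_eq_zero_off_compact {f : EuclideanSpace ℝ (Fin n) → ℝ}
    {K : Set (EuclideanSpace ℝ (Fin n))} (hK : IsCompact K) (hf : Continuous f)
    (h0 : ∀ x ∉ K, f x = 0) : Integrable f :=
  hf.integrable_of_hasCompactSupport (HasCompactSupport.intro hK h0)

/-- Differentiation under the integral sign for integrands supported in a fixed compact set. -/
theorem hasDerivAt_integral_of_compact {f f' : ℝ → EuclideanSpace ℝ (Fin n) → ℝ} {a b : ℝ}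
    {K : Set (EuclideanSpace ℝ (Fin n))} (hK : IsCompact K)
    (hf : ∀ t ∈ Ioo a b, Continuous (f t))
    (hf' : ContinuousOn (Function.uncurry f') (Ioo a b ×ˢ univ))
    (hd : ∀ t ∈ Ioo a b, ∀ x, HasDerivAt (fun s => f s x) (f' t x) t)
    (h0 : ∀ t ∈ Ioo a b, ∀ x ∉ K, f t x = 0) {t : ℝ} (ht : t ∈ Ioo a b) :
    HasDerivAt (fun s => ∫ x, f s x) (∫ x, f' t x) t := by
  obtain ⟨c, hac, hct⟩ := exists_between ht.1
  obtain ⟨d, htd, hdb⟩ := exists_between ht.2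
  have hsub : Icc c d ⊆ Ioo a b := fun s hs => ⟨hac.trans_le hs.1, hs.2.trans_lt hdb⟩
  obtain ⟨M, hM⟩ := (isCompact_Icc.prod hK).exists_bound_of_continuousOn
    (hf'.mono (prod_mono hsub (subset_univ K)))
  have h0' : ∀ s ∈ Ioo a b, ∀ x ∉ K, f' s x = 0 := by
    intro s hs x hx
    refine (hd s hs x).unique ((hasDerivAt_const s (0:ℝ)).congr_of_eventuallyEq ?_)
    filter_upwards [isOpen_Ioo.mem_nhds hs] with r hr using h0 r hr x hx
  refine (hasDerivAt_integral_of_dominated_loc_of_deriv_le (s := Icc c d)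
    (bound := K.indicator fun _ => M) (Icc_mem_nhds hct htd) ?_ ?_ ?_ ?_ ?_ ?_).2
  · filter_upwards [isOpen_Ioo.mem_nhds ht] with s hs using (hf s hs).aestronglyMeasurable
  · exact integrable_of_eq_zero_off_compact hK (hf t ht) (h0 t ht)
  · exact (continuous_slice hf' ht).aestronglyMeasurable
  · refine Eventually.of_forall fun x s hs => ?_
    by_cases hx : x ∈ K
    · rw [indicator_of_mem hx]
      exact hM (s, x) ⟨hs, hx⟩
    · rw [indicator_of_notMem hx, h0' s (hsub hs) x hx, norm_zero]
  · exact (integrable_indicator_iff hK.measurableSet).2 (integrableOn_const hK.measure_ne_top)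
  · exact Eventually.of_forall fun x s hs => hd s (hsub hs) x

/-- Integration by parts in a direction `v`, one of the factors being compactly supported. -/
theorem integral_mul_hasLineDerivAt_of_compact {f f' g g' : EuclideanSpace ℝ (Fin n) → ℝ}
    {v : EuclideanSpace ℝ (Fin n)} {K : Set (EuclideanSpace ℝ (Fin n))} (hK : IsCompact K)
    (hf : Continuous f) (hf' : Continuous f') (hg : Continuous g) (hg' : Continuous g')
    (hfd : ∀ x, HasLineDerivAt ℝ f (f' x) x v) (hgd : ∀ x, HasLineDerivAt ℝ g (g' x) x v)
    (h0 : ∀ x ∉ K, f x = 0) : ∫ x, f x * g' x = -∫ x, f' x * g x := by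
  have h0' : ∀ x ∉ K, f' x = 0 := by
    intro x hx
    refine HasDerivAt.unique (hfd x) ((hasDerivAt_const (0:ℝ) (0:ℝ)).congr_of_eventuallyEq ?_)
    have hc : ContinuousAt (fun τ : ℝ => x + τ • v) 0 := by fun_prop
    filter_upwards [hc (hK.isClosed.isOpen_compl.mem_nhds (by simpa using hx))] with τ hτ
      using h0 _ hτ
  exact integral_bilinear_hasLineDerivAt_right_eq_neg_left_of_integrable
    (B := ContinuousLinearMap.mul ℝ ℝ)
    (integrable_of_eq_zero_off_compact hK (hf'.mul hg) fun x hx => by simp [h0' x hx])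
    (integrable_of_eq_zero_off_compact hK (hf.mul hg') fun x hx => by simp [h0 x hx])
    (integrable_of_eq_zero_off_compact hK (hf.mul hg) fun x hx => by simp [h0 x hx])
    (fun x _ => hfd x) (fun x _ => hgd x)

end Integrals

/-! ### Weighted energy in a backward light cone -/

section FiniteSpeed

variable {n : ℕ}

theorem deriv_expNegInvGlue_nonneg (s : ℝ) : 0 ≤ deriv expNegInvGlue s :=
  expNegInvGlue.monotone.deriv_nonneg

theorem deriv_expNegInvGlue_of_nonpos {s : ℝ} (hs : s ≤ 0) : deriv expNegInvGlue s = 0 := by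
  refine IsLocalMin.deriv_eq_zero (Eventually.of_forall fun r => ?_)
  rw [expNegInvGlue.zero_of_nonpos hs]
  exact expNegInvGlue.nonneg r

theorem hasDerivAt_expNegInvGlue (s : ℝ) :
    HasDerivAt expNegInvGlue (deriv expNegInvGlue s) s :=
  ((expNegInvGlue.contDiff (n := 1)).differentiable (by norm_num) s).hasDerivAt

theorem continuous_deriv_expNegInvGlue : Continuous (deriv expNegInvGlue) :=
  (expNegInvGlue.contDiff (n := 1)).continuous_deriv (by norm_num)

/-- A smooth weight, positive exactly in the backward light cone with vertex `(b, x₀)`. -/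
def coneWeight (b : ℝ) (x₀ : EuclideanSpace ℝ (Fin n)) (t : ℝ) (x : EuclideanSpace ℝ (Fin n)) :
    ℝ := expNegInvGlue ((b - t) ^ 2 - ‖x - x₀‖ ^ 2)

/-- The common factor `φ'` in the derivatives of `coneWeight`. -/
def coneSlope (b : ℝ) (x₀ : EuclideanSpace ℝ (Fin n)) (t : ℝ) (x : EuclideanSpace ℝ (Fin n)) :
    ℝ := 2 * deriv expNegInvGlue ((b - t) ^ 2 - ‖x - x₀‖ ^ 2)

theorem continuous_coneWeight (b : ℝ) (x₀ : EuclideanSpace ℝ (Fin n)) :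
    Continuous (Function.uncurry (coneWeight b x₀)) := by
  have := (expNegInvGlue.contDiff (n := 1)).continuous
  unfold coneWeight Function.uncurry
  exact this.comp (by fun_prop)

theorem continuous_coneSlope (b : ℝ) (x₀ : EuclideanSpace ℝ (Fin n)) :
    Continuous (Function.uncurry (coneSlope b x₀)) := by
  unfold coneSlope Function.uncurry
  exact continuous_const.mul (continuous_deriv_expNegInvGlue.comp (by fun_prop))

theorem coneSlope_nonneg (b : ℝ) (x₀ : EuclideanSpace ℝ (Fin n)) (t x) :
    0 ≤ coneSlope b x₀ t x :=
  mul_nonneg zero_le_two (deriv_expNegInvGlue_nonneg _)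

theorem coneWeight_nonneg (b : ℝ) (x₀ : EuclideanSpace ℝ (Fin n)) (t x) :
    0 ≤ coneWeight b x₀ t x := expNegInvGlue.nonneg _

theorem coneWeight_eq_zero {b t : ℝ} (ht : t ∈ Icc 0 b) {x₀ x : EuclideanSpace ℝ (Fin n)}
    (h : b - t ≤ ‖x - x₀‖) : coneWeight b x₀ t x = 0 := by
  refine expNegInvGlue.zero_of_nonpos ?_
  have := ht.2
  nlinarith

theorem coneSlope_eq_zero {b t : ℝ} (ht : t ∈ Icc 0 b) {x₀ x : EuclideanSpace ℝ (Fin n)}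
    (h : b - t ≤ ‖x - x₀‖) : coneSlope b x₀ t x = 0 := by
  have := ht.2
  rw [coneSlope, deriv_expNegInvGlue_of_nonpos (by nlinarith), mul_zero]

theorem hasDerivAt_coneWeight (b : ℝ) (x₀ : EuclideanSpace ℝ (Fin n)) (t x) :
    HasDerivAt (fun s => coneWeight b x₀ s x) (-(b - t) * coneSlope b x₀ t x) t := by
  have h : HasDerivAt (fun s => (b - s) ^ 2 - ‖x - x₀‖ ^ 2) (-(2 * (b - t))) t := by
    have := (((hasDerivAt_id t).const_sub b).pow 2).sub_const (‖x - x₀‖ ^ 2)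
    refine this.congr_deriv ?_
    simp
  refine ((hasDerivAt_expNegInvGlue _).comp t h).congr_deriv ?_
  rw [coneSlope]
  ring

theorem hasLineDerivAt_coneWeight (b : ℝ) (x₀ : EuclideanSpace ℝ (Fin n)) (t x) (i : Fin n) :
    HasLineDerivAt ℝ (coneWeight b x₀ t) (-(x i - x₀ i) * coneSlope b x₀ t x) x
      (EuclideanSpace.single i 1) := by
  have h1 : HasDerivAt (fun τ : ℝ => x + τ • EuclideanSpace.single i (1:ℝ) - x₀)
      (EuclideanSpace.single i (1:ℝ)) 0 := by
    simpa using (((hasDerivAt_id (0 : ℝ)).smul_const (EuclideanSpace.single i (1:ℝ))).const_add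
      x).sub_const x₀
  have h2 := (h1.norm_sq).const_sub ((b - t) ^ 2)
  have h3 := (hasDerivAt_expNegInvGlue
    ((b - t) ^ 2 - ‖x + (0:ℝ) • EuclideanSpace.single i (1:ℝ) - x₀‖ ^ 2)).comp 0 h2
  refine HasDerivAt.congr_deriv (f := fun τ : ℝ => coneWeight b x₀ t
    (x + τ • EuclideanSpace.single i (1:ℝ))) h3 ?_
  simp [coneSlope, EuclideanSpace.inner_single_right]
  ring

/-- The energy density. -/
def density (u ut : ℝ → EuclideanSpace ℝ (Fin n) → ℝ)
    (ux : Fin n → ℝ → EuclideanSpace ℝ (Fin n) → ℝ) (t : ℝ) (x : EuclideanSpace ℝ (Fin n)) : ℝ :=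
  ut t x ^ 2 + ∑ i, ux i t x ^ 2 + u t x ^ 2

theorem density_nonneg (u ut : ℝ → EuclideanSpace ℝ (Fin n) → ℝ)
    (ux : Fin n → ℝ → EuclideanSpace ℝ (Fin n) → ℝ) (t x) : 0 ≤ density u ut ux t x := by
  have : 0 ≤ ∑ i, ux i t x ^ 2 := Finset.sum_nonneg fun i _ => sq_nonneg _
  unfold density
  positivity

variable {b : ℝ} {u ut utt : ℝ → EuclideanSpace ℝ (Fin n) → ℝ}
  {ux utx uxx : Fin n → ℝ → EuclideanSpace ℝ (Fin n) → ℝ}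

theorem Jet.continuousOn_density (hJ : Jet b u ut ux utt utx uxx) :
    ContinuousOn (Function.uncurry (density u ut ux)) (Icc 0 b ×ˢ univ) :=
  ((hJ.cont_t.pow 2).add (continuousOn_finsetSum _ fun i _ => (hJ.cont_x i).pow 2)).add
    (hJ.cont.pow 2)

/-- The integrand in the time derivative of the weighted energy, after integration by parts. -/
def energyFlux (b : ℝ) (x₀ : EuclideanSpace ℝ (Fin n)) (u ut : ℝ → EuclideanSpace ℝ (Fin n) → ℝ)
    (ux : Fin n → ℝ → EuclideanSpace ℝ (Fin n) → ℝ) (utt : ℝ → EuclideanSpace ℝ (Fin n) → ℝ)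
    (uxx : Fin n → ℝ → EuclideanSpace ℝ (Fin n) → ℝ) (t : ℝ) (x : EuclideanSpace ℝ (Fin n)) : ℝ :=
  -(b - t) * coneSlope b x₀ t x * density u ut ux t x
    + 2 * coneWeight b x₀ t x * ut t x * (utt t x - ∑ i, uxx i t x + u t x)
    + 2 * coneSlope b x₀ t x * ut t x * ∑ i, (x i - x₀ i) * ux i t x

theorem Jet.continuous_energyFlux (hJ : Jet b u ut ux utt utx uxx)
    (x₀ : EuclideanSpace ℝ (Fin n)) {t : ℝ} (ht : t ∈ Ioo 0 b) :
    Continuous (energyFlux b x₀ u ut ux utt uxx t) := by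
  have ht' := Ioo_subset_Icc_self ht
  have h1 := continuous_slice hJ.continuousOn_density ht'
  have h2 := continuous_slice hJ.cont ht'
  have h3 := continuous_slice hJ.cont_t ht'
  have h4 := fun i => continuous_slice (hJ.cont_x i) ht'
  have h5 := continuous_slice hJ.cont_tt ht
  have h6 := fun i => continuous_slice (hJ.cont_xx i) ht
  have h7 := continuous_slice (continuous_coneWeight b x₀).continuousOn (mem_univ t)
  have h8 := continuous_slice (continuous_coneSlope b x₀).continuousOn (mem_univ t)
  unfold energyFlux
  fun_prop

theorem energyFlux_eq_zero {t : ℝ} (ht : t ∈ Icc 0 b) {x₀ x : EuclideanSpace ℝ (Fin n)}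
    (h : b - t ≤ ‖x - x₀‖) : energyFlux b x₀ u ut ux utt uxx t x = 0 := by
  simp [energyFlux, coneSlope_eq_zero ht h, coneWeight_eq_zero ht h]

theorem le_norm_sub_of_notMem {t : ℝ} (ht : t ∈ Icc 0 b) {x₀ x : EuclideanSpace ℝ (Fin n)}
    (hx : x ∉ Metric.closedBall x₀ b) : b - t ≤ ‖x - x₀‖ := by
  rw [Metric.mem_closedBall, dist_eq_norm, not_le] at hx
  linarith [ht.1]

/-- Differentiation under the integral produces the terms χ uᵢ uₜᵢ, with χ the cone weight.
Integrating each by parts in xᵢ moves the derivative onto χ uᵢ; this yields -χ uᵢᵢ uₜ, which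
combines with χ uₜ uₜₜ into the wave operator, and a term with ∂ᵢχ, which belongs to the flux
through the cone. -/
theorem Jet.hasDerivAt_energy (hJ : Jet b u ut ux utt utx uxx) (x₀ : EuclideanSpace ℝ (Fin n))
    {t : ℝ} (ht : t ∈ Ioo 0 b) :
    HasDerivAt (fun s => ∫ x, coneWeight b x₀ s x * density u ut ux s x)
      (∫ x, energyFlux b x₀ u ut ux utt uxx t x) t := by
  have hK : IsCompact (Metric.closedBall x₀ b) := isCompact_closedBall x₀ b
  have hsub : Ioo 0 b ×ˢ (univ : Set (EuclideanSpace ℝ (Fin n))) ⊆ Icc 0 b ×ˢ univ :=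
    prod_mono Ioo_subset_Icc_self subset_rfl
  have key := hasDerivAt_integral_of_compact
    (f := fun s x => coneWeight b x₀ s x * density u ut ux s x)
    (f' := fun s x => -(b - s) * coneSlope b x₀ s x * density u ut ux s x + coneWeight b x₀ s x *
      (2 * ut s x * utt s x + ∑ i, 2 * ux i s x * utx i s x + 2 * u s x * ut s x))
    (a := 0) (b := b) hK ?_ ?_ ?_ ?_ ht
  · refine key.congr_deriv ?_
    have ht' := Ioo_subset_Icc_self ht
    have h1 := continuous_slice hJ.continuousOn_density ht'
    have h2 := continuous_slice hJ.cont ht'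
    have h3 := continuous_slice hJ.cont_t ht'
    have h4 := fun i => continuous_slice (hJ.cont_x i) ht'
    have h5 := continuous_slice hJ.cont_tt ht
    have h6 := fun i => continuous_slice (hJ.cont_xx i) ht
    have h6' := fun i => continuous_slice (hJ.cont_tx i) ht
    have h7 : Continuous (coneWeight b x₀ t) :=
      continuous_slice (continuous_coneWeight b x₀).continuousOn (mem_univ t)
    have h8 : Continuous (coneSlope b x₀ t) :=
      continuous_slice (continuous_coneSlope b x₀).continuousOn (mem_univ t)
    have hibp : ∀ i, ∫ x, (coneWeight b x₀ t x * ux i t x) * utx i t x =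
        -∫ x, (-(x i - x₀ i) * coneSlope b x₀ t x * ux i t x
          + coneWeight b x₀ t x * uxx i t x) * ut t x := by
      intro i
      refine integral_mul_hasLineDerivAt_of_compact hK (v := EuclideanSpace.single i 1)
        (h7.mul (h4 i)) ?_ h3 (h6' i) ?_ (hJ.line_tx i t ht) ?_
      · have := h4 i
        have := h6 i
        fun_prop
      · intro x
        refine (HasDerivAt.mul (hasLineDerivAt_coneWeight b x₀ t x i)
          (hJ.line_xx i t ht x)).congr_deriv ?_
        simp
      · intro x hx
        simp [coneWeight_eq_zero ht' (le_norm_sub_of_notMem ht' hx)]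
    have hI : ∀ f : EuclideanSpace ℝ (Fin n) → ℝ, Continuous f →
        (∀ x ∉ Metric.closedBall x₀ b, f x = 0) → Integrable f :=
      fun f hf h0 => integrable_of_eq_zero_off_compact hK hf h0
    have hw0 : ∀ x ∉ Metric.closedBall x₀ b, coneWeight b x₀ t x = 0 := fun x hx =>
      coneWeight_eq_zero ht' (le_norm_sub_of_notMem ht' hx)
    have hs0 : ∀ x ∉ Metric.closedBall x₀ b, coneSlope b x₀ t x = 0 := fun x hx =>
      coneSlope_eq_zero ht' (le_norm_sub_of_notMem ht' hx)
    have i1 : Integrable fun x => -(b - t) * coneSlope b x₀ t x * density u ut ux t x +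
        coneWeight b x₀ t x * (2 * ut t x * utt t x + 2 * u t x * ut t x) :=
      hI _ (by fun_prop) fun x hx => by simp [hw0 x hx, hs0 x hx]
    have i2 : ∀ i, Integrable fun x => coneWeight b x₀ t x * ux i t x * utx i t x := fun i =>
      hI _ ((h7.mul (h4 i)).mul (h6' i)) fun x hx => by simp [hw0 x hx]
    have i3 : ∀ i, Integrable fun x => (-(x i - x₀ i) * coneSlope b x₀ t x * ux i t x
          + coneWeight b x₀ t x * uxx i t x) * ut t x := fun i =>
      hI _ (by have := h4 i; have := h6 i; fun_prop) fun x hx => by simp [hw0 x hx, hs0 x hx]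
    have e1 : (fun x => -(b - t) * coneSlope b x₀ t x * density u ut ux t x + coneWeight b x₀ t x *
        (2 * ut t x * utt t x + ∑ i, 2 * ux i t x * utx i t x + 2 * u t x * ut t x)) =
        fun x => (-(b - t) * coneSlope b x₀ t x * density u ut ux t x +
        coneWeight b x₀ t x * (2 * ut t x * utt t x + 2 * u t x * ut t x))
        + ∑ i, 2 * (coneWeight b x₀ t x * ux i t x * utx i t x) := by
      funext x
      have : ∑ i, 2 * (coneWeight b x₀ t x * ux i t x * utx i t x) =
          coneWeight b x₀ t x * ∑ i, 2 * ux i t x * utx i t x := by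
        rw [Finset.mul_sum]
        exact Finset.sum_congr rfl fun i _ => by ring
      rw [this]
      ring
    have e2 : energyFlux b x₀ u ut ux utt uxx t =
        fun x => (-(b - t) * coneSlope b x₀ t x * density u ut ux t x +
        coneWeight b x₀ t x * (2 * ut t x * utt t x + 2 * u t x * ut t x))
        - ∑ i, 2 * ((-(x i - x₀ i) * coneSlope b x₀ t x * ux i t x
          + coneWeight b x₀ t x * uxx i t x) * ut t x) := by
      funext x
      have : ∑ i, 2 * ((-(x i - x₀ i) * coneSlope b x₀ t x * ux i t x
          + coneWeight b x₀ t x * uxx i t x) * ut t x) =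
          2 * coneWeight b x₀ t x * ut t x * (∑ i, uxx i t x)
          - 2 * coneSlope b x₀ t x * ut t x * ∑ i, (x i - x₀ i) * ux i t x := by
        rw [Finset.mul_sum, Finset.mul_sum, ← Finset.sum_sub_distrib]
        exact Finset.sum_congr rfl fun i _ => by ring
      rw [this, energyFlux]
      ring
    rw [e1, e2, integral_add i1 (integrable_finsetSum _ fun i _ => (i2 i).const_mul 2),
      integral_sub i1 (integrable_finsetSum _ fun i _ => (i3 i).const_mul 2),
      integral_finsetSum _ fun i _ => (i2 i).const_mul 2,
      integral_finsetSum _ fun i _ => (i3 i).const_mul 2]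
    refine eq_sub_of_add_eq ?_
    rw [add_assoc, ← Finset.sum_add_distrib, add_eq_left]
    refine Finset.sum_eq_zero fun i _ => ?_
    rw [integral_const_mul, integral_const_mul, hibp i]
    ring
  · intro s hs
    exact (continuous_slice (continuous_coneWeight b x₀).continuousOn (mem_univ s)).mul
      (continuous_slice hJ.continuousOn_density (Ioo_subset_Icc_self hs))
  · have c1 := hJ.continuousOn_density.mono hsub
    have c2 := hJ.cont_t.mono hsub
    have c3 := hJ.cont.mono hsub
    have c4 : ContinuousOn (fun z : ℝ × EuclideanSpace ℝ (Fin n) =>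
        ∑ i, 2 * ux i z.1 z.2 * utx i z.1 z.2) (Ioo 0 b ×ˢ univ) :=
      continuousOn_finsetSum _ fun i _ =>
        (continuousOn_const.mul ((hJ.cont_x i).mono hsub)).mul (hJ.cont_tx i)
    have c5 := (continuous_coneWeight b x₀).continuousOn (s := Ioo 0 b ×ˢ univ)
    have c6 := (continuous_coneSlope b x₀).continuousOn (s := Ioo 0 b ×ˢ univ)
    have c7 : ContinuousOn (fun z : ℝ × EuclideanSpace ℝ (Fin n) => -(b - z.1))
      (Ioo 0 b ×ˢ univ) := by fun_prop
    exact ((c7.mul c6).mul c1).add (c5.mul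
      ((((continuousOn_const (c := (2:ℝ))).mul c2).mul hJ.cont_tt |>.add c4).add
        ((continuousOn_const.mul c3).mul c2)))
  · intro s hs x
    have d1 : HasDerivAt (fun s => density u ut ux s x)
        (2 * ut s x * utt s x + ∑ i, 2 * ux i s x * utx i s x + 2 * u s x * ut s x) s := by
      refine HasDerivAt.add (HasDerivAt.add ?_ (HasDerivAt.fun_sum fun i _ => ?_)) ?_
      · simpa using (hJ.deriv_tt s hs x).fun_pow 2
      · simpa using (hJ.deriv_xt i s hs x).fun_pow 2
      · simpa using (hJ.deriv_t s hs x).fun_pow 2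
    exact (hasDerivAt_coneWeight b x₀ s x).mul d1
  · intro s hs x hx
    have hs' := Ioo_subset_Icc_self hs
    simp [coneWeight_eq_zero hs' (le_norm_sub_of_notMem hs' hx)]

/-- Propagation at speed one makes the flux through the cone nonpositive: where the slope of the
weight is nonzero, |x - x₀| < b - t, and Cauchy–Schwarz absorbs the cross term 2uₜ (x - x₀)·∇u into
(b - t)(uₜ² + |∇u|²). In the rest, the damping has a favourable sign, the source costs M, and the
mass term together with the u² in the density costs 1 + ν². Here `w` stands for the time derivative
of the other component. -/
theorem energyFlux_le {t μ ν M w : ℝ} (ht : t ∈ Ioo 0 b) (hμ : 0 ≤ μ)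
    (x₀ x : EuclideanSpace ℝ (Fin n))
    (hF : |utt t x - (∑ i, uxx i t x) + μ / (1 + t) * ut t x + ν ^ 2 / (1 + t) ^ 2 * u t x| ≤ M * |w|)
    (hM : 0 ≤ M) :
    energyFlux b x₀ u ut ux utt uxx t x ≤
      coneWeight b x₀ t x * ((M + ν ^ 2 + 1) * (density u ut ux t x + w ^ 2)) := by
  have hS : 0 ≤ ∑ i, ux i t x ^ 2 := Finset.sum_nonneg fun i _ => sq_nonneg _
  have h1t : 0 < 1 + t := by linarith [ht.1]
  have hbt : 0 < b - t := by linarith [ht.2]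
  have hχ := coneWeight_nonneg b x₀ t x
  have hs := coneSlope_nonneg b x₀ t x
  have hslope : -(b - t) * coneSlope b x₀ t x * density u ut ux t x
      + 2 * coneSlope b x₀ t x * ut t x * ∑ i, (x i - x₀ i) * ux i t x ≤ 0 := by
    by_cases hx : b - t ≤ ‖x - x₀‖
    · simp [coneSlope_eq_zero (Ioo_subset_Icc_self ht) hx]
    · have hcs : (∑ i, (x i - x₀ i) * ux i t x) ^ 2 ≤ (b - t) ^ 2 * ∑ i, ux i t x ^ 2 := by
        refine (Finset.sum_mul_sq_le_sq_mul_sq _ _ _).trans ?_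
        refine mul_le_mul_of_nonneg_right ?_ hS
        have : ∑ i, (x i - x₀ i) ^ 2 = ‖x - x₀‖ ^ 2 := by
          rw [EuclideanSpace.real_norm_sq_eq]
          simp
        rw [this]
        exact pow_le_pow_left₀ (norm_nonneg _) (not_le.1 hx).le 2
      set A := ∑ i, (x i - x₀ i) * ux i t x
      set Sx := ∑ i, ux i t x ^ 2
      have h2 : 2 * ut t x * A ≤ (b - t) * (ut t x ^ 2 + Sx) := by
        have h3 : 0 ≤ ((b - t) * ut t x - A) ^ 2 := sq_nonneg _
        have h4 : (b - t) * (2 * ut t x * A) ≤ (b - t) * ((b - t) * (ut t x ^ 2 + Sx)) := by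
          nlinarith
        exact le_of_mul_le_mul_left h4 hbt
      have h5 : 2 * ut t x * A ≤ (b - t) * density u ut ux t x := by
        refine h2.trans (mul_le_mul_of_nonneg_left ?_ hbt.le)
        unfold density
        nlinarith [sq_nonneg (u t x)]
      nlinarith [mul_le_mul_of_nonneg_left h5 hs]
  have hmid : 2 * ut t x * (utt t x - ∑ i, uxx i t x + u t x) ≤
      (M + ν ^ 2 + 1) * (density u ut ux t x + w ^ 2) := by
    set F := utt t x - (∑ i, uxx i t x) + μ / (1 + t) * ut t x + ν ^ 2 / (1 + t) ^ 2 * u t x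
      with hFdef
    have e : 2 * ut t x * (utt t x - ∑ i, uxx i t x + u t x) =
        2 * ut t x * F - 2 * (μ / (1 + t)) * ut t x ^ 2
          + 2 * (1 - ν ^ 2 / (1 + t) ^ 2) * (ut t x * u t x) := by
      rw [hFdef]; ring
    have a1 : 2 * ut t x * F ≤ M * (ut t x ^ 2 + w ^ 2) := by
      have : ut t x * F ≤ |ut t x| * (M * |w|) :=
        (le_abs_self _).trans (by rw [abs_mul]; exact mul_le_mul_of_nonneg_left hF (abs_nonneg _))
      have h := mul_le_mul_of_nonneg_left (two_mul_le_add_sq |ut t x| |w|) hM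
      rw [sq_abs, sq_abs] at h
      linarith
    have a2 : 0 ≤ 2 * (μ / (1 + t)) * ut t x ^ 2 := by positivity
    have k0 : 0 ≤ ν ^ 2 / (1 + t) ^ 2 := by positivity
    have k1 : ν ^ 2 / (1 + t) ^ 2 ≤ ν ^ 2 :=
      div_le_self (sq_nonneg _) (by nlinarith [ht.1])
    have a3 : 2 * (1 - ν ^ 2 / (1 + t) ^ 2) * (ut t x * u t x) ≤
        (1 + ν ^ 2) * (ut t x ^ 2 + u t x ^ 2) := by
      set k := ν ^ 2 / (1 + t) ^ 2
      have b1 : 2 * (ut t x * u t x) ≤ ut t x ^ 2 + u t x ^ 2 := by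
        nlinarith [sq_nonneg (ut t x - u t x)]
      have b2 : -(2 * (ut t x * u t x)) ≤ ut t x ^ 2 + u t x ^ 2 := by
        nlinarith [sq_nonneg (ut t x + u t x)]
      nlinarith [mul_le_mul_of_nonneg_left b2 k0, sq_nonneg (ut t x), sq_nonneg (u t x)]
    have a4 : M * (ut t x ^ 2 + w ^ 2) ≤ M * (density u ut ux t x + w ^ 2) :=
      mul_le_mul_of_nonneg_left (by unfold density; nlinarith [sq_nonneg (u t x)]) hM
    have a5 : (1 + ν ^ 2) * (ut t x ^ 2 + u t x ^ 2) ≤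
        (1 + ν ^ 2) * (density u ut ux t x + w ^ 2) :=
      mul_le_mul_of_nonneg_left (by unfold density; nlinarith [sq_nonneg w]) (by positivity)
    rw [e]
    linarith
  have := mul_le_mul_of_nonneg_left hmid hχ
  unfold energyFlux
  linarith

end FiniteSpeed

/-! ### Uniqueness in cones and finite speed of propagation -/

section FiniteSpeed

variable {n : ℕ} {b : ℝ} {u ut utt v vt vtt : ℝ → EuclideanSpace ℝ (Fin n) → ℝ}
  {ux utx uxx vx vtx vxx : Fin n → ℝ → EuclideanSpace ℝ (Fin n) → ℝ}

/-- The energy argument: a pair whose wave operators are controlled by the time derivatives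
vanishes in a backward light cone if its data vanish on the base of the cone. -/
theorem eq_zero_in_cone (hb : 0 < b) (hu : Jet b u ut ux utt utx uxx)
    (hv : Jet b v vt vx vtt vtx vxx) {μ₁ ν₁ μ₂ ν₂ M : ℝ} (hμ₁ : 0 ≤ μ₁) (hμ₂ : 0 ≤ μ₂) (hM : 0 ≤ M)
    (x₀ : EuclideanSpace ℝ (Fin n))
    (hF : ∀ t ∈ Ioo 0 b, ∀ x ∈ Metric.closedBall x₀ b,
      |utt t x - (∑ i, uxx i t x) + μ₁ / (1 + t) * ut t x + ν₁ ^ 2 / (1 + t) ^ 2 * u t x|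
        ≤ M * |vt t x|)
    (hG : ∀ t ∈ Ioo 0 b, ∀ x ∈ Metric.closedBall x₀ b,
      |vtt t x - (∑ i, vxx i t x) + μ₂ / (1 + t) * vt t x + ν₂ ^ 2 / (1 + t) ^ 2 * v t x|
        ≤ M * |ut t x|)
    (h0 : ∀ x ∈ Metric.ball x₀ b, density u ut ux 0 x = 0 ∧ density v vt vx 0 x = 0)
    {t : ℝ} (ht : t ∈ Ico 0 b) : u t x₀ = 0 ∧ v t x₀ = 0 := by
  -- Each of the two fluxes is at most (M + ν₁² + ν₂² + 1) times the total weighted density, since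
  -- the source of one component is controlled by the energy of the other. The factor 2 counts the
  -- components.
  set C := 2 * (M + ν₁ ^ 2 + ν₂ ^ 2 + 1) with hC
  set e : ℝ → EuclideanSpace ℝ (Fin n) → ℝ := fun s x =>
    coneWeight b x₀ s x * density u ut ux s x + coneWeight b x₀ s x * density v vt vx s x with he
  have hK : IsCompact (Metric.closedBall x₀ b) := isCompact_closedBall x₀ b
  have hec : ContinuousOn (Function.uncurry e) (Icc 0 b ×ˢ univ) :=
    ((continuous_coneWeight b x₀).continuousOn.mul hu.continuousOn_density).add
      ((continuous_coneWeight b x₀).continuousOn.mul hv.continuousOn_density)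
  have he0 : ∀ s, ∀ x, s ∈ Icc 0 b → x ∉ Metric.closedBall x₀ b → e s x = 0 := by
    intro s x hs hx
    simp [he, coneWeight_eq_zero hs (le_norm_sub_of_notMem hs hx)]
  have he_nonneg : ∀ s x, 0 ≤ e s x := fun s x =>
    add_nonneg (mul_nonneg (coneWeight_nonneg _ _ _ _) (density_nonneg _ _ _ _ _))
      (mul_nonneg (coneWeight_nonneg _ _ _ _) (density_nonneg _ _ _ _ _))
  have hei : ∀ s ∈ Icc 0 b, Integrable (e s) := fun s hs =>
    integrable_of_eq_zero_off_compact hK (continuous_slice hec hs) fun x hx => he0 s x hs hx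
  have hEc : ContinuousOn (fun s => ∫ x, e s x) (Icc 0 b) :=
    continuousOn_integral_of_compact_support hK hec he0
  have hwi : ∀ {w wt : ℝ → EuclideanSpace ℝ (Fin n) → ℝ}
      {wx : Fin n → ℝ → EuclideanSpace ℝ (Fin n) → ℝ}, ContinuousOn
        (Function.uncurry (density w wt wx)) (Icc 0 b ×ˢ univ) → ∀ s ∈ Icc 0 b,
        Integrable fun x => coneWeight b x₀ s x * density w wt wx s x := by
    intro w wt wx hw s hs
    refine integrable_of_eq_zero_off_compact hK
      ((continuous_slice (continuous_coneWeight b x₀).continuousOn (mem_univ s)).mul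
        (continuous_slice hw hs)) fun x hx => ?_
    simp [coneWeight_eq_zero hs (le_norm_sub_of_notMem hs hx)]
  have hEd : ∀ s ∈ Ioo 0 b, HasDerivAt (fun s => ∫ x, e s x)
      ((∫ x, energyFlux b x₀ u ut ux utt uxx s x) + ∫ x, energyFlux b x₀ v vt vx vtt vxx s x) s := by
    intro s hs
    refine ((hu.hasDerivAt_energy x₀ hs).add (hv.hasDerivAt_energy x₀ hs)).congr_of_eventuallyEq ?_
    filter_upwards [isOpen_Ioo.mem_nhds hs] with r hr
    have hr' := Ioo_subset_Icc_self hr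
    exact integral_add (hwi hu.continuousOn_density r hr') (hwi hv.continuousOn_density r hr')
  have hEle : ∀ s ∈ Ioo 0 b, (∫ x, energyFlux b x₀ u ut ux utt uxx s x) +
      (∫ x, energyFlux b x₀ v vt vx vtt vxx s x) ≤ C * ∫ x, e s x := by
    intro s hs
    have hs' := Ioo_subset_Icc_self hs
    have f1 : Integrable (energyFlux b x₀ u ut ux utt uxx s) :=
      integrable_of_eq_zero_off_compact hK (hu.continuous_energyFlux x₀ hs) fun x hx =>
        energyFlux_eq_zero hs' (le_norm_sub_of_notMem hs' hx)
    have f2 : Integrable (energyFlux b x₀ v vt vx vtt vxx s) :=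
      integrable_of_eq_zero_off_compact hK (hv.continuous_energyFlux x₀ hs) fun x hx =>
        energyFlux_eq_zero hs' (le_norm_sub_of_notMem hs' hx)
    rw [← integral_add f1 f2, ← integral_const_mul]
    refine integral_mono (f1.add f2) ((hei s hs').const_mul C) fun x => ?_
    by_cases hx : x ∈ Metric.closedBall x₀ b
    · have g1 := energyFlux_le (ux := ux) hs hμ₁ x₀ x (hF s hs x hx) hM
      have g2 := energyFlux_le (ux := vx) hs hμ₂ x₀ x (hG s hs x hx) hM
      have w0 := coneWeight_nonneg b x₀ s x
      have d1 := density_nonneg u ut ux s x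
      have d2 := density_nonneg v vt vx s x
      have k1 : vt s x ^ 2 ≤ density v vt vx s x := by
        have : 0 ≤ ∑ i, vx i s x ^ 2 := Finset.sum_nonneg fun i _ => sq_nonneg _
        unfold density
        nlinarith [sq_nonneg (v s x)]
      have k2 : ut s x ^ 2 ≤ density u ut ux s x := by
        have : 0 ≤ ∑ i, ux i s x ^ 2 := Finset.sum_nonneg fun i _ => sq_nonneg _
        unfold density
        nlinarith [sq_nonneg (u s x)]
      have l1 : (M + ν₁ ^ 2 + 1) * (density u ut ux s x + vt s x ^ 2) ≤
          (M + ν₁ ^ 2 + ν₂ ^ 2 + 1) * (density u ut ux s x + density v vt vx s x) :=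
        mul_le_mul (by nlinarith [sq_nonneg ν₂]) (by linarith) (by positivity) (by positivity)
      have l2 : (M + ν₂ ^ 2 + 1) * (density v vt vx s x + ut s x ^ 2) ≤
          (M + ν₁ ^ 2 + ν₂ ^ 2 + 1) * (density u ut ux s x + density v vt vx s x) :=
        mul_le_mul (by nlinarith [sq_nonneg ν₁]) (by linarith) (by positivity) (by positivity)
      have m1 := mul_le_mul_of_nonneg_left l1 w0
      have m2 := mul_le_mul_of_nonneg_left l2 w0
      have : C * e s x = 2 * (coneWeight b x₀ s x * ((M + ν₁ ^ 2 + ν₂ ^ 2 + 1) *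
        (density u ut ux s x + density v vt vx s x))) := by rw [hC, he]; ring
      linarith
    · have hx' := le_norm_sub_of_notMem hs' hx
      rw [energyFlux_eq_zero hs' hx', energyFlux_eq_zero hs' hx', he0 s x hs' hx]
      simp
  have hE0 : ∫ x, e 0 x = 0 := by
    have : e 0 = fun _ => 0 := by
      funext x
      by_cases hx : x ∈ Metric.ball x₀ b
      · simp [he, (h0 x hx).1, (h0 x hx).2]
      · have : b - 0 ≤ ‖x - x₀‖ := by
          rw [Metric.mem_ball, dist_eq_norm, not_lt] at hx
          simpa using hx
        simp [he, coneWeight_eq_zero ⟨le_rfl, hb.le⟩ this]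
    rw [this, integral_zero]
  -- Grönwall's argument: the energy starts from 0 and grows at most at rate C, so it stays 0.
  have hanti : AntitoneOn (fun s => Real.exp (-C * s) * ∫ x, e s x) (Icc 0 b) := by
    have hd : ∀ s ∈ Ioo 0 b, HasDerivAt (fun s => Real.exp (-C * s) * ∫ x, e s x)
        (Real.exp (-C * s) * -C * (∫ x, e s x) + Real.exp (-C * s) *
          ((∫ x, energyFlux b x₀ u ut ux utt uxx s x) +
            ∫ x, energyFlux b x₀ v vt vx vtt vxx s x)) s := by
      intro s hs
      have h1 : HasDerivAt (fun s => Real.exp (-C * s)) (Real.exp (-C * s) * -C) s := by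
        simpa using ((hasDerivAt_id s).const_mul (-C)).exp
      exact h1.mul (hEd s hs)
    refine antitoneOn_of_deriv_nonpos (convex_Icc 0 b) (ContinuousOn.mul (by fun_prop) hEc) ?_ ?_
    · rw [interior_Icc]
      exact fun s hs => (hd s hs).differentiableAt.differentiableWithinAt
    · rw [interior_Icc]
      intro s hs
      rw [(hd s hs).deriv]
      nlinarith [hEle s hs, Real.exp_pos (-C * s)]
  have ht' : t ∈ Icc 0 b := ⟨ht.1, ht.2.le⟩
  have hEt : ∫ x, e t x = 0 := by
    have h1 := hanti ⟨le_rfl, hb.le⟩ ht' ht.1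
    simp only [hE0, mul_zero] at h1
    refine le_antisymm ?_ (integral_nonneg (he_nonneg t))
    by_contra hcon
    exact absurd h1 (not_le.2 (mul_pos (Real.exp_pos _) (not_le.1 hcon)))
  have hz : e t = 0 :=
    ((continuous_slice hec ht').ae_eq_iff_eq volume continuous_zero).1
      ((integral_eq_zero_iff_of_nonneg (he_nonneg t) (hei t ht')).1 hEt)
  have hw : 0 < coneWeight b x₀ t x₀ := by
    refine expNegInvGlue.pos_of_pos ?_
    have : 0 < b - t := by linarith [ht.2]
    rw [sub_self, norm_zero]
    nlinarith
  have hzx : coneWeight b x₀ t x₀ * density u ut ux t x₀ +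
      coneWeight b x₀ t x₀ * density v vt vx t x₀ = 0 := congrFun hz x₀
  have hd : density u ut ux t x₀ + density v vt vx t x₀ = 0 := by
    rw [← mul_add] at hzx
    exact (mul_eq_zero.1 hzx).resolve_left hw.ne'
  have s1 : 0 ≤ ∑ i, ux i t x₀ ^ 2 := Finset.sum_nonneg fun i _ => sq_nonneg _
  have s2 : 0 ≤ ∑ i, vx i t x₀ ^ 2 := Finset.sum_nonneg fun i _ => sq_nonneg _
  unfold density at hd
  constructor <;> refine pow_eq_zero_iff (two_ne_zero) |>.1 ?_ <;>
    nlinarith [sq_nonneg (u t x₀), sq_nonneg (v t x₀), sq_nonneg (ut t x₀), sq_nonneg (vt t x₀)]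

theorem Jet.density_zero_eq_zero (hb : 0 < b) (hu : Jet b u ut ux utt utx uxx)
    {U : Set (EuclideanSpace ℝ (Fin n))} (hU : IsOpen U) (h0 : ∀ x ∈ U, u 0 x = 0)
    (h1 : ∀ x ∈ U, ut 0 x = 0) {x : EuclideanSpace ℝ (Fin n)} (hx : x ∈ U) :
    density u ut ux 0 x = 0 := by
  have hux : ∀ i, ux i 0 x = 0 := by
    intro i
    refine HasDerivAt.unique (hu.line_x i 0 ⟨le_rfl, hb.le⟩ x)
      ((hasDerivAt_const (0:ℝ) (0:ℝ)).congr_of_eventuallyEq ?_)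
    have hc : ContinuousAt (fun τ : ℝ => x + τ • EuclideanSpace.single i (1:ℝ)) 0 := by fun_prop
    filter_upwards [hc (hU.mem_nhds (by simpa using hx))] with τ hτ using h0 _ hτ
  simp [density, hux, h0 x hx, h1 x hx]

/-- The equations of `IsSolution` on a time interval `[0, b]`, in terms of jets. -/
structure SolvesOn (b μ₁ ν₁ μ₂ ν₂ p q : ℝ) (u ut : ℝ → EuclideanSpace ℝ (Fin n) → ℝ)
    (ux : Fin n → ℝ → EuclideanSpace ℝ (Fin n) → ℝ) (utt : ℝ → EuclideanSpace ℝ (Fin n) → ℝ)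
    (utx uxx : Fin n → ℝ → EuclideanSpace ℝ (Fin n) → ℝ)
    (v vt : ℝ → EuclideanSpace ℝ (Fin n) → ℝ)
    (vx : Fin n → ℝ → EuclideanSpace ℝ (Fin n) → ℝ) (vtt : ℝ → EuclideanSpace ℝ (Fin n) → ℝ)
    (vtx vxx : Fin n → ℝ → EuclideanSpace ℝ (Fin n) → ℝ) : Prop where
  jet_u : Jet b u ut ux utt utx uxx
  jet_v : Jet b v vt vx vtt vtx vxx
  eq_u : ∀ t ∈ Ioo 0 b, ∀ x, utt t x - (∑ i, uxx i t x) + μ₁ / (1 + t) * ut t x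
    + ν₁ ^ 2 / (1 + t) ^ 2 * u t x = |vt t x| ^ p
  eq_v : ∀ t ∈ Ioo 0 b, ∀ x, vtt t x - (∑ i, vxx i t x) + μ₂ / (1 + t) * vt t x
    + ν₂ ^ 2 / (1 + t) ^ 2 * v t x = |ut t x| ^ q

variable {μ₁ ν₁ μ₂ ν₂ p q ε R : ℝ} {u₀ u₁ v₀ v₁ : EuclideanSpace ℝ (Fin n) → ℝ} {T : ℝ≥0∞}

theorem slab_mono_Icc {b : ℝ} (hbT : ENNReal.ofReal b < T) :
    Icc 0 b ×ˢ (univ : Set (EuclideanSpace ℝ (Fin n))) ⊆ slab n T := fun _ hz =>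
  ⟨hz.1.1, (ENNReal.ofReal_le_ofReal hz.1.2).trans_lt hbT⟩

theorem IsSolution.exists_solvesOn (h : IsSolution μ₁ ν₁ μ₂ ν₂ p q ε u₀ u₁ v₀ v₁ T u v)
    (hb : 0 < b) (hbT : ENNReal.ofReal b < T) :
    ∃ ut ux utt utx uxx vt vx vtt vtx vxx,
      SolvesOn b μ₁ ν₁ μ₂ ν₂ p q u ut ux utt utx uxx v vt vx vtt vtx vxx ∧
      (∀ x, ut 0 x = ε * u₁ x) ∧ (∀ x, vt 0 x = ε * v₁ x) := by
  obtain ⟨ut, ux, utt, utx, uxx, hu⟩ := exists_jet hb (h.contDiffOn_u.mono (slab_mono_Icc hbT))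
  obtain ⟨vt, vx, vtt, vtx, vxx, hv⟩ := exists_jet hb (h.contDiffOn_v.mono (slab_mono_Icc hbT))
  have hlt : ∀ t ∈ Ioo 0 b, ENNReal.ofReal t < T := fun t ht =>
    (ENNReal.ofReal_le_ofReal ht.2.le).trans_lt hbT
  have hun : UniqueDiffWithinAt ℝ (Icc 0 b) 0 := uniqueDiffOn_Icc hb 0 ⟨le_rfl, hb.le⟩
  refine ⟨ut, ux, utt, utx, uxx, vt, vx, vtt, vtx, vxx, ⟨hu, hv, ?_, ?_⟩, ?_, ?_⟩
  · intro t ht x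
    have := h.eq_u t x ht.1 (hlt t ht)
    rwa [waveOp, hu.laplacian_eq t ht, hu.iteratedDeriv_eq t ht, (hu.deriv_t t ht x).deriv,
      (hv.deriv_t t ht x).deriv] at this
  · intro t ht x
    have := h.eq_v t x ht.1 (hlt t ht)
    rwa [waveOp, hv.laplacian_eq t ht, hv.iteratedDeriv_eq t ht, (hu.deriv_t t ht x).deriv,
      (hv.deriv_t t ht x).deriv] at this
  · intro x
    exact hun.eq_deriv _ (hu.deriv_zero x) ((h.init_ut x).mono Icc_subset_Ici_self)
  · intro x
    exact hun.eq_deriv _ (hv.deriv_zero x) ((h.init_vt x).mono Icc_subset_Ici_self)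

/-- As p > 1, the power has a spare factor |vₜ|^(p-1), bounded on compact sets. The nonlinearity
thus becomes a linear source, as the energy argument requires. -/
theorem exists_rpow_le_mul_abs {K : Set (EuclideanSpace ℝ (Fin n))} (hK : IsCompact K)
    (hv : ContinuousOn (Function.uncurry vt) (Icc 0 b ×ˢ univ)) (hp : 1 < p) :
    ∃ M, 0 ≤ M ∧ ∀ t ∈ Icc 0 b, ∀ x ∈ K, |vt t x| ^ p ≤ M * |vt t x| := by
  obtain ⟨M, hM⟩ := (isCompact_Icc.prod hK).exists_bound_of_continuousOn
    (hv.mono (prod_mono subset_rfl (subset_univ K)))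
  refine ⟨(max M 0) ^ (p - 1), by positivity, fun t ht x hx => ?_⟩
  have h1 : |vt t x| ≤ max M 0 := (hM (t, x) ⟨ht, hx⟩).trans (le_max_left _ _)
  have h2 : |vt t x| ^ p = |vt t x| ^ (p - 1) * |vt t x| := by
    rw [← Real.rpow_add_one' (abs_nonneg _) (by linarith)]
    ring_nf
  rw [h2]
  gcongr

/-- Finite speed of propagation. -/
theorem IsSolution.eq_zero_of_lt_norm (h : IsSolution μ₁ ν₁ μ₂ ν₂ p q ε u₀ u₁ v₀ v₁ T u v)
    (hμ₁ : 0 ≤ μ₁) (hμ₂ : 0 ≤ μ₂) (hp : 1 < p) (hq : 1 < q)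
    (hu₀R : tsupport u₀ ⊆ Metric.closedBall 0 R) (hu₁R : tsupport u₁ ⊆ Metric.closedBall 0 R)
    (hv₀R : tsupport v₀ ⊆ Metric.closedBall 0 R) (hv₁R : tsupport v₁ ⊆ Metric.closedBall 0 R)
    {t : ℝ} (ht : 0 ≤ t) (htT : ENNReal.ofReal t < T) {x : EuclideanSpace ℝ (Fin n)}
    (hx : R + t < ‖x‖) : u t x = 0 ∧ v t x = 0 := by
  -- With b > t the point (t, x) lies strictly inside the cone with vertex (b, x); with b < ‖x‖ - R
  -- the base of this cone misses the support of the data.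
  obtain ⟨b, htb, hbx, hbT⟩ : ∃ b, t < b ∧ b < ‖x‖ - R ∧ ENNReal.ofReal b < T := by
    have h1 : ∀ᶠ s in 𝓝[>] t, ENNReal.ofReal s < T :=
      (ENNReal.continuous_ofReal.continuousAt.eventually_lt continuousAt_const htT).filter_mono
        nhdsWithin_le_nhds
    have h2 : ∀ᶠ s in 𝓝[>] t, s < ‖x‖ - R :=
      (eventually_lt_nhds (by linarith)).filter_mono nhdsWithin_le_nhds
    obtain ⟨b, hb⟩ := ((h1.and h2).and eventually_mem_nhdsWithin).exists
    exact ⟨b, hb.2, hb.1.2, hb.1.1⟩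
  have hb : 0 < b := ht.trans_lt htb
  obtain ⟨ut, ux, utt, utx, uxx, vt, vx, vtt, vtx, vxx, hs, hut, hvt⟩ := h.exists_solvesOn hb hbT
  have hout : ∀ {w : EuclideanSpace ℝ (Fin n) → ℝ}, tsupport w ⊆ Metric.closedBall 0 R →
      ∀ y ∈ (Metric.closedBall (0 : EuclideanSpace ℝ (Fin n)) R)ᶜ, w y = 0 := fun hw y hy =>
    image_eq_zero_of_notMem_tsupport fun hyw => hy (hw hyw)
  have hUo : IsOpen (Metric.closedBall (0 : EuclideanSpace ℝ (Fin n)) R)ᶜ :=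
    Metric.isClosed_closedBall.isOpen_compl
  obtain ⟨M₁, hM₁, hM₁'⟩ := exists_rpow_le_mul_abs (isCompact_closedBall x b) hs.jet_v.cont_t hp
  obtain ⟨M₂, hM₂, hM₂'⟩ := exists_rpow_le_mul_abs (isCompact_closedBall x b) hs.jet_u.cont_t hq
  refine eq_zero_in_cone hb hs.jet_u hs.jet_v (M := M₁ + M₂) (ν₁ := ν₁) (ν₂ := ν₂) hμ₁ hμ₂ (by positivity) x ?_ ?_ ?_
    ⟨ht, htb⟩
  · intro s hs' y hy
    rw [hs.eq_u s hs', abs_of_nonneg (by positivity)]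
    refine (hM₁' s (Ioo_subset_Icc_self hs') y hy).trans ?_
    nlinarith [abs_nonneg (vt s y)]
  · intro s hs' y hy
    rw [hs.eq_v s hs', abs_of_nonneg (by positivity)]
    refine (hM₂' s (Ioo_subset_Icc_self hs') y hy).trans ?_
    nlinarith [abs_nonneg (ut s y)]
  · intro y hy
    have hyU : y ∈ (Metric.closedBall (0 : EuclideanSpace ℝ (Fin n)) R)ᶜ := by
      rw [mem_compl_iff, mem_closedBall_zero_iff, not_le]
      rw [Metric.mem_ball, dist_eq_norm] at hy
      have := norm_sub_norm_le x y
      rw [norm_sub_rev] at this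
      linarith
    exact ⟨hs.jet_u.density_zero_eq_zero hb hUo (fun z hz => by rw [h.init_u, hout hu₀R z hz, mul_zero])
        (fun z hz => by rw [hut, hout hu₁R z hz, mul_zero]) hyU,
      hs.jet_v.density_zero_eq_zero hb hUo (fun z hz => by rw [h.init_v, hout hv₀R z hz, mul_zero])
        (fun z hz => by rw [hvt, hout hv₁R z hz, mul_zero]) hyU⟩

end FiniteSpeed

/-! ### The exponential test function and its mass on balls -/

section ExponentialWeight

variable {n : ℕ}

/-- The exponential weight `exp (l xᵢ)`. -/
def expWeight (l : ℝ) (i : Fin n) (x : EuclideanSpace ℝ (Fin n)) : ℝ := Real.exp (l * x i)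

theorem expWeight_pos (l : ℝ) (i : Fin n) (x : EuclideanSpace ℝ (Fin n)) :
    0 < expWeight l i x := Real.exp_pos _

theorem continuous_expWeight (l : ℝ) (i : Fin n) : Continuous (expWeight l i) := by
  unfold expWeight
  fun_prop

theorem hasLineDerivAt_expWeight (l : ℝ) (i j : Fin n) (x : EuclideanSpace ℝ (Fin n)) :
    HasLineDerivAt ℝ (expWeight l i) ((if i = j then l else 0) * expWeight l i x) x
      (EuclideanSpace.single j 1) := by
  have h : HasDerivAt (fun τ : ℝ => l * (x i + τ * (if i = j then 1 else 0)))
      (l * (if i = j then 1 else 0)) 0 := by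
    simpa using (((hasDerivAt_id (0:ℝ)).mul_const (if i = j then (1:ℝ) else 0)).const_add
      (x i)).const_mul l
  have e : (fun τ : ℝ => expWeight l i (x + τ • EuclideanSpace.single j 1)) =
      fun τ => Real.exp (l * (x i + τ * (if i = j then 1 else 0))) := by
    funext τ
    simp [expWeight]
  unfold HasLineDerivAt
  rw [e]
  refine h.exp.congr_deriv ?_
  split_ifs <;> simp [expWeight, mul_comm]

/-- On the ball of radius `r` the weight is bounded by a product of functions of one variable. -/
theorem expWeight_le_prod {l r : ℝ} (hl : 0 < l) (hr : 0 < r) (i : Fin n)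
    {x : EuclideanSpace ℝ (Fin n)} (hx : ‖x‖ ≤ r) :
    expWeight l i x ≤ Real.exp (l * r / 2) * ∏ j, (if j = i then
      (Iic r).indicator (fun s => Real.exp (l / 2 * s)) (x j)
      else Real.exp (-(l / (4 * r)) * x j ^ 2)) := by
  have hsum : x i ^ 2 + ∑ j ∈ Finset.univ.erase i, x j ^ 2 ≤ r ^ 2 := by
    rw [Finset.add_sum_erase _ (fun j => x j ^ 2) (Finset.mem_univ i),
      ← EuclideanSpace.real_norm_sq_eq]
    exact pow_le_pow_left₀ (norm_nonneg _) hx 2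
  have hS : 0 ≤ ∑ j ∈ Finset.univ.erase i, x j ^ 2 := Finset.sum_nonneg fun j _ => sq_nonneg _
  have hxr : x i ≤ r := by nlinarith
  rw [← Finset.mul_prod_erase _ _ (Finset.mem_univ i), if_pos rfl,
    indicator_of_mem (show x i ∈ Iic r from hxr),
    Finset.prod_congr rfl (g := fun j => Real.exp (-(l / (4 * r)) * x j ^ 2)) (fun j hj => by
      rw [if_neg (Finset.ne_of_mem_erase hj)]),
    ← Real.exp_sum, ← Real.exp_add, ← Real.exp_add, expWeight, Real.exp_le_exp, ← Finset.mul_sum]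
  set S := ∑ j ∈ Finset.univ.erase i, x j ^ 2
  -- On the ball, S ≤ r² - xᵢ² = (r + xᵢ)(r - xᵢ) with r + xᵢ ≤ 2r. So half of the exponent l xᵢ can
  -- be traded for Gaussian decay in the transverse variables.
  have h1 : S ≤ 2 * r * (r - x i) := by nlinarith
  have h2 : l / (4 * r) * S ≤ l / (4 * r) * (2 * r * (r - x i)) :=
    mul_le_mul_of_nonneg_left h1 (by positivity)
  have h3 : l / (4 * r) * (2 * r * (r - x i)) = l / 2 * (r - x i) := by
    field_simp
    ring
  linarith

/-- Fubini for the product majorant: the factor in xᵢ integrates to (2/l) exp(lr/2), and each of the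
n - 1 transverse Gaussians contributes √(4πr/l). The mass sits in a cap of width about √r, hence the
power r^((n-1)/2). -/
theorem setIntegral_expWeight_le {l r : ℝ} (hl : 0 < l) (hr : 0 < r) (i : Fin n) :
    ∫ x in Metric.closedBall 0 r, expWeight l i x ≤
      2 / l * Real.exp (l * r) * √(4 * Real.pi / l * r) ^ (n - 1) := by
  set f : Fin n → ℝ → ℝ := fun j => if j = i then
      (Iic r).indicator (fun s => Real.exp (l / 2 * s))
      else fun s => Real.exp (-(l / (4 * r)) * s ^ 2) with hf
  have hl2 : 0 < l / 2 := by positivity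
  have hlr : 0 < l / (4 * r) := by positivity
  have hfi : ∀ j, Integrable (f j) := by
    intro j
    by_cases hj : j = i
    · simp only [hf, if_pos hj]
      exact (integrable_indicator_iff measurableSet_Iic).2 (integrableOn_exp_mul_Iic hl2 r)
    · simp only [hf, if_neg hj]
      exact integrable_exp_neg_mul_sq hlr
  have hmp := PiLp.volume_preserving_ofLp (Fin n)
  have hemb : MeasurableEmbedding (@WithLp.ofLp 2 (Fin n → ℝ)) :=
    (MeasurableEquiv.toLp 2 (Fin n → ℝ)).symm.measurableEmbedding
  have hprod : Integrable (fun x : EuclideanSpace ℝ (Fin n) => ∏ j, f j (x j)) :=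
    (hmp.integrable_comp_emb hemb (g := fun y : Fin n → ℝ => ∏ j, f j (y j))).2
      (Integrable.fintype_prod hfi)
  have h_integral : ∫ x : EuclideanSpace ℝ (Fin n), ∏ j, f j (x j) = ∏ j, ∫ s, f j s := by
    rw [← integral_fintype_prod_volume_eq_prod]
    exact hmp.integral_comp hemb (fun y : Fin n → ℝ => ∏ j, f j (y j))
  have hpos : ∀ x : EuclideanSpace ℝ (Fin n), 0 ≤ ∏ j, f j (x j) := by
    refine fun x => Finset.prod_nonneg fun j _ => ?_
    by_cases hj : j = i
    · simp only [hf, if_pos hj]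
      exact indicator_nonneg (fun s _ => (Real.exp_pos _).le) _
    · simp only [hf, if_neg hj]
      positivity
  calc ∫ x in Metric.closedBall 0 r, expWeight l i x
      ≤ ∫ x in Metric.closedBall (0 : EuclideanSpace ℝ (Fin n)) r,
          Real.exp (l * r / 2) * ∏ j, f j (x j) := by
        refine setIntegral_mono_on ((continuous_expWeight l i).continuousOn.integrableOn_compact
          (isCompact_closedBall 0 r)) (hprod.const_mul _).integrableOn
          Metric.isClosed_closedBall.measurableSet fun x hx => ?_
        refine (expWeight_le_prod hl hr i (by simpa using hx)).trans_eq ?_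
        congr 1
        refine Finset.prod_congr rfl fun j _ => ?_
        by_cases hj : j = i <;> simp [hf, hj]
    _ ≤ ∫ x : EuclideanSpace ℝ (Fin n), Real.exp (l * r / 2) * ∏ j, f j (x j) :=
        setIntegral_le_integral (hprod.const_mul _)
          (Eventually.of_forall fun x => mul_nonneg (Real.exp_pos _).le (hpos x))
    _ = Real.exp (l * r / 2) * ∏ j, ∫ s, f j s := by rw [integral_const_mul, h_integral]
    _ = _ := by
        rw [← Finset.mul_prod_erase _ _ (Finset.mem_univ i),
          Finset.prod_congr rfl (g := fun _ => √(4 * Real.pi / l * r)) (fun j hj => by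
            simp only [hf, if_neg (Finset.ne_of_mem_erase hj), integral_gaussian]
            congr 1
            field_simp)]
        simp only [hf, if_true, integral_indicator measurableSet_Iic, integral_exp_mul_Iic hl2,
          Finset.prod_const, Finset.card_erase_of_mem (Finset.mem_univ i), Finset.card_univ,
          Fintype.card_fin]
        rw [show Real.exp (l * r) = Real.exp (l * r / 2) * Real.exp (l / 2 * r) by
          rw [← Real.exp_add]; ring_nf]
        field_simp

theorem exists_setIntegral_expWeight_le {l R : ℝ} (hl : 0 < l) (hR : 0 < R) (i : Fin n) :
    ∃ K, 0 < K ∧ ∀ t, 0 ≤ t → ∫ x in Metric.closedBall 0 (R + t), expWeight l i x ≤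
      K * Real.exp (l * t) * (1 + t) ^ (((n : ℝ) - 1) / 2) := by
  refine ⟨2 / l * Real.exp (l * R) * √(4 * Real.pi / l * (1 + R)) ^ (n - 1), by positivity,
    fun t ht => ?_⟩
  refine (setIntegral_expWeight_le hl (by positivity) i).trans ?_
  have hn : 1 ≤ n := Fin.pos i
  have h1 : √(4 * Real.pi / l * (R + t)) ≤ √(4 * Real.pi / l * (1 + R)) * √(1 + t) := by
    rw [← Real.sqrt_mul (by positivity), mul_assoc]
    refine Real.sqrt_le_sqrt (mul_le_mul_of_nonneg_left ?_ (by positivity))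
    nlinarith
  have h2 : √(1 + t) ^ (n - 1) = (1 + t) ^ (((n : ℝ) - 1) / 2) := by
    rw [Real.sqrt_eq_rpow, ← Real.rpow_natCast, ← Real.rpow_mul (by positivity), Nat.cast_sub hn]
    congr 1
    push_cast
    ring
  calc _ ≤ 2 / l * Real.exp (l * (R + t)) *
        (√(4 * Real.pi / l * (1 + R)) * √(1 + t)) ^ (n - 1) := by gcongr
    _ = _ := by
      rw [mul_pow, h2, mul_add, Real.exp_add]
      ring

/-- Jensen's inequality, in a form that only needs an upper bound for the total mass. -/
theorem rpow_mul_rpow_le_integral {f w : EuclideanSpace ℝ (Fin n) → ℝ} {r p M : ℝ} (hp : 1 < p)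
    (hf : Continuous f) (hw : Continuous w) (hw0 : ∀ x, 0 ≤ w x)
    (hf0 : ∀ x, r < ‖x‖ → f x = 0) (hM : 0 < M)
    (hwM : ∫ x in Metric.closedBall 0 r, w x ≤ M) :
    (∫ x, |f x| * w x) ^ p * M ^ (1 - p) ≤ ∫ x, |f x| ^ p * w x := by
  have hp0 : 0 < p := by linarith
  set K : Set (EuclideanSpace ℝ (Fin n)) := Metric.closedBall 0 r
  have hK : IsCompact K := isCompact_closedBall 0 r
  have hKf : ∀ x ∉ K, f x = 0 := fun x hx => hf0 x (by
    rwa [mem_closedBall_zero_iff, not_le] at hx)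
  have i1 : Integrable fun x => |f x| * w x :=
    integrable_of_eq_zero_off_compact hK (by fun_prop) fun x hx => by simp [hKf x hx]
  have i2 : Integrable fun x => |f x| ^ p * w x := by
    refine integrable_of_eq_zero_off_compact hK ?_ fun x hx => by
      simp [hKf x hx, Real.zero_rpow hp0.ne']
    exact (hf.abs.rpow_const fun x => Or.inr hp0.le).mul hw
  have i3 : Integrable (K.indicator w) := (integrable_indicator_iff hK.measurableSet).2
    (hw.continuousOn.integrableOn_compact hK)
  set Y := ∫ x, |f x| * w x
  have hY : 0 ≤ Y := integral_nonneg fun x => mul_nonneg (abs_nonneg _) (hw0 x)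
  set c := Y / M with hc
  have hc0 : 0 ≤ c := by positivity
  -- The graph of a ↦ a^p lies above its tangent at c = Y/M. Once integrated, the total mass of `w`
  -- appears with a negative coefficient, so the upper bound M for it is enough.
  have htan : ∀ a, 0 ≤ a → p * c ^ (p - 1) * a - (p - 1) * c ^ p ≤ a ^ p := by
    intro a ha
    rcases hc0.eq_or_lt with h | h
    · rw [← h, Real.zero_rpow (by linarith), Real.zero_rpow hp0.ne']
      simp only [mul_zero, zero_mul, sub_zero]
      positivity
    · have hb := one_add_mul_self_le_rpow_one_add (s := a / c - 1) (by
        have : 0 ≤ a / c := by positivity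
        linarith) hp.le
      rw [add_sub_cancel, Real.div_rpow ha h.le, le_div_iff₀ (by positivity)] at hb
      have e : c ^ (p - 1) = c ^ p / c := Real.rpow_sub_one h.ne' p
      rw [e]
      calc _ = (1 + p * (a / c - 1)) * c ^ p := by field_simp; ring
        _ ≤ _ := hb
  have hpt : ∀ x, p * c ^ (p - 1) * (|f x| * w x) - (p - 1) * c ^ p * K.indicator w x ≤
      |f x| ^ p * w x := by
    intro x
    by_cases hx : x ∈ K
    · rw [indicator_of_mem hx]
      have := mul_le_mul_of_nonneg_right (htan _ (abs_nonneg (f x))) (hw0 x)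
      linarith
    · simp [indicator_of_notMem hx, hKf x hx, Real.zero_rpow hp0.ne']
  have h_integral : ∫ x, (p * c ^ (p - 1) * (|f x| * w x) - (p - 1) * c ^ p * K.indicator w x) ≤
      ∫ x, |f x| ^ p * w x := integral_mono ((i1.const_mul (p * c ^ (p - 1))).sub
    (i3.const_mul ((p - 1) * c ^ p))) i2 hpt
  rw [integral_sub (i1.const_mul _) (i3.const_mul _), integral_const_mul, integral_const_mul,
    integral_indicator hK.measurableSet] at h_integral
  refine le_trans ?_ h_integral
  have h1 : (p - 1) * c ^ p * ∫ x in K, w x ≤ (p - 1) * c ^ p * M :=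
    mul_le_mul_of_nonneg_left hwM (mul_nonneg (by linarith) (by positivity))
  have h2 : c ^ (p - 1) * Y = c ^ p * M := by
    have : Y = c * M := by rw [hc]; field_simp
    rw [this, ← mul_assoc, ← Real.rpow_add_one' hc0 (by linarith)]
    ring_nf
  have h3 : Y ^ p * M ^ (1 - p) = c ^ p * M := by
    rw [hc, Real.div_rpow hY hM.le, Real.rpow_sub hM, Real.rpow_one]
    ring
  rw [h3]
  change _ ≤ p * c ^ (p - 1) * Y - _
  nlinarith

end ExponentialWeight

/-! ### The functional ∫ u exp(l xᵢ) and its differential equation -/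

section Functional

variable {n : ℕ} {b R μ ν l : ℝ} {u ut utt : ℝ → EuclideanSpace ℝ (Fin n) → ℝ}
  {ux utx uxx : Fin n → ℝ → EuclideanSpace ℝ (Fin n) → ℝ} {i : Fin n}

theorem Jet.ut_eq_zero (hu : Jet b u ut ux utt utx uxx) {x : EuclideanSpace ℝ (Fin n)} {t : ℝ}
    (ht : t ∈ Ioo 0 b) (h : ∀ᶠ s in 𝓝 t, u s x = 0) : ut t x = 0 :=
  (hu.deriv_t t ht x).unique ((hasDerivAt_const t (0:ℝ)).congr_of_eventuallyEq h)

theorem Jet.ut_eq_zero_of_lt_norm (hu : Jet b u ut ux utt utx uxx)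
    (h0 : ∀ t ∈ Icc 0 b, ∀ x, R + t < ‖x‖ → u t x = 0) {t : ℝ} (ht : t ∈ Ioo 0 b)
    {x : EuclideanSpace ℝ (Fin n)} (hx : R + t < ‖x‖) : ut t x = 0 := by
  refine hu.ut_eq_zero ht ?_
  filter_upwards [isOpen_Ioo.mem_nhds ht,
    eventually_lt_nhds (show t < ‖x‖ - R by linarith)] with s hs hs'
  exact h0 s (Ioo_subset_Icc_self hs) x (by linarith)

theorem Jet.ut_eq_zero_off_ball (hb : 0 < b) (hu : Jet b u ut ux utt utx uxx)
    (h0 : ∀ t ∈ Icc 0 b, ∀ x, R + t < ‖x‖ → u t x = 0) {t : ℝ} (ht : t ∈ Icc 0 b)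
    {x : EuclideanSpace ℝ (Fin n)} (hx : x ∉ Metric.closedBall 0 (R + b)) : ut t x = 0 := by
  rw [mem_closedBall_zero_iff, not_le] at hx
  have h1 : EqOn (fun s => ut s x) (fun _ => 0) (Ioo 0 b) := fun s hs =>
    hu.ut_eq_zero_of_lt_norm h0 hs (by linarith [hs.2])
  have hc : ContinuousOn (fun s => ut s x) (Icc 0 b) :=
    hu.cont_t.comp (f := fun s => (s, x)) (by fun_prop) fun s hs => mk_mem_prod hs (mem_univ x)
  -- The endpoints t = 0 and t = b are reached by continuity of uₜ.
  exact h1.of_subset_closure hc continuousOn_const Ioo_subset_Icc_self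
    (by rw [closure_Ioo hb.ne]) ht

theorem Jet.continuousOn_functional (hu : Jet b u ut ux utt utx uxx)
    (h0 : ∀ t ∈ Icc 0 b, ∀ x, R + t < ‖x‖ → u t x = 0) :
    ContinuousOn (fun t => ∫ x, u t x * expWeight l i x) (Icc 0 b) := by
  refine continuousOn_integral_of_compact_support (isCompact_closedBall 0 (R + b))
    (hu.cont.mul ((continuous_expWeight l i).comp continuous_snd).continuousOn) fun t x ht hx => ?_
  rw [mem_closedBall_zero_iff, not_le] at hx
  rw [h0 t ht x (by linarith [ht.2]), zero_mul]

theorem Jet.continuousOn_functional_t (hb : 0 < b) (hu : Jet b u ut ux utt utx uxx)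
    (h0 : ∀ t ∈ Icc 0 b, ∀ x, R + t < ‖x‖ → u t x = 0) :
    ContinuousOn (fun t => ∫ x, ut t x * expWeight l i x) (Icc 0 b) := by
  refine continuousOn_integral_of_compact_support (isCompact_closedBall 0 (R + b))
    (hu.cont_t.mul ((continuous_expWeight l i).comp continuous_snd).continuousOn)
    fun t x ht hx => ?_
  rw [hu.ut_eq_zero_off_ball hb h0 ht hx, zero_mul]

theorem Jet.hasDerivAt_functional (hu : Jet b u ut ux utt utx uxx)
    (h0 : ∀ t ∈ Icc 0 b, ∀ x, R + t < ‖x‖ → u t x = 0) {t : ℝ} (ht : t ∈ Ioo 0 b) :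
    HasDerivAt (fun t => ∫ x, u t x * expWeight l i x) (∫ x, ut t x * expWeight l i x) t := by
  refine hasDerivAt_integral_of_compact (a := 0) (b := b) (isCompact_closedBall 0 (R + b))
    (f := fun t x => u t x * expWeight l i x) (f' := fun t x => ut t x * expWeight l i x)
    ?_ ?_ ?_ ?_ ht
  · exact fun s hs => (continuous_slice hu.cont (Ioo_subset_Icc_self hs)).mul
      (continuous_expWeight l i)
  · exact (hu.cont_t.mono (prod_mono Ioo_subset_Icc_self subset_rfl)).mul
      ((continuous_expWeight l i).comp continuous_snd).continuousOn
  · exact fun s hs x => (hu.deriv_t s hs x).mul_const _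
  · intro s hs x hx
    rw [mem_closedBall_zero_iff, not_le] at hx
    rw [h0 s (Ioo_subset_Icc_self hs) x (by linarith [hs.2]), zero_mul]

theorem Jet.hasDerivAt_functional_t (hb : 0 < b) (hu : Jet b u ut ux utt utx uxx)
    (h0 : ∀ t ∈ Icc 0 b, ∀ x, R + t < ‖x‖ → u t x = 0) {t : ℝ} (ht : t ∈ Ioo 0 b) :
    HasDerivAt (fun t => ∫ x, ut t x * expWeight l i x) (∫ x, utt t x * expWeight l i x) t := by
  refine hasDerivAt_integral_of_compact (a := 0) (b := b) (isCompact_closedBall 0 (R + b))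
    (f := fun t x => ut t x * expWeight l i x) (f' := fun t x => utt t x * expWeight l i x)
    ?_ ?_ ?_ ?_ ht
  · exact fun s hs => (continuous_slice hu.cont_t (Ioo_subset_Icc_self hs)).mul
      (continuous_expWeight l i)
  · exact hu.cont_tt.mul ((continuous_expWeight l i).comp continuous_snd).continuousOn
  · exact fun s hs x => (hu.deriv_tt s hs x).mul_const _
  · intro s hs x hx
    rw [hu.ut_eq_zero_off_ball hb h0 (Ioo_subset_Icc_self hs) hx, zero_mul]

/-- Pairing the wave operator with the exponential weight. -/
theorem Jet.functional_eq (hb : 0 < b) (hu : Jet b u ut ux utt utx uxx)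
    (h0 : ∀ t ∈ Icc 0 b, ∀ x, R + t < ‖x‖ → u t x = 0) {F : ℝ → EuclideanSpace ℝ (Fin n) → ℝ}
    (heq : ∀ t ∈ Ioo 0 b, ∀ x, utt t x - (∑ i, uxx i t x) + μ / (1 + t) * ut t x
      + ν ^ 2 / (1 + t) ^ 2 * u t x = F t x) {t : ℝ} (ht : t ∈ Ioo 0 b) :
    (∫ x, utt t x * expWeight l i x) + μ / (1 + t) * (∫ x, ut t x * expWeight l i x)
      + (ν ^ 2 / (1 + t) ^ 2 - l ^ 2) * (∫ x, u t x * expWeight l i x)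
      = ∫ x, F t x * expWeight l i x := by
  have ht' := Ioo_subset_Icc_self ht
  have hK : IsCompact (Metric.closedBall (0 : EuclideanSpace ℝ (Fin n)) (R + b)) :=
    isCompact_closedBall 0 (R + b)
  have hKo : IsOpen (Metric.closedBall (0 : EuclideanSpace ℝ (Fin n)) (R + b))ᶜ :=
    hK.isClosed.isOpen_compl
  have z0 : ∀ x ∉ Metric.closedBall (0 : EuclideanSpace ℝ (Fin n)) (R + b), u t x = 0 := by
    intro x hx
    rw [mem_closedBall_zero_iff, not_le] at hx
    exact h0 t ht' x (by linarith [ht.2])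
  have hline : ∀ {f : EuclideanSpace ℝ (Fin n) → ℝ} {f' : ℝ} {x v : EuclideanSpace ℝ (Fin n)},
      (∀ x ∉ Metric.closedBall (0 : EuclideanSpace ℝ (Fin n)) (R + b), f x = 0) →
      x ∉ Metric.closedBall (0 : EuclideanSpace ℝ (Fin n)) (R + b) →
      HasLineDerivAt ℝ f f' x v → f' = 0 := by
    intro f f' x v hf hx hd
    refine HasDerivAt.unique hd ((hasDerivAt_const (0:ℝ) (0:ℝ)).congr_of_eventuallyEq ?_)
    have hc : ContinuousAt (fun τ : ℝ => x + τ • v) 0 := by fun_prop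
    filter_upwards [hc (hKo.mem_nhds (by simpa using hx))] with τ hτ using hf _ hτ
  have zx : ∀ j, ∀ x ∉ Metric.closedBall (0 : EuclideanSpace ℝ (Fin n)) (R + b), ux j t x = 0 :=
    fun j x hx => hline z0 hx (hu.line_x j t ht' x)
  have zxx : ∀ j, ∀ x ∉ Metric.closedBall (0 : EuclideanSpace ℝ (Fin n)) (R + b),
      uxx j t x = 0 := fun j x hx => hline (zx j) hx (hu.line_xx j t ht x)
  have zt : ∀ x ∉ Metric.closedBall (0 : EuclideanSpace ℝ (Fin n)) (R + b), ut t x = 0 :=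
    fun x hx => hu.ut_eq_zero_off_ball hb h0 ht' hx
  have ztt : ∀ x ∉ Metric.closedBall (0 : EuclideanSpace ℝ (Fin n)) (R + b), utt t x = 0 := by
    intro x hx
    refine (hu.deriv_tt t ht x).unique ((hasDerivAt_const t (0:ℝ)).congr_of_eventuallyEq ?_)
    filter_upwards [isOpen_Ioo.mem_nhds ht] with s hs
      using hu.ut_eq_zero_off_ball hb h0 (Ioo_subset_Icc_self hs) hx
  have hw := continuous_expWeight l i
  have c0 := continuous_slice hu.cont ht'
  have ct := continuous_slice hu.cont_t ht'
  have ctt := continuous_slice hu.cont_tt ht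
  have cx := fun j => continuous_slice (hu.cont_x j) ht'
  have cxx := fun j => continuous_slice (hu.cont_xx j) ht
  have hI : ∀ {f : EuclideanSpace ℝ (Fin n) → ℝ}, Continuous f →
      (∀ x ∉ Metric.closedBall (0 : EuclideanSpace ℝ (Fin n)) (R + b), f x = 0) →
      Integrable fun x => f x * expWeight l i x := fun hf hf0 =>
    integrable_of_eq_zero_off_compact hK (hf.mul hw) fun x hx => by rw [hf0 x hx, zero_mul]
  -- Two integrations by parts put both derivatives on the weight, which depends on xᵢ only.
  have hibp : ∀ j, ∫ x, uxx j t x * expWeight l i x =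
      (if i = j then l ^ 2 else 0) * ∫ x, u t x * expWeight l i x := by
    intro j
    have hwd := hasLineDerivAt_expWeight l i j
    have e1 := integral_mul_hasLineDerivAt_of_compact hK (cx j) (cxx j) hw (by fun_prop)
      (hu.line_xx j t ht) hwd (zx j)
    have e2 := integral_mul_hasLineDerivAt_of_compact hK c0 (cx j) hw (by fun_prop)
      (hu.line_x j t ht') hwd z0
    have comm : ∀ (f : EuclideanSpace ℝ (Fin n) → ℝ) (c : ℝ),
        ∫ x, f x * (c * expWeight l i x) = c * ∫ x, f x * expWeight l i x := by
      intro f c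
      rw [← integral_const_mul]
      congr 1
      funext x
      ring
    rw [comm] at e1 e2
    split_ifs at e1 e2 ⊢
    · linear_combination e1 - l * e2
    · linear_combination e1
  have hlap : ∫ x, (∑ j, uxx j t x) * expWeight l i x = l ^ 2 * ∫ x, u t x * expWeight l i x := by
    simp_rw [Finset.sum_mul]
    rw [integral_finsetSum _ fun j _ => hI (cxx j) (zxx j), Finset.sum_congr rfl fun j _ => hibp j,
      ← Finset.sum_mul]
    simp
  have hsumI : Integrable fun x => (∑ j, uxx j t x) * expWeight l i x :=
    hI (continuous_finsetSum _ fun j _ => cxx j)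
      fun x hx => Finset.sum_eq_zero fun j _ => zxx j x hx
  have e : (fun x => F t x * expWeight l i x) = fun x => utt t x * expWeight l i x
      - (∑ j, uxx j t x) * expWeight l i x + μ / (1 + t) * (ut t x * expWeight l i x)
      + ν ^ 2 / (1 + t) ^ 2 * (u t x * expWeight l i x) := by
    funext x
    rw [← heq t ht x]
    ring
  have a1 : Integrable fun x => utt t x * expWeight l i x
      - (∑ j, uxx j t x) * expWeight l i x := (hI ctt ztt).sub hsumI
  have a2 : Integrable fun x => utt t x * expWeight l i x
      - (∑ j, uxx j t x) * expWeight l i x + μ / (1 + t) * (ut t x * expWeight l i x) :=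
    a1.add ((hI ct zt).const_mul _)
  rw [e, integral_add a2 ((hI c0 z0).const_mul _), integral_add a1 ((hI ct zt).const_mul _),
    integral_sub (hI ctt ztt) hsumI, integral_const_mul, integral_const_mul, hlap]
  ring

end Functional

/-! ### Positivity for cooperative differential inequalities -/

section Cooperative

variable {f g f' g' α β : ℝ → ℝ} {b : ℝ}

theorem monotoneOn_of_hasDerivAt_nonneg {a : ℝ} (hf : ContinuousOn f (Icc a b))
    (hd : ∀ t ∈ Ioo a b, HasDerivAt f (f' t) t) (h0 : ∀ t ∈ Ioo a b, 0 ≤ f' t) :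
    MonotoneOn f (Icc a b) := by
  refine monotoneOn_of_deriv_nonneg (convex_Icc a b) hf ?_ ?_
  · rw [interior_Icc]
    exact fun s hs => (hd s hs).differentiableAt.differentiableWithinAt
  · rw [interior_Icc]
    intro s hs
    rw [(hd s hs).deriv]
    exact h0 s hs

/-- Up to the first time at which min(f, g) ≤ 0 both functions are positive, so both are
nondecreasing there and remain above their positive initial values. -/
theorem pos_of_cooperative (hf : ContinuousOn f (Icc 0 b)) (hg : ContinuousOn g (Icc 0 b))
    (hfd : ∀ t ∈ Ioo 0 b, HasDerivAt f (f' t) t) (hgd : ∀ t ∈ Ioo 0 b, HasDerivAt g (g' t) t)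
    (hα : ∀ t ∈ Ioo 0 b, 0 ≤ α t) (hβ : ∀ t ∈ Ioo 0 b, 0 ≤ β t)
    (hfα : ∀ t ∈ Ioo 0 b, α t * g t ≤ f' t) (hgβ : ∀ t ∈ Ioo 0 b, β t * f t ≤ g' t)
    (hf0 : 0 < f 0) (hg0 : 0 < g 0) {t : ℝ} (ht : t ∈ Icc 0 b) : 0 < f t ∧ 0 < g t := by
  rw [← lt_min_iff]
  by_contra hcon
  have hc : ContinuousOn (fun s => min (f s) (g s)) (Icc 0 b) := fun s hs => (hf s hs).min (hg s hs)
  have hcl : IsClosed (Icc 0 b ∩ (fun s => min (f s) (g s)) ⁻¹' Iic 0) :=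
    hc.preimage_isClosed_of_isClosed isClosed_Icc isClosed_Iic
  obtain ⟨t₁, ⟨ht₁, ht₁'⟩, hleast⟩ :=
    (isCompact_Icc.of_isClosed_subset hcl inter_subset_left).exists_isLeast
      ⟨t, ht, not_lt.1 hcon⟩
  have hpos : ∀ s ∈ Ioo 0 t₁, 0 < f s ∧ 0 < g s := by
    intro s hs
    rw [← lt_min_iff]
    by_contra h
    exact absurd (hleast ⟨⟨hs.1.le, hs.2.le.trans ht₁.2⟩, not_lt.1 h⟩) (not_le.2 hs.2)
  have hsub : Ioo 0 t₁ ⊆ Ioo 0 b := Ioo_subset_Ioo_right ht₁.2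
  have hsub' : Icc 0 t₁ ⊆ Icc 0 b := Icc_subset_Icc_right ht₁.2
  have m1 := monotoneOn_of_hasDerivAt_nonneg (hf.mono hsub') (fun s hs => hfd s (hsub hs))
    (fun s hs => (mul_nonneg (hα s (hsub hs)) (hpos s hs).2.le).trans (hfα s (hsub hs)))
    ⟨le_rfl, ht₁.1⟩ ⟨ht₁.1, le_rfl⟩ ht₁.1
  have m2 := monotoneOn_of_hasDerivAt_nonneg (hg.mono hsub') (fun s hs => hgd s (hsub hs))
    (fun s hs => (mul_nonneg (hβ s (hsub hs)) (hpos s hs).1.le).trans (hgβ s (hsub hs)))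
    ⟨le_rfl, ht₁.1⟩ ⟨ht₁.1, le_rfl⟩ ht₁.1
  have : 0 < min (f t₁) (g t₁) := lt_min (hf0.trans_le m1) (hg0.trans_le m2)
  exact absurd ht₁' (not_le.2 this)

/-- A cooperative system of differential inequalities preserves nonnegativity. -/
theorem nonneg_of_cooperative {K : ℝ} (hf : ContinuousOn f (Icc 0 b))
    (hg : ContinuousOn g (Icc 0 b))
    (hfd : ∀ t ∈ Ioo 0 b, HasDerivAt f (f' t) t) (hgd : ∀ t ∈ Ioo 0 b, HasDerivAt g (g' t) t)
    (hα : ∀ t ∈ Ioo 0 b, 0 ≤ α t) (hβ : ∀ t ∈ Ioo 0 b, 0 ≤ β t)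
    (hαK : ∀ t ∈ Ioo 0 b, α t ≤ K) (hβK : ∀ t ∈ Ioo 0 b, β t ≤ K)
    (hfα : ∀ t ∈ Ioo 0 b, α t * g t ≤ f' t) (hgβ : ∀ t ∈ Ioo 0 b, β t * f t ≤ g' t)
    (hf0 : 0 ≤ f 0) (hg0 : 0 ≤ g 0) {t : ℝ} (ht : t ∈ Icc 0 b) : 0 ≤ f t ∧ 0 ≤ g t := by
  -- Adding η exp(Kt) makes the data strictly positive and preserves the inequalities, because K
  -- dominates α and β. At the end η is chosen to make the perturbed value exactly 0.
  have key : ∀ η, 0 < η → 0 < f t + η * Real.exp (K * t) ∧ 0 < g t + η * Real.exp (K * t) := by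
    intro η hη
    have hexp : ∀ s, HasDerivAt (fun s => η * Real.exp (K * s)) (η * (Real.exp (K * s) * K)) s := by
      intro s
      simpa using ((hasDerivAt_id s).const_mul K).exp.const_mul η
    have hc : ContinuousOn (fun s => η * Real.exp (K * s)) (Icc 0 b) := by fun_prop
    refine pos_of_cooperative (f := fun s => f s + η * Real.exp (K * s))
      (g := fun s => g s + η * Real.exp (K * s)) (hf.add hc) (hg.add hc)
      (fun s hs => (hfd s hs).add (hexp s)) (fun s hs => (hgd s hs).add (hexp s)) hα hβ ?_ ?_ ?_ ?_
      ht
    · intro s hs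
      have h1 : 0 ≤ η * Real.exp (K * s) := by positivity
      nlinarith [hfα s hs, mul_le_mul_of_nonneg_right (hαK s hs) h1]
    · intro s hs
      have h1 : 0 ≤ η * Real.exp (K * s) := by positivity
      nlinarith [hgβ s hs, mul_le_mul_of_nonneg_right (hβK s hs) h1]
    · have : 0 < η * Real.exp (K * 0) := by positivity
      linarith
    · have : 0 < η * Real.exp (K * 0) := by positivity
      linarith
  have he := Real.exp_pos (K * t)
  constructor
  · by_contra h
    have h' := (key (-f t / Real.exp (K * t)) (div_pos (by linarith) he)).1
    rw [div_mul_cancel₀ _ he.ne'] at h'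
    linarith
  · by_contra h
    have h' := (key (-g t / Real.exp (K * t)) (div_pos (by linarith) he)).2
    rw [div_mul_cancel₀ _ he.ne'] at h'
    linarith

end Cooperative

/-! ### The damped ordinary differential equation and its renormalisation -/

/-- The damped linear equation `y'' + μ/(1+t) y' + (ν²/(1+t)² - l²) y = N` on `[0, b]` with
nonnegative source and data. -/
structure DampedODE (b μ ν l : ℝ) (y y₁ y₂ N : ℝ → ℝ) : Prop where
  cont : ContinuousOn y (Icc 0 b)
  cont₁ : ContinuousOn y₁ (Icc 0 b)
  deriv : ∀ t ∈ Ioo 0 b, HasDerivAt y (y₁ t) t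
  deriv₁ : ∀ t ∈ Ioo 0 b, HasDerivAt y₁ (y₂ t) t
  eq : ∀ t ∈ Ioo 0 b, y₂ t + μ / (1 + t) * y₁ t + (ν ^ 2 / (1 + t) ^ 2 - l ^ 2) * y t = N t
  source_nonneg : ∀ t ∈ Ioo 0 b, 0 ≤ N t
  zero_nonneg : 0 ≤ y 0
  zero_nonneg₁ : 0 ≤ y₁ 0

/-- The weight `exp (-l t) (1+t)^(μ/2) exp (-1/(1+t))`. -/
def profile (μ l t : ℝ) : ℝ :=
  Real.exp (-l * t) * (1 + t) ^ (μ / 2) * Real.exp (-(1 + t)⁻¹)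

/-- The renormalised functional: `profile` times a first order factor of the equation. -/
def renorm (μ l : ℝ) (y y₁ : ℝ → ℝ) (t : ℝ) : ℝ :=
  profile μ l t * (y₁ t + (l + μ / 2 * (1 + t)⁻¹ - (1 + t)⁻¹ ^ 2) * y t)

theorem hasDerivAt_one_add_inv {t : ℝ} (ht : 0 ≤ t) :
    HasDerivAt (fun s : ℝ => (1 + s)⁻¹) (-(1 + t)⁻¹ ^ 2) t := by
  have h := ((hasDerivAt_id t).const_add 1).inv (show (1:ℝ) + t ≠ 0 by positivity)
  refine h.congr_deriv ?_
  simp [div_eq_mul_inv, inv_pow]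

theorem hasDerivAt_one_add_rpow {t : ℝ} (ht : 0 ≤ t) (a : ℝ) :
    HasDerivAt (fun s : ℝ => (1 + s) ^ a) ((1 + t) ^ a * (a * (1 + t)⁻¹)) t := by
  have h := ((hasDerivAt_id t).const_add 1).rpow_const (p := a)
    (Or.inl (show (1:ℝ) + t ≠ 0 by positivity))
  refine h.congr_deriv ?_
  simp only [id, one_mul]
  rw [Real.rpow_sub_one (by positivity)]
  ring

theorem continuousOn_one_add_rpow (a b : ℝ) : ContinuousOn (fun s : ℝ => (1 + s) ^ a) (Icc 0 b) :=
  fun _ ht => (hasDerivAt_one_add_rpow ht.1 a).continuousAt.continuousWithinAt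

theorem continuousOn_one_add_inv (b : ℝ) : ContinuousOn (fun s : ℝ => (1 + s)⁻¹) (Icc 0 b) :=
  fun _ ht => (hasDerivAt_one_add_inv ht.1).continuousAt.continuousWithinAt

theorem profile_pos {μ l t : ℝ} (ht : 0 ≤ t) : 0 < profile μ l t := by
  unfold profile
  positivity

theorem hasDerivAt_profile (μ l : ℝ) {t : ℝ} (ht : 0 ≤ t) :
    HasDerivAt (profile μ l)
      (profile μ l t * (-l + μ / 2 * (1 + t)⁻¹ + (1 + t)⁻¹ ^ 2)) t := by
  have h1 : HasDerivAt (fun s => Real.exp (-l * s)) (Real.exp (-l * t) * -l) t := by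
    simpa using ((hasDerivAt_id t).const_mul (-l)).exp
  have h3 := (hasDerivAt_one_add_inv ht).neg.exp
  refine ((h1.mul (hasDerivAt_one_add_rpow ht (μ / 2))).mul h3).congr_deriv ?_
  simp only [profile, Pi.mul_apply, Pi.neg_apply]
  ring

namespace DampedODE

variable {b μ ν l : ℝ} {y y₁ y₂ N : ℝ → ℝ}

/-- The factor (1+t)^μ absorbs the damping: y and (1+t)^μ y' form a cooperative system with
nonnegative coefficients, because l² ≥ ν² and N ≥ 0. -/
theorem nonneg (h : DampedODE b μ ν l y y₁ y₂ N) (hμ : 0 ≤ μ) (hl : ν ^ 2 + μ + 2 ≤ l ^ 2)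
    {t : ℝ} (ht : t ∈ Icc 0 b) : 0 ≤ y t ∧ 0 ≤ y₁ t := by
  have hb : 0 ≤ b := ht.1.trans ht.2
  have hν : ∀ s ∈ Ioo 0 b, ν ^ 2 / (1 + s) ^ 2 ≤ ν ^ 2 := fun s hs =>
    div_le_self (sq_nonneg _) (by nlinarith [hs.1])
  have key := nonneg_of_cooperative (f := y) (g := fun s => (1 + s) ^ μ * y₁ s)
    (f' := y₁) (g' := fun s => (1 + s) ^ μ * (μ * (1 + s)⁻¹) * y₁ s + (1 + s) ^ μ * y₂ s)
    (α := fun s => (1 + s) ^ (-μ))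
    (β := fun s => (1 + s) ^ μ * (l ^ 2 - ν ^ 2 / (1 + s) ^ 2))
    (K := 1 + (1 + b) ^ μ * l ^ 2)
    h.cont ((continuousOn_one_add_rpow μ b).mul h.cont₁) h.deriv
    (fun s hs => (hasDerivAt_one_add_rpow hs.1.le μ).mul (h.deriv₁ s hs))
    ?_ ?_ ?_ ?_ ?_ ?_ h.zero_nonneg (by simpa using h.zero_nonneg₁) ht
  · have h1t : 0 < (1 + t) ^ μ := Real.rpow_pos_of_pos (by linarith [ht.1]) _
    exact ⟨key.1, nonneg_of_mul_nonneg_right key.2 h1t⟩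
  · intro s hs
    have := hs.1
    positivity
  · intro s hs
    have := hs.1
    have := hν s hs
    exact mul_nonneg (by positivity) (by linarith)
  · intro s hs
    have h1 : (1 + s) ^ (-μ) ≤ 1 :=
      Real.rpow_le_one_of_one_le_of_nonpos (by linarith [hs.1]) (by linarith)
    have h2 : 0 ≤ (1 + b) ^ μ * l ^ 2 := by positivity
    linarith
  · intro s hs
    have h0 := hs.1
    have h1 : (1 + s) ^ μ ≤ (1 + b) ^ μ :=
      Real.rpow_le_rpow (by linarith [hs.1]) (by linarith [hs.2]) hμ
    have h2 : (1 + s) ^ μ * (l ^ 2 - ν ^ 2 / (1 + s) ^ 2) ≤ (1 + b) ^ μ * l ^ 2 := by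
      refine mul_le_mul h1 ?_ (by have := hν s hs; linarith) (by positivity)
      have : 0 ≤ ν ^ 2 / (1 + s) ^ 2 := by positivity
      linarith
    linarith
  · intro s hs
    have h0 := hs.1
    rw [← mul_assoc, ← Real.rpow_add (by positivity)]
    simp
  · intro s hs
    have h0 := hs.1
    have h1 : 0 < (1 + s) ^ μ := by positivity
    have e : y₂ s = N s - μ / (1 + s) * y₁ s - (ν ^ 2 / (1 + s) ^ 2 - l ^ 2) * y s := by
      linarith [h.eq s hs]
    have h2 := mul_nonneg h1.le (h.source_nonneg s hs)
    have e' : (1 + s) ^ μ * (μ * (1 + s)⁻¹) * y₁ s + (1 + s) ^ μ * y₂ s =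
        (1 + s) ^ μ * N s + (1 + s) ^ μ * (l ^ 2 - ν ^ 2 / (1 + s) ^ 2) * y s := by
      rw [e]
      ring
    simp only [e']
    linarith

/-- The functional grows: `t/(1+t) y ≤ y'`. -/
theorem div_mul_le (h : DampedODE b μ ν l y y₁ y₂ N) (hμ : 0 ≤ μ)
    (hl : ν ^ 2 + μ + 2 ≤ l ^ 2) {t : ℝ} (ht : t ∈ Icc 0 b) :
    (1 - (1 + t)⁻¹) * y t ≤ y₁ t := by
  have hb : 0 ≤ b := ht.1.trans ht.2
  -- φ is the integrating factor for z = y' - (1 - τ) y with τ = 1/(1+s): in z' + (φ'/φ) z the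
  -- coefficient of y' is exactly cancelled by the damping. The factor 1 - τ vanishes at s = 0, so
  -- that z(0) = y'(0) ≥ 0.
  set φ : ℝ → ℝ := fun s => (1 + s) ^ (μ - 1) * Real.exp s with hφ
  have hφpos : ∀ s, 0 ≤ s → 0 < φ s := fun s hs => by simp only [hφ]; positivity
  have hmono : MonotoneOn (fun s => φ s * (y₁ s - (1 - (1 + s)⁻¹) * y s)) (Icc 0 b) := by
    refine monotoneOn_of_hasDerivAt_nonneg (f' := fun s =>
      ((1 + s) ^ (μ - 1) * ((μ - 1) * (1 + s)⁻¹) * Real.exp s + (1 + s) ^ (μ - 1) * Real.exp s)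
        * (y₁ s - (1 - (1 + s)⁻¹) * y s)
      + φ s * (y₂ s - ((1 + s)⁻¹ ^ 2 * y s + (1 - (1 + s)⁻¹) * y₁ s))) ?_ ?_ ?_
    · exact ((continuousOn_one_add_rpow _ b).mul (by fun_prop)).mul (h.cont₁.sub
        ((continuousOn_const.sub (continuousOn_one_add_inv b)).mul h.cont))
    · intro s hs
      refine ((hasDerivAt_one_add_rpow hs.1.le (μ - 1)).mul (Real.hasDerivAt_exp s)).mul
        ((h.deriv₁ s hs).sub (HasDerivAt.mul ?_ (h.deriv s hs)))
      simpa using (hasDerivAt_one_add_inv hs.1.le).const_sub 1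
    · intro s hs
      have h0 := hs.1
      have hy := (h.nonneg hμ hl (Ioo_subset_Icc_self hs)).1
      have hN := h.source_nonneg s hs
      have e : y₂ s = N s - μ * (1 + s)⁻¹ * y₁ s - (ν ^ 2 * (1 + s)⁻¹ ^ 2 - l ^ 2) * y s := by
        have := h.eq s hs
        rw [div_eq_mul_inv, div_eq_mul_inv, ← inv_pow] at this
        linarith
      have hτ0 : 0 < (1 + s)⁻¹ := by positivity
      have hτ1 : (1 + s)⁻¹ ≤ 1 := inv_le_one_of_one_le₀ (by linarith)
      set τ := (1 + s)⁻¹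
      have e' : ((1 + s) ^ (μ - 1) * ((μ - 1) * τ) * Real.exp s + (1 + s) ^ (μ - 1) * Real.exp s)
        * (y₁ s - (1 - τ) * y s) + φ s * (y₂ s - (τ ^ 2 * y s + (1 - τ) * y₁ s)) =
        φ s * (N s + (l ^ 2 - ν ^ 2 * τ ^ 2 - μ * τ * (1 - τ) - (1 - τ) ^ 2 - τ ^ 2) * y s) := by
        rw [e, hφ]
        ring
      rw [e']
      refine mul_nonneg (hφpos s h0.le).le (add_nonneg hN (mul_nonneg ?_ hy))
      have b1 : ν ^ 2 * τ ^ 2 ≤ ν ^ 2 := by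
        have : τ ^ 2 ≤ 1 := by nlinarith
        nlinarith [sq_nonneg ν]
      have b2 : μ * τ * (1 - τ) ≤ μ := by
        have : τ * (1 - τ) ≤ 1 := by nlinarith
        nlinarith
      nlinarith
  have h1 := hmono ⟨le_rfl, hb⟩ ht ht.1
  have h2 : 0 ≤ φ t * (y₁ t - (1 - (1 + t)⁻¹) * y t) := by
    refine le_trans ?_ h1
    have : φ 0 * (y₁ 0 - (1 - (1 + 0)⁻¹) * y 0) = y₁ 0 := by simp [hφ]
    simp only [this]
    exact h.zero_nonneg₁
  linarith [nonneg_of_mul_nonneg_right h2 (hφpos t ht.1)]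

theorem continuousOn_renorm (h : DampedODE b μ ν l y y₁ y₂ N) :
    ContinuousOn (renorm μ l y y₁) (Icc 0 b) := by
  have h1 : ContinuousOn (profile μ l) (Icc 0 b) := fun t ht =>
    (hasDerivAt_profile μ l ht.1).continuousAt.continuousWithinAt
  have h2 := continuousOn_one_add_inv b
  exact h1.mul (h.cont₁.add (((continuousOn_const.add (continuousOn_const.mul h2)).sub
    (h2.pow 2)).mul h.cont))

/-- Write τ = 1/(1+t). The logarithmic derivative of `profile` is -l + (μ/2)τ + τ², and its sum with
the coefficient l + (μ/2)τ - τ² is μτ, so the terms in y' cancel. What is left besides N is τ²(μ²/4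
- μ/2 - ν² + 2l + 2τ - τ²) y. The assumption δ ≥ 0 says μ²/4 - μ/2 - ν² ≥ -1/4, and the term 2l,
created by the corrections ±τ², makes the bracket nonnegative. -/
theorem exists_hasDerivAt_renorm (h : DampedODE b μ ν l y y₁ y₂ N) (hμ : 0 ≤ μ) (hl1 : 1 ≤ l)
    (hl : ν ^ 2 + μ + 2 ≤ l ^ 2) (hδ : 0 ≤ delta μ ν) {t : ℝ} (ht : t ∈ Ioo 0 b) :
    ∃ G', HasDerivAt (renorm μ l y y₁) G' t ∧ profile μ l t * N t ≤ G' := by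
  have h0 := ht.1
  have hinv := hasDerivAt_one_add_inv h0.le
  have hcoef := ((hinv.const_mul (μ / 2)).const_add l).sub (hinv.fun_pow 2)
  refine ⟨_, (hasDerivAt_profile μ l h0.le).mul ((h.deriv₁ t ht).add
    (hcoef.mul (h.deriv t ht))), ?_⟩
  have hy := (h.nonneg hμ hl (Ioo_subset_Icc_self ht)).1
  have e : y₂ t = N t - μ * (1 + t)⁻¹ * y₁ t - (ν ^ 2 * (1 + t)⁻¹ ^ 2 - l ^ 2) * y t := by
    have := h.eq t ht
    rw [div_eq_mul_inv, div_eq_mul_inv, ← inv_pow] at this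
    linarith
  have hτ0 : 0 < (1 + t)⁻¹ := by positivity
  have hτ1 : (1 + t)⁻¹ ≤ 1 := inv_le_one_of_one_le₀ (by linarith)
  simp only [Pi.sub_apply]
  set τ := (1 + t)⁻¹
  have hP := profile_pos (μ := μ) (l := l) h0.le
  have hk : 0 ≤ τ ^ 2 * (μ ^ 2 / 4 - μ / 2 - ν ^ 2 + 2 * l + 2 * τ - τ ^ 2) := by
    refine mul_nonneg (sq_nonneg _) ?_
    unfold delta at hδ
    nlinarith
  have := mul_nonneg hP.le (mul_nonneg hk hy)
  rw [e]
  push_cast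
  have e2 : profile μ l t * N t + profile μ l t *
      (τ ^ 2 * (μ ^ 2 / 4 - μ / 2 - ν ^ 2 + 2 * l + 2 * τ - τ ^ 2) * y t) =
      profile μ l t * (-l + μ / 2 * τ + τ ^ 2) * (y₁ t + (l + μ / 2 * τ - τ ^ 2) * y t) +
      profile μ l t * (N t - μ * τ * y₁ t - (ν ^ 2 * τ ^ 2 - l ^ 2) * y t +
      ((μ / 2 * -τ ^ 2 - 2 * τ ^ (2 - 1) * -τ ^ 2) * y t + (l + μ / 2 * τ - τ ^ 2) * y₁ t)) := by
    simp only [Nat.add_one_sub_one, pow_one]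
    ring
  linarith

theorem renorm_nonneg (h : DampedODE b μ ν l y y₁ y₂ N) (hμ : 0 ≤ μ) (hl1 : 1 ≤ l)
    (hl : ν ^ 2 + μ + 2 ≤ l ^ 2) {t : ℝ} (ht : t ∈ Icc 0 b) : 0 ≤ renorm μ l y y₁ t := by
  obtain ⟨hy, hy₁⟩ := h.nonneg hμ hl ht
  have h0 := ht.1
  have hτ0 : 0 < (1 + t)⁻¹ := by positivity
  have hτ1 : (1 + t)⁻¹ ≤ 1 := inv_le_one_of_one_le₀ (by linarith)
  refine mul_nonneg (profile_pos h0).le (add_nonneg hy₁ (mul_nonneg ?_ hy))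
  have : 0 ≤ μ / 2 * (1 + t)⁻¹ := by positivity
  nlinarith

/-- For t ≥ 1 the growth estimate `div_mul_le` gives y ≤ 2y', so y' alone controls G. This is why
the coupled inequalities start at t = 1, that is s = 2. -/
theorem renorm_le (h : DampedODE b μ ν l y y₁ y₂ N) (hμ : 0 ≤ μ) (hl1 : 1 ≤ l)
    (hl : ν ^ 2 + μ + 2 ≤ l ^ 2) {t : ℝ} (ht : t ∈ Icc 0 b) (ht1 : 1 ≤ t) :
    renorm μ l y y₁ t ≤ (1 + 2 * l + μ) * (Real.exp (-l * t) * (1 + t) ^ (μ / 2)) * y₁ t := by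
  obtain ⟨hy, hy₁⟩ := h.nonneg hμ hl ht
  have h0 := ht.1
  have hτ0 : 0 < (1 + t)⁻¹ := by positivity
  have hτ1 : (1 + t)⁻¹ ≤ 1 / 2 := by
    rw [one_div]
    exact inv_anti₀ (by norm_num) (by linarith)
  have hg := h.div_mul_le hμ hl ht
  set τ := (1 + t)⁻¹ with hτ
  have hy2 : y t ≤ 2 * y₁ t := by nlinarith
  have hQ : y₁ t + (l + μ / 2 * τ - τ ^ 2) * y t ≤ (1 + 2 * l + μ) * y₁ t := by
    have c1 : l + μ / 2 * τ - τ ^ 2 ≤ l + μ / 2 := by nlinarith [sq_nonneg τ]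
    have c2 := mul_le_mul_of_nonneg_right c1 hy
    have c3 := mul_le_mul_of_nonneg_left hy2 (show 0 ≤ l + μ / 2 by positivity)
    linarith
  have hP : profile μ l t ≤ Real.exp (-l * t) * (1 + t) ^ (μ / 2) := by
    unfold profile
    refine mul_le_of_le_one_right (by positivity) ?_
    rw [Real.exp_le_one_iff]
    linarith
  calc renorm μ l y y₁ t ≤ profile μ l t * ((1 + 2 * l + μ) * y₁ t) :=
        mul_le_mul_of_nonneg_left hQ (profile_pos h0).le
    _ ≤ (Real.exp (-l * t) * (1 + t) ^ (μ / 2)) * ((1 + 2 * l + μ) * y₁ t) :=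
        mul_le_mul_of_nonneg_right hP (by positivity)
    _ = _ := by ring

/-- G is nondecreasing, and the left-hand side is its value at 0. This is how the size of the data
enters the blow-up argument. -/
theorem renorm_zero_le (h : DampedODE b μ ν l y y₁ y₂ N) (hμ : 0 ≤ μ) (hl1 : 1 ≤ l)
    (hl : ν ^ 2 + μ + 2 ≤ l ^ 2) (hδ : 0 ≤ delta μ ν) {t : ℝ} (ht : t ∈ Icc 0 b) :
    Real.exp (-1) * (y₁ 0 + (l + μ / 2 - 1) * y 0) ≤ renorm μ l y y₁ t := by
  have hb : 0 ≤ b := ht.1.trans ht.2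
  choose! G' hG' hle using fun s (hs : s ∈ Ioo 0 b) =>
    h.exists_hasDerivAt_renorm hμ hl1 hl hδ hs
  have hm := monotoneOn_of_hasDerivAt_nonneg h.continuousOn_renorm hG' (fun s hs =>
    (mul_nonneg (profile_pos hs.1.le).le (h.source_nonneg s hs)).trans (hle s hs))
  refine le_trans (le_of_eq ?_) (hm ⟨le_rfl, hb⟩ ht ht.1)
  simp [renorm, profile]

end DampedODE

/-! ### Blow-up for coupled differential inequalities -/

/-- The differential inequalities `X' ≥ α(s) Y^p`, `Y' ≥ β(s) X^q` on `[s₀, s₁]` for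
nonnegative `X`, `Y`. -/
structure SuperPair (α β : ℝ → ℝ) (p q s₀ s₁ : ℝ) (X Y : ℝ → ℝ) : Prop where
  contX : ContinuousOn X (Icc s₀ s₁)
  contY : ContinuousOn Y (Icc s₀ s₁)
  nonnegX : ∀ s ∈ Icc s₀ s₁, 0 ≤ X s
  nonnegY : ∀ s ∈ Icc s₀ s₁, 0 ≤ Y s
  derivX : ∀ s ∈ Ioo s₀ s₁, ∃ X', HasDerivAt X X' s ∧ α s * Y s ^ p ≤ X'
  derivY : ∀ s ∈ Ioo s₀ s₁, ∃ Y', HasDerivAt Y Y' s ∧ β s * X s ^ q ≤ Y'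

theorem mul_sub_le_of_hasDerivAt {f : ℝ → ℝ} {x y C : ℝ} (hxy : x ≤ y)
    (hf : ContinuousOn f (Icc x y)) (hd : ∀ s ∈ Ioo x y, ∃ f', HasDerivAt f f' s ∧ C ≤ f') :
    C * (y - x) ≤ f y - f x := by
  refine (convex_Icc x y).mul_sub_le_image_sub_of_le_deriv hf ?_ ?_ x ⟨le_rfl, hxy⟩ y
    ⟨hxy, le_rfl⟩ hxy
  · rw [interior_Icc]
    intro s hs
    obtain ⟨f', h, -⟩ := hd s hs
    exact h.differentiableAt.differentiableWithinAt
  · rw [interior_Icc]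
    intro s hs
    obtain ⟨f', h, h'⟩ := hd s hs
    rwa [h.deriv]

namespace SuperPair

variable {α β X Y : ℝ → ℝ} {p q s₀ s₁ : ℝ}

theorem swap (h : SuperPair α β p q s₀ s₁ X Y) : SuperPair β α q p s₀ s₁ Y X :=
  ⟨h.contY, h.contX, h.nonnegY, h.nonnegX, h.derivY, h.derivX⟩

theorem mono (h : SuperPair α β p q s₀ s₁ X Y) {α' β' : ℝ → ℝ} {r₀ r₁ : ℝ} (h₀ : s₀ ≤ r₀)
    (h₁ : r₁ ≤ s₁) (hα : ∀ s ∈ Ioo r₀ r₁, α' s ≤ α s) (hβ : ∀ s ∈ Ioo r₀ r₁, β' s ≤ β s) :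
    SuperPair α' β' p q r₀ r₁ X Y := by
  have hc : Icc r₀ r₁ ⊆ Icc s₀ s₁ := Icc_subset_Icc h₀ h₁
  have ho : Ioo r₀ r₁ ⊆ Ioo s₀ s₁ := Ioo_subset_Ioo h₀ h₁
  refine ⟨h.contX.mono hc, h.contY.mono hc, fun s hs => h.nonnegX s (hc hs),
    fun s hs => h.nonnegY s (hc hs), fun s hs => ?_, fun s hs => ?_⟩
  · obtain ⟨d, hd, hd'⟩ := h.derivX s (ho hs)
    exact ⟨d, hd, le_trans (mul_le_mul_of_nonneg_right (hα s hs)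
      (Real.rpow_nonneg (h.nonnegY s (hc (Ioo_subset_Icc_self hs))) _)) hd'⟩
  · obtain ⟨d, hd, hd'⟩ := h.derivY s (ho hs)
    exact ⟨d, hd, le_trans (mul_le_mul_of_nonneg_right (hβ s hs)
      (Real.rpow_nonneg (h.nonnegX s (hc (Ioo_subset_Icc_self hs))) _)) hd'⟩

theorem X_mono (h : SuperPair α β p q s₀ s₁ X Y) (hα : ∀ s ∈ Ioo s₀ s₁, 0 ≤ α s) :
    MonotoneOn X (Icc s₀ s₁) := by
  intro x hx y hy hxy
  have := mul_sub_le_of_hasDerivAt (C := 0) hxy (h.contX.mono (Icc_subset_Icc hx.1 hy.2))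
    (fun s hs => by
      have hs' : s ∈ Ioo s₀ s₁ := ⟨hx.1.trans_lt hs.1, hs.2.trans_le hy.2⟩
      obtain ⟨d, hd, hd'⟩ := h.derivX s hs'
      exact ⟨d, hd, le_trans (mul_nonneg (hα s hs')
        (Real.rpow_nonneg (h.nonnegY s (Ioo_subset_Icc_self hs')) _)) hd'⟩)
  linarith

theorem X_increment {a b η x y : ℝ} (h : SuperPair (fun _ => a) (fun _ => b) p q s₀ s₁ X Y)
    (ha : 0 ≤ a) (hp : 0 ≤ p) (hη : 0 ≤ η) (hx : s₀ ≤ x) (hxy : x ≤ y) (hy : y ≤ s₁)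
    (hY : ∀ s ∈ Icc x y, η ≤ Y s) : X x + a * η ^ p * (y - x) ≤ X y := by
  have := mul_sub_le_of_hasDerivAt (C := a * η ^ p) hxy (h.contX.mono (Icc_subset_Icc hx hy))
    (fun s hs => by
      obtain ⟨d, hd, hd'⟩ := h.derivX s ⟨hx.trans_lt hs.1, hs.2.trans_le hy⟩
      exact ⟨d, hd, le_trans (mul_le_mul_of_nonneg_left
        (Real.rpow_le_rpow hη (hY s (Ioo_subset_Icc_self hs)) hp) ha) hd'⟩)
  linarith

/-- Passing once through both inequalities, with constant coefficients. -/
theorem X_two_increments {a b ξ s d : ℝ}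
    (h : SuperPair (fun _ => a) (fun _ => b) p q s₀ s₁ X Y) (ha : 0 ≤ a) (hb : 0 ≤ b) (hp : 0 ≤ p)
    (hq : 0 ≤ q) (hξ : 0 ≤ ξ) (hs : s₀ ≤ s) (hd : 0 ≤ d) (hs₁ : s + 2 * d ≤ s₁) (hX : ξ ≤ X s) :
    X s + a * (b * ξ ^ q * d) ^ p * d ≤ X (s + 2 * d) := by
  have hXm := h.X_mono fun _ _ => ha
  have hYm := h.swap.X_mono fun _ _ => hb
  have hsm : s ∈ Icc s₀ s₁ := ⟨hs, by linarith⟩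
  have hY : b * ξ ^ q * d ≤ Y (s + d) := by
    have := h.swap.X_increment (x := s) (y := s + d) hb hq hξ hs (by linarith) (by linarith)
      (fun r hr => hX.trans (hXm hsm ⟨hs.trans hr.1, by linarith [hr.2]⟩ hr.1))
    have h0 := h.nonnegY s hsm
    have e : s + d - s = d := by ring
    rw [e] at this
    linarith
  have h1 := h.X_increment (x := s + d) (y := s + 2 * d) ha hp (η := b * ξ ^ q * d)
    (by positivity) (by linarith) (by linarith) hs₁
    (fun r hr => hY.trans (hYm ⟨by linarith, by linarith⟩ ⟨by linarith [hr.1], by linarith [hr.2]⟩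
      hr.1))
  have h2 : X s ≤ X (s + d) := hXm hsm ⟨by linarith, by linarith⟩ (by linarith)
  have e : s + 2 * d - (s + d) = d := by ring
  rw [e] at h1
  linarith

/-- Blow-up for constant coefficients: no pair exists on an interval of length `L` if
`a b^p L^(p+1) ξ^(pq-1)` is large. -/
theorem false_of_const {a b ξ L : ℝ}
    (h : SuperPair (fun _ => a) (fun _ => b) p q s₀ (s₀ + L) X Y) (ha : 0 < a) (hb : 0 < b)
    (hp : 1 < p) (hq : 1 < q) (hξ : 0 < ξ) (hL : 0 < L) (hX : ξ ≤ X s₀)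
    (hK : (4:ℝ) ^ (p + 1) * 2 ^ ((p + 1) / (p * q - 1)) ≤
      a * b ^ p * L ^ (p + 1) * ξ ^ (p * q - 1)) : False := by
  have hpq : 0 < p * q - 1 := by nlinarith
  -- θ is the growth factor with θ^(pq-1) = 2^(p+1). The remaining time is halved at each step,
  -- which costs 2^(p+1), and the superlinear gain from X having grown by θ exactly makes up for it.
  -- So X grows like θ^j at times converging to s₀ + L.
  set θ : ℝ := 2 ^ ((p + 1) / (p * q - 1)) with hθ
  have hθ1 : 1 < θ := Real.one_lt_rpow (by norm_num) (by positivity)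
  have hθ0 : 0 < θ := by linarith
  have hθpow : θ ^ (p * q - 1) = 2 ^ (p + 1) := by
    rw [hθ, ← Real.rpow_mul (by norm_num), div_mul_cancel₀ _ hpq.ne']
  have hXm := h.X_mono fun _ _ => ha.le
  have hhalf : ∀ j : ℕ, 0 < (1 / 2 : ℝ) ^ j ∧ (1 / 2 : ℝ) ^ j ≤ 1 := fun j =>
    ⟨by positivity, pow_le_one₀ (by norm_num) (by norm_num)⟩
  have hmem : ∀ j : ℕ, s₀ + L * (1 - (1 / 2) ^ j) ∈ Icc s₀ (s₀ + L) := by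
    intro j
    obtain ⟨h1, h2⟩ := hhalf j
    constructor <;> nlinarith
  have hind : ∀ j : ℕ, ξ * θ ^ j ≤ X (s₀ + L * (1 - (1 / 2) ^ j)) := by
    intro j
    induction j with
    | zero => simpa using hX
    | succ j ih =>
      obtain ⟨h1, h2⟩ := hhalf j
      set r := (1 / 2 : ℝ) ^ j with hr
      -- The j-th step lasts Lr/2: one quarter Lr/4 to raise Y, another to raise X.
      have hstep := h.X_two_increments (ξ := ξ * θ ^ j) (s := s₀ + L * (1 - r)) (d := L * r / 4)
        ha.le hb.le (by linarith) (by linarith) (by positivity) (by nlinarith) (by positivity)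
        (by nlinarith) ih
      have e1 : s₀ + L * (1 - r) + 2 * (L * r / 4) = s₀ + L * (1 - (1 / 2) ^ (j + 1)) := by
        rw [pow_succ, ← hr]
        ring
      rw [e1] at hstep
      have h0 := h.nonnegX _ (hmem j)
      refine le_trans ?_ (le_trans (le_add_of_nonneg_left h0) hstep)
      have hrpow : r ^ (p + 1) * (θ ^ j) ^ (p * q - 1) = 1 := by
        rw [← Real.rpow_natCast θ j, ← Real.rpow_mul hθ0.le, mul_comm (j : ℝ), Real.rpow_mul hθ0.le,
          hθpow, hr, ← Real.rpow_natCast, ← Real.rpow_mul (by norm_num),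
          mul_comm (j : ℝ), Real.rpow_mul (by norm_num), ← Real.mul_rpow (by positivity)
          (by positivity), ← Real.mul_rpow (by norm_num) (by norm_num)]
        norm_num
      have e2 : a * (b * (ξ * θ ^ j) ^ q * (L * r / 4)) ^ p * (L * r / 4) =
          (a * b ^ p * L ^ (p + 1) * ξ ^ (p * q - 1)) * (4 ^ (p + 1))⁻¹ *
            (r ^ (p + 1) * (θ ^ j) ^ (p * q - 1)) * (ξ * θ ^ j) := by
        have hz : 0 < ξ * θ ^ j := by positivity
        have f1 : (b * (ξ * θ ^ j) ^ q * (L * r / 4)) ^ p =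
            b ^ p * (ξ * θ ^ j) ^ (p * q) * (L * r / 4) ^ p := by
          rw [Real.mul_rpow (by positivity) (by positivity), Real.mul_rpow (by positivity)
            (by positivity), ← Real.rpow_mul hz.le, mul_comm q]
        have f2 : (L * r / 4) ^ p * (L * r / 4) = L ^ (p + 1) * r ^ (p + 1) * (4 ^ (p + 1))⁻¹ := by
          rw [← Real.rpow_add_one (by positivity), Real.div_rpow (by positivity) (by norm_num),
            Real.mul_rpow (by positivity) (by positivity)]
          ring
        have f3 : (ξ * θ ^ j) ^ (p * q) = ξ ^ (p * q - 1) * (θ ^ j) ^ (p * q - 1) * (ξ * θ ^ j) := by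
          rw [← Real.mul_rpow (by positivity) (by positivity), ← Real.rpow_add_one hz.ne']
          ring_nf
        rw [f1, f3, mul_assoc a, mul_assoc (b ^ p * _), f2]
        ring
      rw [e2, hrpow, mul_one, pow_succ]
      have h4 : (0:ℝ) < 4 ^ (p + 1) := by positivity
      have : θ ≤ a * b ^ p * L ^ (p + 1) * ξ ^ (p * q - 1) * (4 ^ (p + 1))⁻¹ := by
        rw [← div_eq_mul_inv, le_div_iff₀ h4]
        linarith
      have := mul_le_mul_of_nonneg_right this (show 0 ≤ ξ * θ ^ j by positivity)
      linarith
  obtain ⟨j, hj⟩ := pow_unbounded_of_one_lt (X (s₀ + L) / ξ) hθ1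
  rw [div_lt_iff₀ hξ] at hj
  have h1 := hXm (hmem j) ⟨by linarith, le_rfl⟩ (hmem j).2
  linarith [hind j]

variable {c A B : ℝ}

theorem const_mul_rpow_le (A : ℝ) {L s : ℝ} (hL : 0 < L) (h1 : L ≤ s) (h2 : s ≤ 2 * L) :
    2 ^ (-|A|) * L ^ (-A) ≤ s ^ (-A) := by
  have hs : 0 < s := hL.trans_le h1
  have e : s ^ (-A) = (s / L) ^ (-A) * L ^ (-A) := by
    rw [← Real.mul_rpow (by positivity) hL.le, div_mul_cancel₀ _ hL.ne']
  rw [e]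
  refine mul_le_mul_of_nonneg_right ?_ (by positivity)
  have h3 : 1 ≤ s / L := (one_le_div hL).2 h1
  have h4 : s / L ≤ 2 := (div_le_iff₀ hL).2 h2
  calc (2:ℝ) ^ (-|A|) ≤ (s / L) ^ (-|A|) :=
        Real.rpow_le_rpow_of_nonpos (by positivity) h4 (neg_nonpos.2 (abs_nonneg A))
    _ ≤ (s / L) ^ (-A) := Real.rpow_le_rpow_of_exponent_le h3 (neg_le_neg (le_abs_self A))

/-- Freezing power coefficients on a dyadic interval. -/
theorem dyadic (h : SuperPair (fun s => c * s ^ (-A)) (fun s => c * s ^ (-B)) p q s₀ s₁ X Y)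
    (hc : 0 < c) {L : ℝ} (hL : 0 < L) (h0 : s₀ ≤ L) (h1 : L + L ≤ s₁) :
    SuperPair (fun _ => c * (2 ^ (-|A|) * L ^ (-A))) (fun _ => c * (2 ^ (-|B|) * L ^ (-B))) p q
      L (L + L) X Y :=
  h.mono h0 h1
    (fun s hs => mul_le_mul_of_nonneg_left
      (const_mul_rpow_le A hL hs.1.le (by linarith [hs.2])) hc.le)
    (fun s hs => mul_le_mul_of_nonneg_left
      (const_mul_rpow_le B hL hs.1.le (by linarith [hs.2])) hc.le)

theorem dyadic_coeff (hc : 0 < c) {L : ℝ} (hL : 0 < L) :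
    c * (2 ^ (-|A|) * L ^ (-A)) * (c * (2 ^ (-|B|) * L ^ (-B))) ^ p * L ^ (p + 1) =
      c * 2 ^ (-|A|) * (c * 2 ^ (-|B|)) ^ p * L ^ ((1 - A) + p * (1 - B)) := by
  have e : L ^ ((1 - A) + p * (1 - B)) = L ^ (-A) * (L ^ (-B)) ^ p * L ^ (p + 1) := by
    rw [← Real.rpow_mul hL.le, ← Real.rpow_add hL, ← Real.rpow_add hL]
    ring_nf
  rw [e, ← mul_assoc c, ← mul_assoc c, Real.mul_rpow (by positivity) (by positivity)]
  ring

/-- Subcritical blow-up. -/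
theorem exists_bound_of_pos (hc : 0 < c) (hp : 1 < p) (hq : 1 < q)
    (hE : 0 < (1 - A) + p * (1 - B)) :
    ∃ C, 0 < C ∧ ∀ ξ s₁ X Y, 0 < ξ → ξ ≤ 1 →
      SuperPair (fun s => c * s ^ (-A)) (fun s => c * s ^ (-B)) p q 2 s₁ X Y → ξ ≤ X 2 →
      C * ξ ^ (-((p * q - 1) / ((1 - A) + p * (1 - B)))) ≤ s₁ → False := by
  have hpq : 0 < p * q - 1 := by nlinarith
  set E := (1 - A) + p * (1 - B) with hEdef
  set κ := c * 2 ^ (-|A|) * (c * 2 ^ (-|B|)) ^ p with hκ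
  have hκ0 : 0 < κ := by positivity
  set K : ℝ := (4:ℝ) ^ (p + 1) * 2 ^ ((p + 1) / (p * q - 1)) with hK
  have hK0 : 0 < K := by positivity
  -- The interval used is [s₁/2, s₁]. The 4 makes it start after 2, and the other term makes κ L^E
  -- ξ^(pq-1) exceed the threshold K.
  refine ⟨max 4 (2 * (K / κ) ^ E⁻¹), by positivity, fun ξ s₁ X Y hξ hξ1 h hX hs => ?_⟩
  set D := max 4 (2 * (K / κ) ^ E⁻¹)
  have hpow1 : 1 ≤ ξ ^ (-((p * q - 1) / E)) :=
    Real.one_le_rpow_of_pos_of_le_one_of_nonpos hξ hξ1 (by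
      have : 0 ≤ (p * q - 1) / E := by positivity
      linarith)
  have hD4 : 4 ≤ D := le_max_left _ _
  have hs4 : 4 ≤ s₁ := by nlinarith
  set L := s₁ / 2 with hL
  have hL2 : 2 ≤ L := by rw [hL]; linarith
  have hL0 : 0 < L := by linarith
  have hd := h.dyadic hc hL0 hL2 (by rw [hL]; linarith)
  have hXL : ξ ≤ X L := hX.trans (h.X_mono (fun s hs => by
    have : 0 < s := by linarith [hs.1]
    positivity) ⟨le_rfl, by linarith⟩ ⟨hL2, by rw [hL]; linarith⟩ hL2)
  refine hd.false_of_const (by positivity) (by positivity) hp hq hξ hL0 hXL ?_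
  rw [dyadic_coeff hc hL0, ← hκ, ← hEdef, ← hK]
  have h1 : (K / κ) ^ E⁻¹ * ξ ^ (-((p * q - 1) / E)) ≤ L := by
    have : 2 * (K / κ) ^ E⁻¹ ≤ D := le_max_right _ _
    have := mul_le_mul_of_nonneg_right this (by linarith : 0 ≤ ξ ^ (-((p * q - 1) / E)))
    rw [hL]
    linarith
  have h2 := Real.rpow_le_rpow (by positivity) h1 hE.le
  rw [Real.mul_rpow (by positivity) (by positivity), ← Real.rpow_mul (by positivity),
    ← Real.rpow_mul hξ.le, inv_mul_cancel₀ hE.ne', Real.rpow_one,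
    show -((p * q - 1) / E) * E = -(p * q - 1) by field_simp] at h2
  have h3 : K / κ ≤ L ^ E * ξ ^ (p * q - 1) := by
    have := mul_le_mul_of_nonneg_right h2 (show 0 ≤ ξ ^ (p * q - 1) by positivity)
    rwa [mul_assoc, ← Real.rpow_add hξ, neg_add_cancel, Real.rpow_zero, mul_one] at this
  rw [div_le_iff₀ hκ0] at h3
  linarith

/-- Discrete form of the fact that x' = κ x^(r+1) makes x^(-r) decrease linearly. The bound x ≤ K is
needed for a uniform decrement; beyond K the increase of x may remove less than that from the
already small x^(-r). -/
theorem inv_rpow_sub_of_le {x x' κ K r : ℝ} (hr : 0 < r) (hκ : 0 < κ) (hx : 0 < x) (hxK : x ≤ K)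
    (h : x + κ * x ^ (r + 1) ≤ x') :
    (x' ^ r)⁻¹ ≤ (x ^ r)⁻¹ - (r * κ / (1 + κ * K ^ r)) / (1 + r * κ / (1 + κ * K ^ r) * K ^ r) := by
  have hK : 0 < K := hx.trans_le hxK
  set m := r * κ / (1 + κ * K ^ r) with hm
  have hm0 : 0 < m := by positivity
  have hxr : 0 < x ^ r := by positivity
  have hxKr : x ^ r ≤ K ^ r := Real.rpow_le_rpow hx.le hxK hr.le
  have e1 : x * (1 + κ * x ^ r) ≤ x' := by
    rw [Real.rpow_add_one hx.ne'] at h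
    linarith
  have e2 : Real.exp (κ * x ^ r / (1 + κ * x ^ r)) ≤ 1 + κ * x ^ r := by
    set w := κ * x ^ r
    have hw : 0 < 1 + w := by positivity
    have h1 := Real.add_one_le_exp (-(w / (1 + w)))
    have h2 : -(w / (1 + w)) + 1 = (1 + w)⁻¹ := by field_simp; ring
    rw [h2, Real.exp_neg] at h1
    exact (inv_le_inv₀ hw (Real.exp_pos _)).1 h1
  have e3 : 1 + m * x ^ r ≤ (1 + κ * x ^ r) ^ r := by
    calc 1 + m * x ^ r ≤ Real.exp (m * x ^ r) := by linarith [Real.add_one_le_exp (m * x ^ r)]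
      _ ≤ Real.exp (κ * x ^ r / (1 + κ * x ^ r) * r) := by
        rw [Real.exp_le_exp, hm]
        have : κ * x ^ r / (1 + κ * K ^ r) ≤ κ * x ^ r / (1 + κ * x ^ r) := by gcongr
        have := mul_le_mul_of_nonneg_right this hr.le
        calc _ = κ * x ^ r / (1 + κ * K ^ r) * r := by ring
          _ ≤ _ := this
      _ = Real.exp (κ * x ^ r / (1 + κ * x ^ r)) ^ r := Real.exp_mul _ _
      _ ≤ _ := Real.rpow_le_rpow (Real.exp_pos _).le e2 hr.le
  have e4 : x ^ r * (1 + m * x ^ r) ≤ x' ^ r := by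
    calc _ ≤ x ^ r * (1 + κ * x ^ r) ^ r := by gcongr
      _ = (x * (1 + κ * x ^ r)) ^ r := (Real.mul_rpow hx.le (by positivity)).symm
      _ ≤ _ := Real.rpow_le_rpow (by positivity) e1 hr.le
  calc (x' ^ r)⁻¹ ≤ (x ^ r * (1 + m * x ^ r))⁻¹ := inv_anti₀ (by positivity) e4
    _ = (x ^ r)⁻¹ - m / (1 + m * x ^ r) := by field_simp; ring
    _ ≤ _ := by gcongr

/-- The growth of `X` over a dyadic interval. -/
theorem X_dyadic_growth
    (h : SuperPair (fun s => c * s ^ (-A)) (fun s => c * s ^ (-B)) p q s₀ s₁ X Y)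
    (hc : 0 < c) (hp : 1 < p) (hq : 1 < q) (hE : 0 ≤ (1 - A) + p * (1 - B)) {L : ℝ} (hL : 1 ≤ L)
    (h0 : s₀ ≤ L) (h1 : L + L ≤ s₁) (hx : 0 < X L) :
    X L + c * 2 ^ (-|A|) * (c * 2 ^ (-|B|)) ^ p * (1 / 2) ^ (p + 1) * X L ^ (p * q) ≤
      X (L + L) := by
  have hL0 : 0 < L := by linarith
  have h2 := (h.dyadic hc hL0 h0 h1).X_two_increments (ξ := X L) (s := L) (d := L / 2)
    (by positivity) (by positivity) (by linarith) (by linarith) hx.le le_rfl (by positivity)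
    (by linarith) le_rfl
  rw [show L + 2 * (L / 2) = L + L by ring] at h2
  refine le_trans ?_ h2
  have f1 : (c * (2 ^ (-|B|) * L ^ (-B)) * X L ^ q * (L / 2)) ^ p =
      (c * (2 ^ (-|B|) * L ^ (-B))) ^ p * X L ^ (p * q) * (L / 2) ^ p := by
    rw [Real.mul_rpow (by positivity) (by positivity), Real.mul_rpow (by positivity)
      (by positivity), ← Real.rpow_mul hx.le, mul_comm q]
  have f2 : (L / 2) ^ p * (L / 2) = L ^ (p + 1) * (1 / 2) ^ (p + 1) := by
    rw [← Real.rpow_add_one (by positivity), ← Real.mul_rpow hL0.le (by norm_num)]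
    ring_nf
  have f3 := dyadic_coeff (A := A) (B := B) (p := p) hc hL0
  set κ := c * 2 ^ (-|A|) * (c * 2 ^ (-|B|)) ^ p
  have e2 : c * (2 ^ (-|A|) * L ^ (-A)) *
      (c * (2 ^ (-|B|) * L ^ (-B)) * X L ^ q * (L / 2)) ^ p * (L / 2) =
      κ * (1 / 2) ^ (p + 1) * X L ^ (p * q) * L ^ ((1 - A) + p * (1 - B)) := by
    rw [f1]
    calc _ = c * (2 ^ (-|A|) * L ^ (-A)) * (c * (2 ^ (-|B|) * L ^ (-B))) ^ p *
          ((L / 2) ^ p * (L / 2)) * X L ^ (p * q) := by ring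
      _ = (c * (2 ^ (-|A|) * L ^ (-A)) * (c * (2 ^ (-|B|) * L ^ (-B))) ^ p * L ^ (p + 1)) *
          (1 / 2) ^ (p + 1) * X L ^ (p * q) := by rw [f2]; ring
      _ = _ := by rw [f3]; ring
  rw [e2]
  have h3 : 1 ≤ L ^ ((1 - A) + p * (1 - B)) := Real.one_le_rpow hL hE
  have h4 : 0 ≤ κ * (1 / 2) ^ (p + 1) * X L ^ (p * q) := by positivity
  linarith [le_mul_of_one_le_right h4 h3]

/-- Critical blow-up. -/
theorem exists_bound_of_nonneg (hc : 0 < c) (hp : 1 < p) (hq : 1 < q)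
    (hE : 0 ≤ (1 - A) + p * (1 - B)) (hs₀ : 1 ≤ s₀) :
    ∃ C, 0 < C ∧ ∀ ξ s₁ X Y, 0 < ξ → ξ ≤ 1 →
      SuperPair (fun s => c * s ^ (-A)) (fun s => c * s ^ (-B)) p q s₀ s₁ X Y → ξ ≤ X s₀ →
      Real.exp (C * ξ ^ (-(p * q - 1))) ≤ s₁ → False := by
  have hpq : 0 < p * q - 1 := by nlinarith
  set r := p * q - 1 with hr
  set E := (1 - A) + p * (1 - B) with hEdef
  set κ := c * 2 ^ (-|A|) * (c * 2 ^ (-|B|)) ^ p with hκ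
  have hκ0 : 0 < κ := by positivity
  set K₀ : ℝ := (4:ℝ) ^ (p + 1) * 2 ^ ((p + 1) / r) with hK₀
  have hK₀0 : 0 < K₀ := by positivity
  -- Threshold: if X reaches K at the start of a dyadic interval, it blows up within that interval,
  -- whatever its length L ≥ 1, because L^E ≥ 1. So X < K on all earlier intervals.
  set K := (K₀ / κ) ^ r⁻¹ with hK
  have hKpos : 0 < K := by positivity
  have hKr : κ * K ^ r = K₀ := by
    rw [hK, ← Real.rpow_mul (by positivity), inv_mul_cancel₀ hpq.ne', Real.rpow_one]
    field_simp
  set κ' := κ * (1 / 2) ^ (p + 1) with hκ'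
  have hκ'0 : 0 < κ' := by positivity
  set m := (r * κ' / (1 + κ' * K ^ r)) / (1 + r * κ' / (1 + κ' * K ^ r) * K ^ r) with hm
  have hm0 : 0 < m := by positivity
  have hlog : 0 ≤ Real.log s₀ := Real.log_nonneg hs₀
  refine ⟨Real.log s₀ + m⁻¹ + 3, by positivity, fun ξ s₁ X Y hξ hξ1 h hX hs => ?_⟩
  have hz1 : 1 ≤ ξ ^ (-r) :=
    Real.one_le_rpow_of_pos_of_le_one_of_nonpos hξ hξ1 (by linarith)
  have hs00 : 0 < s₀ := by linarith
  -- X^(-r) starts at most at ξ^(-r) and loses at least m per dyadic interval, so N intervals would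
  -- make it negative.
  set N := ⌊m⁻¹ * ξ ^ (-r)⌋₊ + 1 with hNdef
  have hN1 : m⁻¹ * ξ ^ (-r) < N := by
    rw [hNdef]; push_cast; exact Nat.lt_floor_add_one _
  have hN2 : (N : ℝ) ≤ m⁻¹ * ξ ^ (-r) + 1 := by
    rw [hNdef]; push_cast
    linarith [Nat.floor_le (show 0 ≤ m⁻¹ * ξ ^ (-r) by positivity)]
  have hfit : s₀ * 2 ^ (N + 1) ≤ s₁ := by
    refine le_trans ?_ hs
    have h2 : (2:ℝ) ≤ Real.exp 1 := by linarith [Real.add_one_le_exp (1:ℝ)]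
    calc s₀ * 2 ^ (N + 1) ≤ Real.exp (Real.log s₀) * Real.exp 1 ^ (N + 1) := by
          rw [Real.exp_log hs00]; gcongr
      _ = Real.exp (Real.log s₀ + (N + 1)) := by
          rw [← Real.exp_nat_mul, ← Real.exp_add]; push_cast; ring_nf
      _ ≤ _ := by
          rw [Real.exp_le_exp]
          nlinarith
  have hpt : ∀ k : ℕ, 0 < s₀ * 2 ^ k ∧ s₀ ≤ s₀ * 2 ^ k ∧ 1 ≤ s₀ * 2 ^ k := by
    intro k
    have : (1:ℝ) ≤ 2 ^ k := one_le_pow₀ (by norm_num)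
    exact ⟨by positivity, by nlinarith, by nlinarith⟩
  have hle : ∀ k ≤ N, s₀ * 2 ^ k + s₀ * 2 ^ k ≤ s₁ := by
    intro k hk
    have : (2:ℝ) ^ (k + 1) ≤ 2 ^ (N + 1) := pow_le_pow_right₀ (by norm_num) (by omega)
    have := mul_le_mul_of_nonneg_left this hs00.le
    rw [pow_succ] at this
    linarith
  have hdy : ∀ k ≤ N, SuperPair _ _ p q (s₀ * 2 ^ k) (s₀ * 2 ^ k + s₀ * 2 ^ k) X Y := fun k hk =>
    h.dyadic hc (hpt k).1 (hpt k).2.1 (hle k hk)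
  have hXm := h.X_mono (fun s hs => by
    have : 0 < s := by linarith [hs.1]
    positivity)
  have hXpos : ∀ k ≤ N, ξ ≤ X (s₀ * 2 ^ k) := fun k hk =>
    hX.trans (hXm ⟨le_rfl, by linarith [hle k hk, (hpt k).1, (hpt k).2.1]⟩
      ⟨(hpt k).2.1, by linarith [hle k hk, (hpt k).1]⟩ (hpt k).2.1)
  have hEk : ∀ k : ℕ, 1 ≤ (s₀ * 2 ^ k) ^ E := fun k => Real.one_le_rpow (hpt k).2.2 hE
  have hsmall : ∀ k ≤ N, X (s₀ * 2 ^ k) < K := by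
    intro k hk
    by_contra hcon
    have hcon := not_lt.1 hcon
    have hk0 := (hpt k).1
    refine (hdy k hk).false_of_const (by positivity) (by positivity) hp hq hKpos hk0 hcon ?_
    rw [dyadic_coeff hc hk0, ← hκ, ← hEdef, ← hK₀, ← hKr]
    have h1 := hEk k
    have h2 : 0 < κ * K ^ r := by positivity
    nlinarith
  have hgrow : ∀ k ≤ N, X (s₀ * 2 ^ k) + κ' * X (s₀ * 2 ^ k) ^ (r + 1) ≤ X (s₀ * 2 ^ (k + 1)) := by
    intro k hk
    have h1 := h.X_dyadic_growth hc hp hq hE (hpt k).2.2 (hpt k).2.1 (hle k hk)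
      (hξ.trans_le (hXpos k hk))
    rw [show s₀ * 2 ^ (k + 1) = s₀ * 2 ^ k + s₀ * 2 ^ k by rw [pow_succ]; ring,
      show r + 1 = p * q by rw [hr]; ring]
    exact h1
  have hind : ∀ k ≤ N, (X (s₀ * 2 ^ k) ^ r)⁻¹ ≤ ξ ^ (-r) - m * k := by
    intro k
    induction k with
    | zero =>
      intro _
      rw [Real.rpow_neg hξ.le]
      simp only [pow_zero, mul_one, Nat.cast_zero, mul_zero, sub_zero]
      exact inv_anti₀ (by positivity) (Real.rpow_le_rpow hξ.le hX hpq.le)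
    | succ k ih =>
      intro hk
      have h1 := inv_rpow_sub_of_le hpq hκ'0 (hξ.trans_le (hXpos k (by omega)))
        (hsmall k (by omega)).le (hgrow k (by omega))
      rw [← hm] at h1
      have h2 := ih (by omega)
      push_cast
      linarith
  have h1 := hind N le_rfl
  have h2 : 0 < (X (s₀ * 2 ^ N) ^ r)⁻¹ := by
    have := hξ.trans_le (hXpos N le_rfl)
    positivity
  have h3 : ξ ^ (-r) < m * N := by
    rw [inv_mul_lt_iff₀ hm0] at hN1
    exact hN1
  linarith

/-- Blow-up when both coefficients are critical. -/
theorem exists_bound_of_one (hc : 0 < c) (hp : 1 < p) (hq : 1 < q) :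
    ∃ C, 0 < C ∧ ∀ ξ s₁ X Y, 0 < ξ → ξ ≤ 1 →
      SuperPair (fun s => c * s ^ (-(1:ℝ))) (fun s => c * s ^ (-(1:ℝ))) p q 2 s₁ X Y → ξ ≤ X 2 →
      Real.exp (C * ξ ^ (-((p * q - 1) / (p + 1)))) ≤ s₁ → False := by
  have hpq : 0 < p * q - 1 := by nlinarith
  have hp1 : 0 < p + 1 := by linarith
  set K : ℝ := (4:ℝ) ^ (p + 1) * 2 ^ ((p + 1) / (p * q - 1)) with hK
  have hK0 : 0 < K := by positivity
  set κ := c * c ^ p with hκ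
  have hκ0 : 0 < κ := by positivity
  set D := (K / κ) ^ (p + 1)⁻¹ with hD
  have hD0 : 0 < D := by positivity
  refine ⟨D + 1, by positivity, fun ξ s₁ X Y hξ hξ1 h hX hs => ?_⟩
  set z := ξ ^ (-((p * q - 1) / (p + 1))) with hz
  have hz1 : 1 ≤ z := Real.one_le_rpow_of_pos_of_le_one_of_nonpos hξ hξ1 (by
    have : 0 ≤ (p * q - 1) / (p + 1) := by positivity
    linarith)
  have hs1 : 0 < s₁ := (Real.exp_pos _).trans_le hs
  have hlog2 : Real.log 2 ≤ 1 := by linarith [Real.log_two_lt_d9]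
  have hlogs : (D + 1) * z ≤ Real.log s₁ := (Real.le_log_iff_exp_le hs1).2 hs
  set L := Real.log s₁ - Real.log 2 with hL
  have hLz : D * z ≤ L := by rw [hL]; nlinarith
  have hL0 : 0 < L := lt_of_lt_of_le (by positivity) hLz
  have hmap : ∀ τ ∈ Icc (Real.log 2) (Real.log 2 + L), Real.exp τ ∈ Icc 2 s₁ := by
    intro τ hτ
    constructor
    · rw [← Real.log_le_iff_le_exp (by norm_num)]; exact hτ.1
    · rw [← Real.le_log_iff_exp_le hs1]; linarith [hτ.2]
  have hmap' : ∀ τ ∈ Ioo (Real.log 2) (Real.log 2 + L), Real.exp τ ∈ Ioo 2 s₁ := by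
    intro τ hτ
    constructor
    · rw [← Real.log_lt_iff_lt_exp (by norm_num)]; exact hτ.1
    · rw [← Real.lt_log_iff_exp_lt hs1]; linarith [hτ.2]
  have hder : ∀ {Z W : ℝ → ℝ} {a τ : ℝ}, (∃ d, HasDerivAt Z d (Real.exp τ) ∧
      c * Real.exp τ ^ (-(1:ℝ)) * W (Real.exp τ) ^ a ≤ d) →
      ∃ d, HasDerivAt (fun τ => Z (Real.exp τ)) d τ ∧ c * W (Real.exp τ) ^ a ≤ d := by
    rintro Z W a τ ⟨d, hd, hd'⟩
    refine ⟨d * Real.exp τ, hd.comp τ (Real.hasDerivAt_exp τ), ?_⟩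
    have he := Real.exp_pos τ
    rw [Real.rpow_neg_one] at hd'
    have := mul_le_mul_of_nonneg_right hd' he.le
    refine le_trans (le_of_eq ?_) this
    field_simp
  -- With s = exp τ the derivative gains a factor s, which cancels s⁻¹: the system has constant
  -- coefficients in τ, on an interval of length log s₁ - log 2.
  have hlogpair : SuperPair (fun _ => c) (fun _ => c) p q (Real.log 2) (Real.log 2 + L)
      (fun τ => X (Real.exp τ)) (fun τ => Y (Real.exp τ)) := by
    refine ⟨?_, ?_, fun τ hτ => h.nonnegX _ (hmap τ hτ), fun τ hτ => h.nonnegY _ (hmap τ hτ),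
      fun τ hτ => hder (h.derivX _ (hmap' τ hτ)), fun τ hτ => hder (h.derivY _ (hmap' τ hτ))⟩
    · exact h.contX.comp Real.continuous_exp.continuousOn hmap
    · exact h.contY.comp Real.continuous_exp.continuousOn hmap
  refine hlogpair.false_of_const hc hc hp hq hξ hL0 (by rwa [Real.exp_log (by norm_num)]) ?_
  rw [← hK, ← hκ]
  have h2 := Real.rpow_le_rpow (by positivity) hLz hp1.le
  rw [Real.mul_rpow (by positivity) (by positivity), hD, hz, ← Real.rpow_mul (by positivity),
    ← Real.rpow_mul hξ.le, inv_mul_cancel₀ hp1.ne', Real.rpow_one,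
    show -((p * q - 1) / (p + 1)) * (p + 1) = -(p * q - 1) by field_simp] at h2
  have h3 : K / κ ≤ L ^ (p + 1) * ξ ^ (p * q - 1) := by
    have := mul_le_mul_of_nonneg_right h2 (show 0 ≤ ξ ^ (p * q - 1) by positivity)
    rwa [mul_assoc, ← Real.rpow_add hξ, neg_add_cancel, Real.rpow_zero, mul_one] at this
  rw [div_le_iff₀ hκ0] at h3
  linarith

end SuperPair

/-! ### From solutions of the wave system to coupled inequalities -/

section Reduction

variable {n : ℕ} {b R l : ℝ} {i : Fin n}

theorem Jet.dampedODE {u ut utt : ℝ → EuclideanSpace ℝ (Fin n) → ℝ}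
    {ux utx uxx : Fin n → ℝ → EuclideanSpace ℝ (Fin n) → ℝ} {μ ν ε : ℝ}
    {u₀ u₁ : EuclideanSpace ℝ (Fin n) → ℝ} (hb : 0 < b)
    (hu : Jet b u ut ux utt utx uxx)
    (h0 : ∀ t ∈ Icc 0 b, ∀ x, R + t < ‖x‖ → u t x = 0) {F : ℝ → EuclideanSpace ℝ (Fin n) → ℝ}
    (heq : ∀ t ∈ Ioo 0 b, ∀ x, utt t x - (∑ i, uxx i t x) + μ / (1 + t) * ut t x
      + ν ^ 2 / (1 + t) ^ 2 * u t x = F t x) (hF : ∀ t x, 0 ≤ F t x) (hε : 0 < ε)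
    (hu0 : ∀ x, u 0 x = ε * u₀ x) (hu1 : ∀ x, ut 0 x = ε * u₁ x)
    (hu₀ : ∀ x, 0 ≤ u₀ x) (hu₁ : ∀ x, 0 ≤ u₁ x) :
    DampedODE b μ ν l (fun t => ∫ x, u t x * expWeight l i x)
      (fun t => ∫ x, ut t x * expWeight l i x) (fun t => ∫ x, utt t x * expWeight l i x)
      (fun t => ∫ x, F t x * expWeight l i x) where
  cont := hu.continuousOn_functional h0
  cont₁ := hu.continuousOn_functional_t hb h0
  deriv := fun _ ht => hu.hasDerivAt_functional h0 ht
  deriv₁ := fun _ ht => hu.hasDerivAt_functional_t hb h0 ht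
  eq := fun _ ht => hu.functional_eq hb h0 heq ht
  source_nonneg := fun t _ => integral_nonneg fun x => mul_nonneg (hF t x) (expWeight_pos l i x).le
  zero_nonneg := integral_nonneg fun x => mul_nonneg
    (by rw [hu0]; exact mul_nonneg hε.le (hu₀ x)) (expWeight_pos l i x).le
  zero_nonneg₁ := integral_nonneg fun x => mul_nonneg
    (by rw [hu1]; exact mul_nonneg hε.le (hu₁ x)) (expWeight_pos l i x).le

/-- The decay exponent in the coupled differential inequalities. -/
def couplingExponent (n : ℕ) (μ μ' p : ℝ) : ℝ :=
  ((n : ℝ) - 1) / 2 * (p - 1) + p * (μ' / 2) - μ / 2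

/-- The bound on H turns z^p into H^p exp(lpt) up to powers of 1 + t; `profile` contributes exp(-lt)
and the mass of the weight exp(lt(1-p)). The exponentials multiply to 1, and the powers of 1 + t add
up to the stated exponent. -/
theorem coupling_lower_bound {μ μ' p K D m t H z : ℝ} (ht : 0 ≤ t) (hp : 1 < p) (hK : 0 < K)
    (hD : 0 < D) (hH : 0 ≤ H) (hz : 0 ≤ z)
    (hHz : H ≤ D * (Real.exp (-l * t) * (1 + t) ^ (μ' / 2)) * z) :
    Real.exp (-1) * K ^ (1 - p) * D ^ (-p) * (1 + t) ^ (-(m * (p - 1) + p * (μ' / 2) - μ / 2))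
      * H ^ p ≤
    profile μ l t * (z ^ p * (K * Real.exp (l * t) * (1 + t) ^ m) ^ (1 - p)) := by
  have h1 : 0 < 1 + t := by linarith
  have e1 : H ^ p ≤ D ^ p * (Real.exp (-l * t * p) * (1 + t) ^ (p * (μ' / 2))) * z ^ p := by
    refine (Real.rpow_le_rpow hH hHz (by linarith)).trans_eq ?_
    rw [Real.mul_rpow (by positivity) hz, Real.mul_rpow hD.le (by positivity),
      Real.mul_rpow (Real.exp_pos _).le (by positivity), ← Real.exp_mul, ← Real.rpow_mul h1.le,
      mul_comm (μ' / 2)]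
  have e2 : Real.exp (-1) * (Real.exp (-l * t) * (1 + t) ^ (μ / 2)) ≤ profile μ l t := by
    unfold profile
    rw [mul_comm]
    refine mul_le_mul_of_nonneg_left ?_ (by positivity)
    rw [Real.exp_le_exp, neg_le_neg_iff]
    exact inv_le_one_of_one_le₀ (by linarith)
  have e3 : (K * Real.exp (l * t) * (1 + t) ^ m) ^ (1 - p) =
      K ^ (1 - p) * Real.exp (l * t * (1 - p)) * (1 + t) ^ (m * (1 - p)) := by
    rw [Real.mul_rpow (by positivity) (by positivity), Real.mul_rpow hK.le (by positivity),
      ← Real.exp_mul, ← Real.rpow_mul h1.le]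
  have e4 : D ^ (-p) * D ^ p = 1 := by rw [← Real.rpow_add hD]; simp
  have e5 : Real.exp (-l * t) * Real.exp (l * t * (1 - p)) = Real.exp (-l * t * p) := by
    rw [← Real.exp_add]; ring_nf
  have e6 : (1 + t) ^ (-(m * (p - 1) + p * (μ' / 2) - μ / 2)) * (1 + t) ^ (p * (μ' / 2)) =
      (1 + t) ^ (μ / 2) * (1 + t) ^ (m * (1 - p)) := by
    rw [← Real.rpow_add h1, ← Real.rpow_add h1]; ring_nf
  calc _ ≤ Real.exp (-1) * K ^ (1 - p) * D ^ (-p) *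
        (1 + t) ^ (-(m * (p - 1) + p * (μ' / 2) - μ / 2)) *
        (D ^ p * (Real.exp (-l * t * p) * (1 + t) ^ (p * (μ' / 2))) * z ^ p) :=
        mul_le_mul_of_nonneg_left e1 (by positivity)
    _ = Real.exp (-1) * K ^ (1 - p) * (D ^ (-p) * D ^ p) * Real.exp (-l * t * p) *
        ((1 + t) ^ (-(m * (p - 1) + p * (μ' / 2) - μ / 2)) * (1 + t) ^ (p * (μ' / 2))) * z ^ p := by
        ring
    _ = Real.exp (-1) * (Real.exp (-l * t) * (1 + t) ^ (μ / 2)) *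
        (z ^ p * (K * Real.exp (l * t) * (1 + t) ^ m) ^ (1 - p)) := by
        rw [e4, e6, ← e5, e3]; ring
    _ ≤ _ := mul_le_mul_of_nonneg_right e2 (by positivity)

/-- The differential inequality for the renormalised functional of one component. -/
theorem exists_hasDerivAt_renorm_ge {μ μ' ν ν' p K : ℝ} (hp : 1 < p)
    (hμ : 0 ≤ μ) (hμ' : 0 ≤ μ') (hl1 : 1 ≤ l) (hl : ν ^ 2 + μ + 2 ≤ l ^ 2)
    (hl' : ν' ^ 2 + μ' + 2 ≤ l ^ 2) (hδ : 0 ≤ delta μ ν) (hK : 0 < K)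
    (hKw : ∀ t, 0 ≤ t → ∫ x in Metric.closedBall 0 (R + t), expWeight l i x ≤
      K * Real.exp (l * t) * (1 + t) ^ (((n : ℝ) - 1) / 2))
    {v vt vtt : ℝ → EuclideanSpace ℝ (Fin n) → ℝ}
    {vx vtx vxx : Fin n → ℝ → EuclideanSpace ℝ (Fin n) → ℝ}
    (hv : Jet b v vt vx vtt vtx vxx) (h0 : ∀ t ∈ Icc 0 b, ∀ x, R + t < ‖x‖ → v t x = 0)
    {y y₁ y₂ z z₂ N : ℝ → ℝ}
    (hy : DampedODE b μ ν l y y₁ y₂ (fun t => ∫ x, |vt t x| ^ p * expWeight l i x))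
    (hz : DampedODE b μ' ν' l z (fun t => ∫ x, vt t x * expWeight l i x) z₂ N)
    {t : ℝ} (ht : t ∈ Ioo 0 b) (ht1 : 1 ≤ t) :
    ∃ G', HasDerivAt (renorm μ l y y₁) G' t ∧
      Real.exp (-1) * K ^ (1 - p) * (1 + 2 * l + μ') ^ (-p) *
        (1 + t) ^ (-couplingExponent n μ μ' p) *
        renorm μ' l z (fun t => ∫ x, vt t x * expWeight l i x) t ^ p ≤ G' := by
  obtain ⟨G', hG', hle⟩ := hy.exists_hasDerivAt_renorm hμ hl1 hl hδ ht
  refine ⟨G', hG', le_trans ?_ hle⟩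
  have ht' := Ioo_subset_Icc_self ht
  have h0t := ht.1.le
  have hz1 := (hz.nonneg hμ' hl' ht').2
  refine (coupling_lower_bound (μ := μ) h0t hp hK (by positivity)
    (hz.renorm_nonneg hμ' hl1 hl' ht') hz1 (hz.renorm_le hμ' hl1 hl' ht' ht1)).trans ?_
  refine mul_le_mul_of_nonneg_left ?_ (profile_pos h0t).le
  refine le_trans ?_ (rpow_mul_rpow_le_integral hp (continuous_slice hv.cont_t ht')
    (continuous_expWeight l i) (fun x => (expWeight_pos l i x).le)
    (fun x hx => hv.ut_eq_zero_of_lt_norm h0 ht hx) (by positivity) (hKw t h0t))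
  refine mul_le_mul_of_nonneg_right (Real.rpow_le_rpow hz1 ?_ (by linarith)) (by positivity)
  have hKc : IsCompact (Metric.closedBall (0 : EuclideanSpace ℝ (Fin n)) (R + b)) :=
    isCompact_closedBall _ _
  have hzero : ∀ x ∉ Metric.closedBall (0 : EuclideanSpace ℝ (Fin n)) (R + b), vt t x = 0 :=
    fun x hx => hv.ut_eq_zero_off_ball (ht.1.trans ht.2) h0 ht' hx
  have hc := continuous_slice hv.cont_t ht'
  have hw := continuous_expWeight l i
  refine integral_mono
    (integrable_of_eq_zero_off_compact hKc (hc.mul hw) fun x hx => by simp [hzero x hx])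
    (integrable_of_eq_zero_off_compact hKc (hc.abs.mul hw) fun x hx => by simp [hzero x hx])
    fun x => mul_le_mul_of_nonneg_right (le_abs_self _) (expWeight_pos l i x).le

theorem hasDerivAt_comp_sub_one {f : ℝ → ℝ} {f' s : ℝ} (h : HasDerivAt f f' (s - 1)) :
    HasDerivAt (fun s => f (s - 1)) f' s := by
  simpa using h.comp_sub_const s 1

/-- The weighted size of the data. -/
def dataMass (l : ℝ) (i : Fin n) (μ : ℝ) (u₀ u₁ : EuclideanSpace ℝ (Fin n) → ℝ) : ℝ :=
  Real.exp (-1) * ((∫ x, u₁ x * expWeight l i x) + (l + μ / 2 - 1) * ∫ x, u₀ x * expWeight l i x)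

theorem renorm_one_ge {ε μ ν : ℝ} {u ut : ℝ → EuclideanSpace ℝ (Fin n) → ℝ}
    {u₀ u₁ : EuclideanSpace ℝ (Fin n) → ℝ} {y₂ N : ℝ → ℝ}
    (h : DampedODE b μ ν l (fun t => ∫ x, u t x * expWeight l i x)
      (fun t => ∫ x, ut t x * expWeight l i x) y₂ N) (hμ : 0 ≤ μ) (hl1 : 1 ≤ l)
    (hl : ν ^ 2 + μ + 2 ≤ l ^ 2) (hδ : 0 ≤ delta μ ν) (hb : 1 ≤ b)
    (hu0 : ∀ x, u 0 x = ε * u₀ x) (hu1 : ∀ x, ut 0 x = ε * u₁ x) :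
    dataMass l i μ u₀ u₁ * ε ≤ renorm μ l (fun t => ∫ x, u t x * expWeight l i x)
      (fun t => ∫ x, ut t x * expWeight l i x) 1 := by
  refine le_trans (le_of_eq ?_) (h.renorm_zero_le hμ hl1 hl hδ ⟨zero_le_one, hb⟩)
  have e : ∀ f : EuclideanSpace ℝ (Fin n) → ℝ, ∫ x, ε * f x * expWeight l i x =
      ε * ∫ x, f x * expWeight l i x := fun f => by
    rw [← integral_const_mul]
    simp only [mul_assoc]
  simp only [hu0, hu1, e, dataMass]
  ring

variable {μ₁ ν₁ μ₂ ν₂ p q : ℝ} {u₀ u₁ v₀ v₁ : EuclideanSpace ℝ (Fin n) → ℝ}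

/-- Solutions give rise to pairs of functions satisfying coupled differential inequalities. -/
theorem exists_superPair (hμ₁ : 0 ≤ μ₁) (hμ₂ : 0 ≤ μ₂) (hδ₁ : 0 ≤ delta μ₁ ν₁)
    (hδ₂ : 0 ≤ delta μ₂ ν₂) (hp : 1 < p) (hq : 1 < q) (hR : 0 < R)
    (hu₀ : ∀ x, 0 ≤ u₀ x) (hu₁ : ∀ x, 0 ≤ u₁ x) (hv₀ : ∀ x, 0 ≤ v₀ x) (hv₁ : ∀ x, 0 ≤ v₁ x)
    (hu₀R : tsupport u₀ ⊆ Metric.closedBall 0 R) (hu₁R : tsupport u₁ ⊆ Metric.closedBall 0 R)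
    (hv₀R : tsupport v₀ ⊆ Metric.closedBall 0 R) (hv₁R : tsupport v₁ ⊆ Metric.closedBall 0 R)
    (hl1 : 1 ≤ l) (hl₁ : ν₁ ^ 2 + μ₁ + 2 ≤ l ^ 2) (hl₂ : ν₂ ^ 2 + μ₂ + 2 ≤ l ^ 2) (i : Fin n) :
    ∃ c, 0 < c ∧ ∀ ε T u v, 0 < ε → IsSolution μ₁ ν₁ μ₂ ν₂ p q ε u₀ u₁ v₀ v₁ T u v →
      ∀ b, 1 ≤ b → ENNReal.ofReal b < T → ∃ X Y,
        SuperPair (fun s => c * s ^ (-couplingExponent n μ₁ μ₂ p))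
          (fun s => c * s ^ (-couplingExponent n μ₂ μ₁ q)) p q 2 (1 + b) X Y ∧
        dataMass l i μ₁ u₀ u₁ * ε ≤ X 2 ∧ dataMass l i μ₂ v₀ v₁ * ε ≤ Y 2 := by
  have hl0 : 0 < l := by linarith
  obtain ⟨K, hK, hKw⟩ := exists_setIntegral_expWeight_le hl0 hR i
  set c₁ := Real.exp (-1) * K ^ (1 - p) * (1 + 2 * l + μ₂) ^ (-p) with hc₁
  set c₂ := Real.exp (-1) * K ^ (1 - q) * (1 + 2 * l + μ₁) ^ (-q) with hc₂
  have hc₁0 : 0 < c₁ := by positivity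
  have hc₂0 : 0 < c₂ := by positivity
  refine ⟨min c₁ c₂, lt_min hc₁0 hc₂0, fun ε T u v hε h b hb hbT => ?_⟩
  have hb0 : 0 < b := by linarith
  obtain ⟨ut, ux, utt, utx, uxx, vt, vx, vtt, vtx, vxx, hs, hut, hvt⟩ := h.exists_solvesOn hb0 hbT
  have hprop : ∀ t ∈ Icc 0 b, ∀ x, R + t < ‖x‖ → u t x = 0 ∧ v t x = 0 := fun t ht x hx =>
    h.eq_zero_of_lt_norm hμ₁ hμ₂ hp hq hu₀R hu₁R hv₀R hv₁R ht.1
      ((ENNReal.ofReal_le_ofReal ht.2).trans_lt hbT) hx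
  have hu0 : ∀ t ∈ Icc 0 b, ∀ x, R + t < ‖x‖ → u t x = 0 := fun t ht x hx => (hprop t ht x hx).1
  have hv0 : ∀ t ∈ Icc 0 b, ∀ x, R + t < ‖x‖ → v t x = 0 := fun t ht x hx => (hprop t ht x hx).2
  have hy := hs.jet_u.dampedODE (l := l) (i := i) hb0 hu0 hs.eq_u (fun t x => by positivity) hε
    h.init_u hut hu₀ hu₁
  have hz := hs.jet_v.dampedODE (l := l) (i := i) hb0 hv0 hs.eq_v (fun t x => by positivity) hε
    h.init_v hvt hv₀ hv₁
  have hmaps : ∀ s ∈ Icc 2 (1 + b), s - 1 ∈ Icc 0 b := fun s hs =>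
    ⟨by linarith [hs.1], by linarith [hs.2]⟩
  have hmaps' : ∀ s ∈ Ioo 2 (1 + b), s - 1 ∈ Ioo 0 b := fun s hs =>
    ⟨by linarith [hs.1], by linarith [hs.2]⟩
  -- The variable is s = 1 + t, so that the coefficients become pure powers of s.
  refine ⟨fun s => renorm μ₁ l (fun t => ∫ x, u t x * expWeight l i x)
      (fun t => ∫ x, ut t x * expWeight l i x) (s - 1),
    fun s => renorm μ₂ l (fun t => ∫ x, v t x * expWeight l i x)
      (fun t => ∫ x, vt t x * expWeight l i x) (s - 1),
    SuperPair.mono (α := fun s => c₁ * s ^ (-couplingExponent n μ₁ μ₂ p))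
      (β := fun s => c₂ * s ^ (-couplingExponent n μ₂ μ₁ q)) ⟨?_, ?_, ?_, ?_, ?_, ?_⟩ le_rfl le_rfl
      ?_ ?_, ?_, ?_⟩
  · exact hy.continuousOn_renorm.comp (by fun_prop) hmaps
  · exact hz.continuousOn_renorm.comp (by fun_prop) hmaps
  · exact fun s hs => hy.renorm_nonneg hμ₁ hl1 hl₁ (hmaps s hs)
  · exact fun s hs => hz.renorm_nonneg hμ₂ hl1 hl₂ (hmaps s hs)
  · intro s hs'
    obtain ⟨G', hG', hle⟩ := exists_hasDerivAt_renorm_ge hp hμ₁ hμ₂ hl1 hl₁ hl₂ hδ₁ hK hKw hs.jet_v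
      hv0 hy hz (hmaps' s hs') (by linarith [hs'.1])
    refine ⟨G', hasDerivAt_comp_sub_one hG', ?_⟩
    rwa [add_sub_cancel] at hle
  · intro s hs'
    obtain ⟨G', hG', hle⟩ := exists_hasDerivAt_renorm_ge hq hμ₂ hμ₁ hl1 hl₂ hl₁ hδ₂ hK hKw hs.jet_u
      hu0 hz hy (hmaps' s hs') (by linarith [hs'.1])
    refine ⟨G', hasDerivAt_comp_sub_one hG', ?_⟩
    rwa [add_sub_cancel] at hle
  · intro s hs'
    have : 0 < s := by linarith [hs'.1]
    exact mul_le_mul_of_nonneg_right (min_le_left _ _) (by positivity)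
  · intro s hs'
    have : 0 < s := by linarith [hs'.1]
    exact mul_le_mul_of_nonneg_right (min_le_right _ _) (by positivity)
  · have := renorm_one_ge hy hμ₁ hl1 hl₁ hδ₁ hb h.init_u hut
    norm_num
    exact this
  · have := renorm_one_ge hz hμ₂ hl1 hl₂ hδ₂ hb h.init_v hvt
    norm_num
    exact this

theorem integral_mul_expWeight_pos {f : EuclideanSpace ℝ (Fin n) → ℝ} (hf : Continuous f)
    (hfR : tsupport f ⊆ Metric.closedBall 0 R) (hf0 : ∀ x, 0 ≤ f x) (hne : f ≠ 0) :
    0 < ∫ x, f x * expWeight l i x := by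
  obtain ⟨x, hx⟩ := Function.ne_iff.1 hne
  have hcs : HasCompactSupport f :=
    (isCompact_closedBall (0 : EuclideanSpace ℝ (Fin n)) R).of_isClosed_subset
      (isClosed_tsupport f) hfR
  exact (hf.mul (continuous_expWeight l i)).integral_pos_of_hasCompactSupport_nonneg_nonzero
    hcs.mul_right (fun x => mul_nonneg (hf0 x) (expWeight_pos l i x).le)
    (mul_ne_zero hx (expWeight_pos l i x).ne')

theorem dataMass_pos {μ : ℝ} (hμ : 0 ≤ μ) (hl1 : 1 < l) (hu₀ : ∀ x, 0 ≤ u₀ x)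
    (hu₁ : ∀ x, 0 ≤ u₁ x) (hc₀ : Continuous u₀) (hc₁ : Continuous u₁)
    (hu₀R : tsupport u₀ ⊆ Metric.closedBall 0 R) (hu₁R : tsupport u₁ ⊆ Metric.closedBall 0 R)
    (hne : u₀ ≠ 0 ∨ u₁ ≠ 0) : 0 < dataMass l i μ u₀ u₁ := by
  have h0 : 0 ≤ ∫ x, u₀ x * expWeight l i x := integral_nonneg fun x =>
    mul_nonneg (hu₀ x) (expWeight_pos l i x).le
  have h1 : 0 ≤ ∫ x, u₁ x * expWeight l i x := integral_nonneg fun x =>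
    mul_nonneg (hu₁ x) (expWeight_pos l i x).le
  have hk : 0 < l + μ / 2 - 1 := by linarith
  refine mul_pos (Real.exp_pos _) ?_
  rcases hne with h | h
  · exact add_pos_of_nonneg_of_pos h1 (mul_pos hk (integral_mul_expWeight_pos hc₀ hu₀R hu₀ h))
  · exact add_pos_of_pos_of_nonneg (integral_mul_expWeight_pos hc₁ hu₁R hu₁ h)
      (mul_nonneg hk.le h0)

/-- Regularity of the data is inherited from any single solution with ε > 0; it makes the weighted
integrals of nontrivial data positive. -/
theorem IsSolution.continuous_data {ε : ℝ} {T : ℝ≥0∞} {u v : ℝ → EuclideanSpace ℝ (Fin n) → ℝ}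
    (h : IsSolution μ₁ ν₁ μ₂ ν₂ p q ε u₀ u₁ v₀ v₁ T u v) (hε : 0 < ε) :
    (Continuous u₀ ∧ Continuous u₁) ∧ Continuous v₀ ∧ Continuous v₁ := by
  obtain ⟨b, hb, hbT⟩ : ∃ b : ℝ, 0 < b ∧ ENNReal.ofReal b < T := by
    obtain ⟨b, hb⟩ := ENNReal.lt_iff_exists_real_btwn.1 h.pos
    exact ⟨b, by simpa using hb.2.1, hb.2.2⟩
  obtain ⟨ut, ux, utt, utx, uxx, vt, vx, vtt, vtx, vxx, hs, hut, hvt⟩ := h.exists_solvesOn hb hbT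
  have hmem : (0:ℝ) ∈ Icc 0 b := ⟨le_rfl, hb.le⟩
  have hscale : ∀ {f g : EuclideanSpace ℝ (Fin n) → ℝ}, Continuous g → (∀ x, g x = ε * f x) →
      Continuous f := by
    intro f g hg hgf
    have : f = fun x => ε⁻¹ * g x := by
      funext x
      rw [hgf, inv_mul_cancel_left₀ hε.ne']
    rw [this]
    exact continuous_const.mul hg
  exact ⟨⟨hscale (continuous_slice hs.jet_u.cont hmem) h.init_u,
    hscale (continuous_slice hs.jet_u.cont_t hmem) hut⟩,
    hscale (continuous_slice hs.jet_v.cont hmem) h.init_v,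
    hscale (continuous_slice hs.jet_v.cont_t hmem) hvt⟩

end Reduction

/-! ### Lifespan bounds from the blow-up of pairs -/

/-- `τ ε` is bounded by `D` as soon as no pair of functions with data at least `k ε`, `k' ε`
satisfies the coupled inequalities up to time `1 + D`. -/
def Controls (c A B p q k k' : ℝ) (τ : ℝ → ℝ≥0∞) : Prop :=
  ∀ ε, 0 < ε → ε ≤ 1 → ∀ D, 1 ≤ D →
    (∀ X Y, SuperPair (fun s => c * s ^ (-A)) (fun s => c * s ^ (-B)) p q 2 (1 + D) X Y →
      k * ε ≤ X 2 → k' * ε ≤ Y 2 → False) → τ ε ≤ ENNReal.ofReal D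

namespace Controls

variable {c A B p q k k' : ℝ} {τ : ℝ → ℝ≥0∞}

theorem swap (h : Controls c A B p q k k' τ) : Controls c B A q p k' k τ :=
  fun ε hε hε1 D hD hX => h ε hε hε1 D hD fun X Y hXY h1 h2 => hX Y X hXY.swap h2 h1

theorem mul_rpow_neg_eq {k ε a : ℝ} (hk : 0 < k) (hε : 0 < ε) :
    (k * ε) ^ (-a) = k ^ (-a) * ε ^ (-a) := Real.mul_rpow hk.le hε.le

theorem one_le_rpow_neg {ε a : ℝ} (hε : 0 < ε) (hε1 : ε ≤ 1) (ha : 0 ≤ a) : 1 ≤ ε ^ (-a) :=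
  Real.one_le_rpow_of_pos_of_le_one_of_nonpos hε hε1 (by linarith)

theorem min_one_mul_le {k ε x : ℝ} (hε : 0 < ε) (h : k * ε ≤ x) : min 1 k * ε ≤ x :=
  (mul_le_mul_of_nonneg_right (min_le_right 1 k) hε.le).trans h

theorem exists_le_rpow (h : Controls c A B p q k k' τ) (hc : 0 < c) (hp : 1 < p) (hq : 1 < q)
    (hE : 0 < (1 - A) + p * (1 - B)) (hk : 0 < k) :
    ∃ C, 0 < C ∧ ∀ ε, 0 < ε → ε ≤ 1 →
      τ ε ≤ ENNReal.ofReal (C * ε ^ (-((p * q - 1) / ((1 - A) + p * (1 - B))))) := by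
  obtain ⟨C, hC, hCb⟩ := SuperPair.exists_bound_of_pos hc hp hq hE
  set a := (p * q - 1) / ((1 - A) + p * (1 - B)) with ha
  have ha0 : 0 ≤ a := div_nonneg (by nlinarith) hE.le
  have hm : 0 < min 1 k := lt_min one_pos hk
  -- `min 1 k` keeps the initial size at most 1, and the summand 1 ensures D ≥ 1.
  refine ⟨C * (min 1 k) ^ (-a) + 1, by positivity, fun ε hε hε1 => ?_⟩
  have hz := one_le_rpow_neg hε hε1 ha0
  have hCk : 0 < C * (min 1 k) ^ (-a) := by positivity
  refine h ε hε hε1 _ (by nlinarith) fun X Y hXY hX _ => ?_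
  refine hCb (min 1 k * ε) _ X Y (by positivity) (by nlinarith [min_le_left 1 k]) hXY
    (min_one_mul_le hε hX) ?_
  rw [mul_rpow_neg_eq hm hε]
  nlinarith

theorem exists_le_exp (h : Controls c A B p q k k' τ) (hc : 0 < c) (hp : 1 < p) (hq : 1 < q)
    (hE : 0 ≤ (1 - A) + p * (1 - B)) (hk : 0 < k) :
    ∃ C, 0 < C ∧ ∀ ε, 0 < ε → ε ≤ 1 →
      τ ε ≤ ENNReal.ofReal (Real.exp (C * ε ^ (-(p * q - 1)))) := by
  obtain ⟨C, hC, hCb⟩ := SuperPair.exists_bound_of_nonneg (s₀ := 2) hc hp hq hE (by norm_num)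
  have hm : 0 < min 1 k := lt_min one_pos hk
  refine ⟨C * (min 1 k) ^ (-(p * q - 1)), by positivity, fun ε hε hε1 => ?_⟩
  refine h ε hε hε1 _ (Real.one_le_exp (by positivity)) fun X Y hXY hX _ => ?_
  refine hCb (min 1 k * ε) _ X Y (by positivity) (by nlinarith [min_le_left 1 k]) hXY
    (min_one_mul_le hε hX) ?_
  rw [mul_rpow_neg_eq hm hε, ← mul_assoc]
  linarith

theorem exists_le_exp_of_one (h : Controls c 1 1 p q k k' τ) (hc : 0 < c) (hp : 1 < p)
    (hq : 1 < q) (hk : 0 < k) :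
    ∃ C, 0 < C ∧ ∀ ε, 0 < ε → ε ≤ 1 →
      τ ε ≤ ENNReal.ofReal (Real.exp (C * ε ^ (-((p * q - 1) / (p + 1))))) := by
  obtain ⟨C, hC, hCb⟩ := SuperPair.exists_bound_of_one hc hp hq
  have hm : 0 < min 1 k := lt_min one_pos hk
  refine ⟨C * (min 1 k) ^ (-((p * q - 1) / (p + 1))), by positivity, fun ε hε hε1 => ?_⟩
  refine h ε hε hε1 _ (Real.one_le_exp (by positivity)) fun X Y hXY hX _ => ?_
  refine hCb (min 1 k * ε) _ X Y (by positivity) (by nlinarith [min_le_left 1 k]) hXY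
    (min_one_mul_le hε hX) ?_
  rw [mul_rpow_neg_eq hm hε, ← mul_assoc]
  linarith

/-- If only Y starts positive, then Y stays above k'ε on [2, 4] and feeds X, which is positive at s
= 4. The critical blow-up result restarted there still gives finiteness, though with a worse power
of ε. -/
theorem lt_top (h : Controls c A B p q k k' τ) (hc : 0 < c) (hp : 1 < p) (hq : 1 < q)
    (hE : 0 ≤ (1 - A) + p * (1 - B)) (hk : 0 < k ∨ 0 < k') {ε : ℝ} (hε : 0 < ε) (hε1 : ε ≤ 1) :
    τ ε < ⊤ := by
  rcases hk with hk | hk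
  · obtain ⟨C, -, hC⟩ := h.exists_le_exp hc hp hq hE hk
    exact (hC ε hε hε1).trans_lt ENNReal.ofReal_lt_top
  · obtain ⟨C, hC, hCb⟩ := SuperPair.exists_bound_of_nonneg (s₀ := 4) hc hp hq hE (by norm_num)
    set a := c * (2 ^ (-|A|) * 2 ^ (-A)) with ha
    have ha0 : 0 < a := by positivity
    set ξ := min 1 (a * (k' * ε) ^ p * 2) with hξ
    have hξ0 : 0 < ξ := lt_min one_pos (by positivity)
    set D := Real.exp (C * ξ ^ (-(p * q - 1))) + 3 with hD
    have hexp := Real.exp_pos (C * ξ ^ (-(p * q - 1)))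
    refine (h ε hε hε1 D (by linarith) fun X Y hXY _ hY => ?_).trans_lt ENNReal.ofReal_lt_top
    have hmono : SuperPair (fun s => c * s ^ (-A)) (fun s => c * s ^ (-B)) p q 4 (1 + D) X Y :=
      hXY.mono (by norm_num) le_rfl (fun _ _ => le_rfl) (fun _ _ => le_rfl)
    refine hCb ξ _ X Y hξ0 (min_le_left _ _) hmono ?_ (by linarith)
    have hYm := hXY.swap.X_mono (fun s hs => by
      have : 0 < s := by linarith [hs.1]
      positivity)
    have hd := hXY.dyadic hc (L := 2) (by norm_num) le_rfl (by linarith)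
    have h1 := hd.X_increment (x := 2) (y := 4) (η := k' * ε) ha0.le (by linarith) (by positivity)
      le_rfl (by norm_num) (by norm_num) (fun s hs => hY.trans (hYm ⟨le_rfl, by linarith⟩
        ⟨hs.1, by linarith [hs.2]⟩ hs.1))
    have h2 := hXY.nonnegX 2 ⟨le_rfl, by linarith⟩
    rw [show (4:ℝ) - 2 = 2 by norm_num] at h1
    exact (min_le_right _ _).trans (by linarith)

end Controls

/-- Since log(1/ε) ≤ ε^(-d)/d, polynomial lifespan bounds are absorbed by exponential ones. This is
used when Λ vanishes for σ but is positive for μ. -/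
theorem mul_rpow_le_exp {C a d : ℝ} (hC : 0 < C) (ha : 0 ≤ a) (hd : 0 < d) {ε : ℝ} (hε : 0 < ε)
    (hε1 : ε ≤ 1) : C * ε ^ (-a) ≤ Real.exp ((C + a / d) * ε ^ (-d)) := by
  have hz := Controls.one_le_rpow_neg hε hε1 hd.le
  have h1 : C ≤ Real.exp (C * ε ^ (-d)) := by
    have h2 := Real.add_one_le_exp (C * ε ^ (-d))
    nlinarith
  have h2 : ε ^ (-a) ≤ Real.exp (a / d * ε ^ (-d)) := by
    rw [Real.rpow_def_of_pos hε, Real.exp_le_exp]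
    have h3 := Real.log_le_rpow_div (x := ε⁻¹) (by positivity) hd
    rw [Real.log_inv, Real.inv_rpow hε.le, ← Real.rpow_neg hε.le] at h3
    have h4 := mul_le_mul_of_nonneg_left h3 ha
    calc Real.log ε * -a = a * -Real.log ε := by ring
      _ ≤ _ := h4
      _ = _ := by ring
  rw [add_mul, Real.exp_add]
  exact mul_le_mul h1 h2 (by positivity) (by positivity)

theorem rpow_neg_inv_le {Λ Λ' ε : ℝ} (hΛ : 0 < Λ) (hΛ' : Λ ≤ Λ') (hε : 0 < ε) (hε1 : ε ≤ 1) :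
    ε ^ (-Λ'⁻¹) ≤ ε ^ (-Λ⁻¹) :=
  Real.rpow_le_rpow_of_exponent_ge hε hε1 (neg_le_neg (inv_anti₀ hΛ hΛ'))

/-- This is where the critical exponent emerges: the damping μ' of the other component cancels. -/
theorem couplingExponent_combination {n : ℕ} {μ μ' p q : ℝ} (hpq : p * q - 1 ≠ 0) :
    (1 - couplingExponent n μ μ' p) + p * (1 - couplingExponent n μ' μ q) =
      (p * q - 1) * Lam (n + μ) p q := by
  unfold couplingExponent Lam
  field_simp
  ring

theorem le_shift (μ ν : ℝ) : μ ≤ shift μ ν := by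
  unfold shift
  split_ifs with h
  · have : √(delta μ ν) ≤ 1 := Real.sqrt_le_one.2 h.le
    linarith
  · exact le_rfl

theorem Lam_shift_le {n : ℕ} {μ ν p q : ℝ} :
    Lam (n + shift μ ν) p q ≤ Lam (n + μ) p q := by
  have := le_shift μ ν
  unfold Lam
  linarith

/-- If no solution exists for any ε > 0, the lifespan is a supremum over the empty set, that is 0,
and any constants do. Otherwise one solution makes the data continuous, and `exists_superPair`
applies with constants independent of ε. -/
theorem lifespan_controls {n : ℕ} (hn : 1 ≤ n) {μ₁ ν₁ μ₂ ν₂ p q R : ℝ}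
    (hμ₁ : 0 ≤ μ₁) (hμ₂ : 0 ≤ μ₂)
    (hδ₁ : 0 ≤ delta μ₁ ν₁) (hδ₂ : 0 ≤ delta μ₂ ν₂)
    (hp : 1 < p) (hq : 1 < q) (hR : 0 < R)
    {u₀ u₁ v₀ v₁ : EuclideanSpace ℝ (Fin n) → ℝ}
    (hu₀ : ∀ x, 0 ≤ u₀ x) (hu₁ : ∀ x, 0 ≤ u₁ x)
    (hv₀ : ∀ x, 0 ≤ v₀ x) (hv₁ : ∀ x, 0 ≤ v₁ x)
    (hu₀R : tsupport u₀ ⊆ Metric.closedBall 0 R) (hu₁R : tsupport u₁ ⊆ Metric.closedBall 0 R)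
    (hv₀R : tsupport v₀ ⊆ Metric.closedBall 0 R) (hv₁R : tsupport v₁ ⊆ Metric.closedBall 0 R) :
    ∃ c k k', 0 < c ∧ (u₀ ≠ 0 ∨ u₁ ≠ 0 → 0 < k) ∧ (v₀ ≠ 0 ∨ v₁ ≠ 0 → 0 < k') ∧
      Controls c (couplingExponent n μ₁ μ₂ p) (couplingExponent n μ₂ μ₁ q) p q k k'
        (fun ε => lifespan μ₁ ν₁ μ₂ ν₂ p q ε u₀ u₁ v₀ v₁) := by
  by_cases hex : ∃ ε T u v, 0 < ε ∧ IsSolution μ₁ ν₁ μ₂ ν₂ p q ε u₀ u₁ v₀ v₁ T u v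
  · obtain ⟨ε', T', u', v', hε', hsol⟩ := hex
    obtain ⟨⟨cu₀, cu₁⟩, cv₀, cv₁⟩ := hsol.continuous_data hε'
    set l := 2 + ν₁ ^ 2 + ν₂ ^ 2 + μ₁ + μ₂ with hl
    have hl1 : 1 < l := by nlinarith [sq_nonneg ν₁, sq_nonneg ν₂]
    have hls : 2 * l ≤ l ^ 2 := by nlinarith [sq_nonneg ν₁, sq_nonneg ν₂]
    let i : Fin n := ⟨0, hn⟩
    obtain ⟨c, hc, hcb⟩ := exists_superPair hμ₁ hμ₂ hδ₁ hδ₂ hp hq hR hu₀ hu₁ hv₀ hv₁ hu₀R hu₁R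
      hv₀R hv₁R hl1.le (by nlinarith [sq_nonneg ν₁, sq_nonneg ν₂])
      (by nlinarith [sq_nonneg ν₁, sq_nonneg ν₂]) i
    refine ⟨c, dataMass l i μ₁ u₀ u₁, dataMass l i μ₂ v₀ v₁, hc,
      dataMass_pos hμ₁ hl1 hu₀ hu₁ cu₀ cu₁ hu₀R hu₁R,
      dataMass_pos hμ₂ hl1 hv₀ hv₁ cv₀ cv₁ hv₀R hv₁R, fun ε hε _ D hD hno => ?_⟩
    refine sSup_le ?_
    rintro T ⟨u, v, h⟩
    by_contra hT
    obtain ⟨X, Y, hXY, hX, hY⟩ := hcb ε T u v hε h D hD (not_le.1 hT)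
    exact hno X Y hXY hX hY
  · refine ⟨1, 1, 1, one_pos, fun _ => one_pos, fun _ => one_pos, fun ε hε _ D _ _ => ?_⟩
    refine sSup_le ?_
    rintro T ⟨u, v, h⟩
    exact absurd ⟨ε, T, u, v, hε, h⟩ hex

end ScaleInvariantSystem

end

/-! ### The lifespan estimates -/

open ScaleInvariantSystem in
theorem theorem2 (n : ℕ) (hn : 1 ≤ n) (μ₁ ν₁ μ₂ ν₂ p q R : ℝ)
    (hμ₁ : 0 ≤ μ₁) (hμ₂ : 0 ≤ μ₂)
    (hδ₁ : 0 ≤ delta μ₁ ν₁) (hδ₂ : 0 ≤ delta μ₂ ν₂)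
    (hp : 1 < p) (hq : 1 < q) (hR : 0 < R)
    (u₀ u₁ v₀ v₁ : EuclideanSpace ℝ (Fin n) → ℝ)
    (hu₀ : ∀ x, 0 ≤ u₀ x) (hu₁ : ∀ x, 0 ≤ u₁ x)
    (hv₀ : ∀ x, 0 ≤ v₀ x) (hv₁ : ∀ x, 0 ≤ v₁ x)
    (hu₀R : tsupport u₀ ⊆ Metric.closedBall 0 R) (hu₁R : tsupport u₁ ⊆ Metric.closedBall 0 R)
    (hv₀R : tsupport v₀ ⊆ Metric.closedBall 0 R) (hv₁R : tsupport v₁ ⊆ Metric.closedBall 0 R)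
    (hu₀δ : delta μ₁ ν₁ < 1 → u₀ = 0) (hv₀δ : delta μ₂ ν₂ < 1 → v₀ = 0)
    (hdata : (u₀ ≠ 0 ∨ u₁ ≠ 0) ∨ (v₀ ≠ 0 ∨ v₁ ≠ 0))
    (hΩ : 0 ≤ Om n (shift μ₁ ν₁) (shift μ₂ ν₂) p q) :
    ∃ ε₀ : ℝ, 0 < ε₀ ∧ ∃ C : ℝ, 0 < C ∧ ∀ ε : ℝ, 0 < ε → ε ≤ ε₀ →
      lifespan μ₁ ν₁ μ₂ ν₂ p q ε u₀ u₁ v₀ v₁ < ⊤ ∧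
      ((Lam (n + shift μ₁ ν₁) p q = Om n (shift μ₁ ν₁) (shift μ₂ ν₂) p q → u₀ ≠ 0 ∨ u₁ ≠ 0) →
        (Lam (n + shift μ₂ ν₂) q p = Om n (shift μ₁ ν₁) (shift μ₂ ν₂) p q → v₀ ≠ 0 ∨ v₁ ≠ 0) →
        (0 < Om n (shift μ₁ ν₁) (shift μ₂ ν₂) p q →
          lifespan μ₁ ν₁ μ₂ ν₂ p q ε u₀ u₁ v₀ v₁ ≤
            ENNReal.ofReal (C * ε ^ (-(Om n (shift μ₁ ν₁) (shift μ₂ ν₂) p q)⁻¹))) ∧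
        (Om n (shift μ₁ ν₁) (shift μ₂ ν₂) p q = 0 →
          lifespan μ₁ ν₁ μ₂ ν₂ p q ε u₀ u₁ v₀ v₁ ≤
            ENNReal.ofReal (Real.exp (C * ε ^ (-(p * q - 1))))) ∧
        (Lam (n + shift μ₁ ν₁) p q = 0 → Lam (n + shift μ₂ ν₂) q p = 0 →
          lifespan μ₁ ν₁ μ₂ ν₂ p q ε u₀ u₁ v₀ v₁ ≤
            ENNReal.ofReal (Real.exp
              (C * ε ^ (-min ((p * q - 1) / (p + 1)) ((p * q - 1) / (q + 1))))))) := by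
  obtain ⟨c, k, k', hc, hk, hk', hctl⟩ := lifespan_controls (ν₁ := ν₁) (ν₂ := ν₂) hn hμ₁ hμ₂ hδ₁ hδ₂
    hp hq hR hu₀ hu₁ hv₀ hv₁ hu₀R hu₁R hv₀R hv₁R
  have hpq : 0 < p * q - 1 := by nlinarith
  have hqp : q * p - 1 = p * q - 1 := by ring
  have hE₁ : (1 - couplingExponent n μ₁ μ₂ p) + p * (1 - couplingExponent n μ₂ μ₁ q) =
      (p * q - 1) * Lam (n + μ₁) p q := couplingExponent_combination hpq.ne'
  have hE₂ : (1 - couplingExponent n μ₂ μ₁ q) + q * (1 - couplingExponent n μ₁ μ₂ p) =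
      (p * q - 1) * Lam (n + μ₂) q p := by
    rw [couplingExponent_combination (by rw [hqp]; exact hpq.ne'), hqp]
  have hL₁ : Lam (n + shift μ₁ ν₁) p q ≤ Lam (n + μ₁) p q := Lam_shift_le
  have hL₂ : Lam (n + shift μ₂ ν₂) q p ≤ Lam (n + μ₂) q p := Lam_shift_le
  set τ : ℝ → ℝ≥0∞ := fun ε => lifespan μ₁ ν₁ μ₂ ν₂ p q ε u₀ u₁ v₀ v₁ with hτ
  set Λ₁ := Lam (n + shift μ₁ ν₁) p q with hΛ₁
  set Λ₂ := Lam (n + shift μ₂ ν₂) q p with hΛ₂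
  have hOm : Om n (shift μ₁ ν₁) (shift μ₂ ν₂) p q = max Λ₁ Λ₂ := rfl
  rw [hOm] at hΩ ⊢
  set Ω := max Λ₁ Λ₂ with hΩdef
  have hmax : Λ₁ = Ω ∨ Λ₂ = Ω := (max_choice Λ₁ Λ₂).imp Eq.symm Eq.symm
  have hfin : ∀ ε, 0 < ε → ε ≤ 1 → τ ε < ⊤ := by
    intro ε hε hε1
    have hkk : 0 < k ∨ 0 < k' := hdata.imp hk hk'
    rcases hmax with h | h
    · exact hctl.lt_top hc hp hq (by rw [hE₁]; exact mul_nonneg hpq.le (by linarith)) hkk hε hε1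
    · exact hctl.swap.lt_top hc hq hp (by rw [hE₂]; exact mul_nonneg hpq.le (by linarith))
        hkk.symm hε hε1
  have hpoly₁ : 0 < Lam (n + μ₁) p q → 0 < k → ∃ C, 0 < C ∧ ∀ ε, 0 < ε → ε ≤ 1 →
      τ ε ≤ ENNReal.ofReal (C * ε ^ (-(Lam (n + μ₁) p q)⁻¹)) := by
    intro hpos hk0
    have := hctl.exists_le_rpow hc hp hq (by rw [hE₁]; positivity) hk0
    rwa [hE₁, div_mul_cancel_left₀ hpq.ne'] at this
  have hpoly₂ : 0 < Lam (n + μ₂) q p → 0 < k' → ∃ C, 0 < C ∧ ∀ ε, 0 < ε → ε ≤ 1 →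
      τ ε ≤ ENNReal.ofReal (C * ε ^ (-(Lam (n + μ₂) q p)⁻¹)) := by
    intro hpos hk0
    have := hctl.swap.exists_le_rpow hc hq hp (by rw [hE₂]; positivity) hk0
    rwa [hE₂, hqp, div_mul_cancel_left₀ hpq.ne'] at this
  have hsub : ∃ C, 0 < C ∧ ∀ ε, 0 < ε → ε ≤ 1 → (Λ₁ = Ω → u₀ ≠ 0 ∨ u₁ ≠ 0) →
      (Λ₂ = Ω → v₀ ≠ 0 ∨ v₁ ≠ 0) → 0 < Ω → τ ε ≤ ENNReal.ofReal (C * ε ^ (-Ω⁻¹)) := by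
    -- The constant must precede ε and these hypotheses; if they fail, any constant works.
    by_cases hyp : (Λ₁ = Ω → u₀ ≠ 0 ∨ u₁ ≠ 0) ∧ (Λ₂ = Ω → v₀ ≠ 0 ∨ v₁ ≠ 0) ∧ 0 < Ω
    · obtain ⟨h1, h2, h3⟩ := hyp
      rcases hmax with h | h
      · obtain ⟨C, hC, hCb⟩ := hpoly₁ (by linarith) (hk (h1 h))
        refine ⟨C, hC, fun ε hε hε1 _ _ _ => (hCb ε hε hε1).trans (ENNReal.ofReal_le_ofReal ?_)⟩
        exact mul_le_mul_of_nonneg_left (rpow_neg_inv_le h3 (by linarith) hε hε1) hC.le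
      · obtain ⟨C, hC, hCb⟩ := hpoly₂ (by linarith) (hk' (h2 h))
        refine ⟨C, hC, fun ε hε hε1 _ _ _ => (hCb ε hε hε1).trans (ENNReal.ofReal_le_ofReal ?_)⟩
        exact mul_le_mul_of_nonneg_left (rpow_neg_inv_le h3 (by linarith) hε hε1) hC.le
    · exact ⟨1, one_pos, fun ε _ _ h1 h2 h3 => absurd ⟨h1, h2, h3⟩ hyp⟩
  have hcrit : ∃ C, 0 < C ∧ ∀ ε, 0 < ε → ε ≤ 1 → (Λ₁ = Ω → u₀ ≠ 0 ∨ u₁ ≠ 0) →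
      (Λ₂ = Ω → v₀ ≠ 0 ∨ v₁ ≠ 0) →
      τ ε ≤ ENNReal.ofReal (Real.exp (C * ε ^ (-(p * q - 1)))) := by
    by_cases hyp : (Λ₁ = Ω → u₀ ≠ 0 ∨ u₁ ≠ 0) ∧ (Λ₂ = Ω → v₀ ≠ 0 ∨ v₁ ≠ 0)
    · obtain ⟨h1, h2⟩ := hyp
      rcases hmax with h | h
      · obtain ⟨C, hC, hCb⟩ := hctl.exists_le_exp hc hp hq
          (by rw [hE₁]; exact mul_nonneg hpq.le (by linarith)) (hk (h1 h))
        exact ⟨C, hC, fun ε hε hε1 _ _ => hCb ε hε hε1⟩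
      · obtain ⟨C, hC, hCb⟩ := hctl.swap.exists_le_exp hc hq hp
          (by rw [hE₂]; exact mul_nonneg hpq.le (by linarith)) (hk' (h2 h))
        rw [hqp] at hCb
        exact ⟨C, hC, fun ε hε hε1 _ _ => hCb ε hε hε1⟩
    · exact ⟨1, one_pos, fun ε _ _ h1 h2 => absurd ⟨h1, h2⟩ hyp⟩
  set d := min ((p * q - 1) / (p + 1)) ((p * q - 1) / (q + 1)) with hd
  have hd0 : 0 < d := lt_min (by positivity) (by positivity)
  have hboth : ∃ C, 0 < C ∧ ∀ ε, 0 < ε → ε ≤ 1 → (Λ₁ = Ω → u₀ ≠ 0 ∨ u₁ ≠ 0) →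
      (Λ₂ = Ω → v₀ ≠ 0 ∨ v₁ ≠ 0) → Λ₁ = 0 → Λ₂ = 0 →
      τ ε ≤ ENNReal.ofReal (Real.exp (C * ε ^ (-d))) := by
    by_cases hyp : ((Λ₁ = Ω → u₀ ≠ 0 ∨ u₁ ≠ 0) ∧ (Λ₂ = Ω → v₀ ≠ 0 ∨ v₁ ≠ 0)) ∧ Λ₁ = 0 ∧ Λ₂ = 0
    · obtain ⟨⟨h1, h2⟩, h3, h4⟩ := hyp
      have hΩ0 : Ω = 0 := by rw [hΩdef, h3, h4, max_self]
      have hk0 : 0 < k := hk (h1 (by rw [h3, hΩ0]))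
      have hk0' : 0 < k' := hk' (h2 (by rw [h4, hΩ0]))
      -- If Λ with μ in place of σ is positive for one component, the problem is in fact subcritical
      -- and the polynomial bound is stronger than needed. Otherwise both vanish.
      rcases (h3 ▸ hL₁).lt_or_eq with hpos | hz₁
      · obtain ⟨C, hC, hCb⟩ := hpoly₁ hpos hk0
        exact ⟨_, by positivity, fun ε hε hε1 _ _ _ _ => (hCb ε hε hε1).trans
          (ENNReal.ofReal_le_ofReal (mul_rpow_le_exp hC (inv_pos.2 hpos).le hd0 hε hε1))⟩
      rcases (h4 ▸ hL₂).lt_or_eq with hpos | hz₂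
      · obtain ⟨C, hC, hCb⟩ := hpoly₂ hpos hk0'
        exact ⟨_, by positivity, fun ε hε hε1 _ _ _ _ => (hCb ε hε hε1).trans
          (ENNReal.ofReal_le_ofReal (mul_rpow_le_exp hC (inv_pos.2 hpos).le hd0 hε hε1))⟩
      rw [← hz₁, mul_zero] at hE₁
      rw [← hz₂, mul_zero] at hE₂
      -- The two vanishing combinations form a linear system in 1 - A and 1 - B with determinant 1 -
      -- pq ≠ 0, hence A = B = 1.
      have hA : couplingExponent n μ₁ μ₂ p = 1 := by
        have : (p * q - 1) * (1 - couplingExponent n μ₁ μ₂ p) = 0 := by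
          linear_combination p * hE₂ - hE₁
        linarith [(mul_eq_zero.1 this).resolve_left hpq.ne']
      have hB : couplingExponent n μ₂ μ₁ q = 1 := by
        rw [hA] at hE₂
        linarith
      rw [hA, hB] at hctl
      obtain ⟨C₁, hC₁, hCb₁⟩ := hctl.exists_le_exp_of_one hc hp hq hk0
      obtain ⟨C₂, hC₂, hCb₂⟩ := hctl.swap.exists_le_exp_of_one hc hq hp hk0'
      rw [hqp] at hCb₂
      rcases min_choice ((p * q - 1) / (p + 1)) ((p * q - 1) / (q + 1)) with h | h
      · exact ⟨C₁, hC₁, fun ε hε hε1 _ _ _ _ => by rw [hd, h]; exact hCb₁ ε hε hε1⟩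
      · exact ⟨C₂, hC₂, fun ε hε hε1 _ _ _ _ => by rw [hd, h]; exact hCb₂ ε hε hε1⟩
    · exact ⟨1, one_pos, fun ε _ _ h1 h2 h3 h4 => absurd ⟨⟨h1, h2⟩, h3, h4⟩ hyp⟩
  obtain ⟨C₁, hC₁, hCb₁⟩ := hsub
  obtain ⟨C₂, hC₂, hCb₂⟩ := hcrit
  obtain ⟨C₃, hC₃, hCb₃⟩ := hboth
  refine ⟨1, one_pos, C₁ + C₂ + C₃, by positivity, fun ε hε hε1 => ⟨hfin ε hε hε1,
    fun h1 h2 => ⟨fun h3 => ?_, fun _ => ?_, fun h3 h4 => ?_⟩⟩⟩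
  · refine (hCb₁ ε hε hε1 h1 h2 h3).trans (ENNReal.ofReal_le_ofReal ?_)
    exact mul_le_mul_of_nonneg_right (by linarith) (by positivity)
  · refine (hCb₂ ε hε hε1 h1 h2).trans (ENNReal.ofReal_le_ofReal (Real.exp_le_exp.2 ?_))
    exact mul_le_mul_of_nonneg_right (by linarith) (by positivity)
  · refine (hCb₃ ε hε hε1 h1 h2 h3 h4).trans (ENNReal.ofReal_le_ofReal (Real.exp_le_exp.2 ?_))
    exact mul_le_mul_of_nonneg_right (by linarith) (by positivity)
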